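/- For a convergent power series $f\in\mathbb C\{x,y\}$ without multiple factors and with $f(0,0)=0$, let $(C,0)=\{f=0\}$ be the corresponding germ of a reduced plane analytic curve, with local ring $\mathcal O=\mathbb C\{x,y\}/(f)$, and let $f=u f_1\cdots f_k$ ($u$ a unit) be its decomposition into irreducible factors, so that $(C,0)=(C_1,0)\cup\dots\cup(C_k,0)$ with $C_i=\{f_i=0\}$ irreducible of multiplicity $m_i=\operatorname{ord} f_i$ at $0$. Let $\delta=\dim_{\mathbb C}\overline{\mathcal O}/\mathcal O$, where $\overline{\mathcal O}$ is the integral closure of $\mathcal O$ in its total ring of fractions; this dimension is finite. Put $$c_{v}(f)=\sum_{i=1}^k(m_i-1),\qquad n_{v}(f)=\delta-\sum_{i=1}^k(m_i-1)$$ (the numbers of virtual cusps and of virtual nodes of the germ). Then 1. $c_v(f)\ge 0$ and $n_v(f)\ge 0$; 2. if the germ is an ordinary cusp (analytically isomorphic to the germ $y^2=x^3$ at the origin), then $c_v(f)=1$ and $n_v(f)=0$; 3. if the germ is an ordinary node (analytically isomorphic to the germ $xy=0$ at the origin), then $c_v(f)=0$ and $n_v(f)=1$. Let $C\subset\mathbb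 P^2$ be a reduced complex projective plane curve. Its set $\operatorname{Sing} C$ of singular points is finite and the $\delta$-invariants $\delta_p$ of its germs at these points are finite. Let $c_{v,p}$, $n_{v,p}$ be the numbers of virtual cusps and virtual nodes of the germ $(C,p)$ and put $$c_v=\sum_{p\in\operatorname{Sing} C}c_{v,p},\qquad n_v=\sum_{p\in\operatorname{Sing} C}n_{v,p}.$$ Then 1. $c_v\ge 0$ and $n_v\ge 0$; 2. if $C$ is cuspidal, that is, every singular point of $C$ is an ordinary cusp or an ordinary node, then $c_v$ and $n_v$ are equal respectively to the number of ordinary cusps and the number of ordinary nodes of $C$. -/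

import Mathlib

noncomputable section

open Finset MvPolynomial

namespace PlaneCurve

/-! ### The local ring `ℂ{x, y}` of convergent power series -/

/-- A formal power series in two variables over `ℂ` is convergent if it converges absolutely at
`(r, r)` for some `r > 0`, that is, on some polydisc around the origin. -/
def IsConvergent (f : MvPowerSeries (Fin 2) ℂ) : Prop :=
  ∃ r : ℝ, 0 < r ∧ Summable fun n : Fin 2 →₀ ℕ => ‖MvPowerSeries.coeff n f‖ * r ^ n.degree

theorem IsConvergent.of_le {f : MvPowerSeries (Fin 2) ℂ} {r s : ℝ} (hs : 0 < s) (hsr : s ≤ r)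
    (h : Summable fun n : Fin 2 →₀ ℕ => ‖MvPowerSeries.coeff n f‖ * r ^ n.degree) :
    Summable fun n : Fin 2 →₀ ℕ => ‖MvPowerSeries.coeff n f‖ * s ^ n.degree :=
  Summable.of_nonneg_of_le (fun n => by positivity) (fun n => by gcongr) h

theorem isConvergent_coe (P : MvPolynomial (Fin 2) ℂ) :
    IsConvergent (P : MvPowerSeries (Fin 2) ℂ) := by
  refine ⟨1, one_pos, summable_of_ne_finset_zero (s := P.support) fun n hn => ?_⟩
  have : MvPolynomial.coeff n P = 0 := by simpa using hn
  simp [this]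

theorem IsConvergent.add {f g : MvPowerSeries (Fin 2) ℂ} (hf : IsConvergent f)
    (hg : IsConvergent g) : IsConvergent (f + g) := by
  obtain ⟨r, hr, hf⟩ := hf
  obtain ⟨s, hs, hg⟩ := hg
  have ht : 0 < min r s := lt_min hr hs
  refine ⟨min r s, ht, Summable.of_nonneg_of_le (fun n => by positivity) (fun n => ?_)
    ((IsConvergent.of_le ht (min_le_left _ _) hf).add
      (IsConvergent.of_le ht (min_le_right _ _) hg))⟩
  rw [← add_mul, map_add]
  gcongr
  exact norm_add_le _ _

theorem IsConvergent.mul {f g : MvPowerSeries (Fin 2) ℂ} (hf : IsConvergent f)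
    (hg : IsConvergent g) : IsConvergent (f * g) := by
  obtain ⟨r, hr, hf⟩ := hf
  obtain ⟨s, hs, hg⟩ := hg
  have ht : 0 < min r s := lt_min hr hs
  have key := summable_sum_mul_antidiagonal_of_summable_mul
    (Summable.mul_of_nonneg (IsConvergent.of_le ht (min_le_left _ _) hf)
      (IsConvergent.of_le ht (min_le_right _ _) hg)
      (fun n => by positivity) (fun n => by positivity))
  refine ⟨min r s, ht, Summable.of_nonneg_of_le (fun n => by positivity) (fun n => ?_) key⟩
  classical
  rw [MvPowerSeries.coeff_mul]
  calc _ ≤ (∑ p ∈ antidiagonal n, ‖MvPowerSeries.coeff p.1 f * MvPowerSeries.coeff p.2 g‖)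
        * min r s ^ n.degree := by
        gcongr
        exact norm_sum_le _ _
    _ = _ := by
        rw [Finset.sum_mul]
        refine Finset.sum_congr rfl fun p hp => ?_
        rw [← HasAntidiagonal.mem_antidiagonal.1 hp, map_add, pow_add, norm_mul]
        ring

/-- The ring `ℂ{x, y}` of convergent power series, that is, the local ring of germs of
holomorphic functions at the origin of `ℂ²`. -/
def convergentSeries : Subalgebra ℂ (MvPowerSeries (Fin 2) ℂ) where
  carrier := {f | IsConvergent f}
  mul_mem' := IsConvergent.mul
  add_mem' := IsConvergent.add
  algebraMap_mem' c := by
    have := isConvergent_coe (MvPolynomial.C c)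
    rwa [MvPolynomial.coe_C] at this

/-- The germ at the origin of a polynomial in two variables. -/
def polyGerm (P : MvPolynomial (Fin 2) ℂ) : convergentSeries :=
  ⟨(P : MvPowerSeries (Fin 2) ℂ), isConvergent_coe P⟩

/-- The order of a germ: the least degree of a monomial that occurs in it (and `⊤` for `0`). -/
def germOrder (f : convergentSeries) : ℕ∞ := (f : MvPowerSeries (Fin 2) ℂ).order

theorem germOrder_mul (f g : convergentSeries) :
    germOrder (f * g) = germOrder f + germOrder g := MvPowerSeries.order_mul _ _

theorem isConvergent_inv {f : MvPowerSeries (Fin 2) ℂ} (hf : IsConvergent f)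
    (h0 : MvPowerSeries.constantCoeff f ≠ 0) : IsConvergent f⁻¹ := by
  classical
  obtain ⟨r, hr, hf⟩ := hf
  set c : ℝ := ‖(MvPowerSeries.constantCoeff f)⁻¹‖ with hc
  have hc0 : 0 < c := by simpa [hc] using h0
  set S : ℝ := ∑' n : Fin 2 →₀ ℕ, ‖MvPowerSeries.coeff n f‖ * r ^ n.degree with hS
  have hS0 : 0 ≤ S := tsum_nonneg fun n => by positivity
  obtain ⟨t, ht0, ht1, ht⟩ : ∃ t : ℝ, 0 < t ∧ t ≤ 1 ∧ c * (t * S) ≤ 1 / 2 := by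
    refine ⟨1 / (2 * c * S + 1), by positivity, ?_, ?_⟩
    · rw [div_le_one (by positivity)]
      nlinarith [mul_nonneg hc0.le hS0]
    · rw [show c * (1 / (2 * c * S + 1) * S) = (c * S) / (2 * c * S + 1) by ring,
        div_le_iff₀ (by positivity)]
      nlinarith [mul_nonneg hc0.le hS0]
  set a : (Fin 2 →₀ ℕ) → ℝ := fun n => ‖MvPowerSeries.coeff n f‖ * (t * r) ^ n.degree with ha
  set b : (Fin 2 →₀ ℕ) → ℝ := fun n => ‖MvPowerSeries.coeff n f⁻¹‖ * (t * r) ^ n.degree with hb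
  have ha0 : ∀ n, 0 ≤ a n := fun n => by positivity
  have hb0 : ∀ n, 0 ≤ b n := fun n => by positivity
  have hat : ∀ n, n ≠ 0 → a n ≤ t * (‖MvPowerSeries.coeff n f‖ * r ^ n.degree) := by
    intro n hn
    have hd : n.degree ≠ 0 := fun h => hn ((Finsupp.degree_eq_zero_iff n).1 h)
    have : t ^ n.degree ≤ t := pow_le_of_le_one ht0.le ht1 hd
    simp only [ha, mul_pow]
    calc _ = t ^ n.degree * (‖MvPowerSeries.coeff n f‖ * r ^ n.degree) := by ring
      _ ≤ _ := by gcongr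
  have haS : ∀ s : Finset (Fin 2 →₀ ℕ), ∑ n ∈ s.erase 0, a n ≤ t * S := by
    intro s
    calc _ ≤ ∑ n ∈ s.erase 0, t * (‖MvPowerSeries.coeff n f‖ * r ^ n.degree) :=
          Finset.sum_le_sum fun n hn => hat n (Finset.ne_of_mem_erase hn)
      _ = t * ∑ n ∈ s.erase 0, ‖MvPowerSeries.coeff n f‖ * r ^ n.degree := by
          rw [Finset.mul_sum]
      _ ≤ _ := by
          gcongr
          exact hf.sum_le_tsum _ fun n _ => by positivity
  have hrec : ∀ n, n ≠ 0 →
      b n ≤ c * ∑ p ∈ (antidiagonal n).filter (fun p => p.1 ≠ 0), a p.1 * b p.2 := by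
    intro n hn
    simp only [hb]
    rw [MvPowerSeries.coeff_inv, if_neg hn, norm_mul, norm_neg, mul_assoc]
    gcongr
    rw [← Finset.sum_filter]
    calc _ ≤ (∑ p ∈ (antidiagonal n).filter (fun p => p.2 < n),
          ‖MvPowerSeries.coeff p.1 f * MvPowerSeries.coeff p.2 f⁻¹‖) * (t * r) ^ n.degree := by
          gcongr
          exact norm_sum_le _ _
      _ = ∑ p ∈ (antidiagonal n).filter (fun p => p.2 < n), a p.1 * b p.2 := by
          rw [Finset.sum_mul]
          refine Finset.sum_congr rfl fun p hp => ?_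
          rw [← HasAntidiagonal.mem_antidiagonal.1 (Finset.mem_filter.1 hp).1, map_add, pow_add, norm_mul]
          simp only [ha, hb]
          ring
      _ ≤ _ := by
          refine Finset.sum_le_sum_of_subset_of_nonneg (fun p hp => ?_)
            fun p _ _ => mul_nonneg (ha0 _) (hb0 _)
          rw [Finset.mem_filter] at hp ⊢
          refine ⟨hp.1, fun h => ?_⟩
          have h1 := HasAntidiagonal.mem_antidiagonal.1 hp.1
          rw [h, zero_add] at h1
          exact hp.2.ne h1
  have hbound : ∀ N : Fin 2 →₀ ℕ, ∑ n ∈ Finset.Iic N, b n ≤ 2 * c := by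
    intro N
    have h1 : ∑ n ∈ Finset.Iic N, b n = b 0 + ∑ n ∈ (Finset.Iic N).erase 0, b n :=
      (Finset.add_sum_erase _ _ (by simp)).symm
    have hb00 : b 0 = c := by simp [hb, hc]
    have h2 : ∑ n ∈ (Finset.Iic N).erase 0, b n ≤
        c * ∑ n ∈ (Finset.Iic N).erase 0,
          ∑ p ∈ (antidiagonal n).filter (fun p => p.1 ≠ 0), a p.1 * b p.2 := by
      rw [Finset.mul_sum]
      exact Finset.sum_le_sum fun n hn => hrec n (Finset.ne_of_mem_erase hn)
    have h3 : ∑ n ∈ (Finset.Iic N).erase 0,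
          ∑ p ∈ (antidiagonal n).filter (fun p => p.1 ≠ 0), a p.1 * b p.2 ≤
        (∑ i ∈ (Finset.Iic N).erase 0, a i) * ∑ j ∈ Finset.Iic N, b j := by
      rw [Finset.sum_mul_sum, ← Finset.sum_product', Finset.sum_sigma']
      have hinj : Set.InjOn (fun x : (_ : Fin 2 →₀ ℕ) × ((Fin 2 →₀ ℕ) × (Fin 2 →₀ ℕ)) => x.2)
          (((Finset.Iic N).erase 0).sigma fun n =>
            (antidiagonal n).filter (fun p => p.1 ≠ 0)) := by
        rintro ⟨n, p⟩ hx ⟨m, q⟩ hy hpq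
        simp only [Finset.mem_coe, Finset.mem_sigma, Finset.mem_filter,
          HasAntidiagonal.mem_antidiagonal] at hx hy
        obtain ⟨-, rfl, -⟩ := hx
        obtain ⟨-, rfl, -⟩ := hy
        simp only at hpq
        rw [hpq]
      rw [← Finset.sum_image (f := fun p : (Fin 2 →₀ ℕ) × (Fin 2 →₀ ℕ) => a p.1 * b p.2) hinj]
      refine Finset.sum_le_sum_of_subset_of_nonneg (fun p hp => ?_)
        fun p _ _ => mul_nonneg (ha0 _) (hb0 _)
      obtain ⟨⟨n, q⟩, hx, rfl⟩ := Finset.mem_image.1 hp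
      simp only [Finset.mem_sigma, Finset.mem_erase, Finset.mem_Iic, Finset.mem_filter,
        HasAntidiagonal.mem_antidiagonal] at hx
      simp only [Finset.mem_product, Finset.mem_erase, Finset.mem_Iic]
      obtain ⟨⟨-, hN⟩, rfl, hq⟩ := hx
      exact ⟨⟨hq, le_trans le_self_add hN⟩, le_trans le_add_self hN⟩
    have hnn : 0 ≤ ∑ j ∈ Finset.Iic N, b j := Finset.sum_nonneg fun j _ => hb0 j
    have h4 : c * ((∑ i ∈ (Finset.Iic N).erase 0, a i) * ∑ j ∈ Finset.Iic N, b j) ≤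
        1 / 2 * ∑ j ∈ Finset.Iic N, b j := by
      calc _ = (c * ∑ i ∈ (Finset.Iic N).erase 0, a i) * ∑ j ∈ Finset.Iic N, b j := by ring
        _ ≤ _ := by
          gcongr
          refine le_trans ?_ ht
          gcongr
          exact haS _
    have h5 := mul_le_mul_of_nonneg_left h3 hc0.le
    linarith
  refine ⟨t * r, by positivity, summable_of_sum_le (c := 2 * c) hb0 fun s => ?_⟩
  refine le_trans (Finset.sum_le_sum_of_subset_of_nonneg (fun n hn => ?_) fun n _ _ => hb0 n)
    (hbound (s.sup id))
  exact Finset.mem_Iic.2 (Finset.le_sup (f := id) hn)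

theorem isUnit_of_germOrder_eq_zero {f : convergentSeries} (h : germOrder f = 0) :
    IsUnit f := by
  have h0 : MvPowerSeries.constantCoeff (f : MvPowerSeries (Fin 2) ℂ) ≠ 0 := fun h' =>
    MvPowerSeries.order_ne_zero_iff_constCoeff_eq_zero.2 h' h
  refine IsUnit.of_mul_eq_one ⟨_, isConvergent_inv f.2 h0⟩ (Subtype.ext ?_)
  exact MvPowerSeries.mul_inv_cancel _ h0

instance : WfDvdMonoid convergentSeries where
  wf := by
    refine Subrelation.wf (r := InvImage (· < ·) germOrder) ?_ (InvImage.wf _ wellFounded_lt)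
    rintro f g ⟨hf, x, hx, rfl⟩
    change germOrder f < germOrder (f * x)
    rw [germOrder_mul]
    have hx0 : germOrder x ≠ 0 := fun h => hx (isUnit_of_germOrder_eq_zero h)
    have hft : germOrder f ≠ ⊤ := fun h =>
      hf (Subtype.ext (MvPowerSeries.order_eq_top_iff.1 h))
    exact ((ENat.lt_add_one_iff hft).2 le_rfl).trans_le
      (add_le_add le_rfl (Order.one_le_iff_ne_zero.2 hx0))

/-! ### Germs of plane curves -/

open scoped Classical in
/-- The irreducible components (branches) of the germ `f = 0`: irreducible convergent series
whose product is `f` up to a unit. Since `ℂ{x, y}` is factorial, they are unique up to order and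
units. -/
def branches (f : convergentSeries) : Multiset convergentSeries :=
  if h : f = 0 then 0 else (WfDvdMonoid.exists_factors f h).choose

/-- The multiplicity at the origin of the germ `f = 0`, for `f ≠ 0`. -/
def germMultiplicity (f : convergentSeries) : ℕ := (germOrder f).toNat

/-- The local ring `𝒪 = ℂ{x, y} / (f)` of the germ `f = 0`. -/
abbrev GermRing (f : convergentSeries) : Type := convergentSeries ⧸ Ideal.span {f}

/-- The normalization of `𝒪`: its integral closure in its total ring of fractions. -/
abbrev Normalization (f : convergentSeries) : Type :=
  integralClosure (GermRing f) (FractionRing (GermRing f))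

/-- The complex vector space which is the quotient of the normalization of `𝒪` by `𝒪`. -/
abbrev DeltaModule (f : convergentSeries) : Type :=
  Normalization f ⧸ LinearMap.range (Algebra.linearMap (GermRing f) (Normalization f))

/-- The `δ`-invariant of the germ `f = 0`. -/
def delta (f : convergentSeries) : ℕ := Module.finrank ℂ (DeltaModule f)

/-- The number of virtual cusps of the germ `f = 0`. -/
def germVirtualCusps (f : convergentSeries) : ℤ :=
  ((branches f).map fun g => (germMultiplicity g : ℤ) - 1).sum

/-- The number of virtual nodes of the germ `f = 0`. -/
def germVirtualNodes (f : convergentSeries) : ℤ :=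
  (delta f : ℤ) - ((branches f).map fun g => (germMultiplicity g : ℤ) - 1).sum

/-- Isomorphism of germs of plane curves: some local analytic change of coordinates at the origin
takes the equation of one to the equation of the other, up to a unit. -/
def GermIso (f g : convergentSeries) : Prop :=
  ∃ φ : convergentSeries ≃ₐ[ℂ] convergentSeries, Associated (φ f) g

/-- Ordinary node: analytically isomorphic to `x y = 0`. -/
def IsOrdinaryNode (f : convergentSeries) : Prop := GermIso f (polyGerm (X 0 * X 1))

/-- Ordinary cusp: analytically isomorphic to `y ^ 2 = x ^ 3`. -/
def IsOrdinaryCusp (f : convergentSeries) : Prop := GermIso f (polyGerm (X 1 ^ 2 - X 0 ^ 3))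

end PlaneCurve

open PlaneCurve

/-! ### Plane curves -/

/-- A reduced curve in the complex projective plane: a square-free form of positive degree in the
three homogeneous coordinates. -/
structure ReducedPlaneCurve where
  /-- the degree of the curve -/
  degree : ℕ
  degree_pos : 0 < degree
  /-- the equation of the curve -/
  form : MvPolynomial (Fin 3) ℂ
  isHomogeneous : form.IsHomogeneous degree
  squarefree : Squarefree form

namespace ReducedPlaneCurve

/-- Points of the complex projective plane. -/
abbrev Point : Type := Projectivization ℂ (Fin 3 → ℂ)

/-- The index of a homogeneous coordinate that does not vanish at `p`. -/
def chart (p : Point) : Fin 3 := (Function.ne_iff.1 p.rep_nonzero).choose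

theorem rep_chart_ne_zero (p : Point) : p.rep (chart p) ≠ 0 :=
  (Function.ne_iff.1 p.rep_nonzero).choose_spec

/-- The equation of the curve in the affine coordinates `x`, `y` centred at `p` of the affine
chart where the coordinate `chart p` is `1`. -/
def affineEquation (C : ReducedPlaneCurve) (p : Point) : MvPolynomial (Fin 2) ℂ :=
  aeval ((chart p).insertNth (α := fun _ => MvPolynomial (Fin 2) ℂ) 1 fun j =>
    MvPolynomial.C (p.rep ((chart p).succAbove j) / p.rep (chart p)) + X j) C.form

/-- The local equation at `p` of the curve, an equation of the germ `(C, p)`. -/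
def germ (C : ReducedPlaneCurve) (p : Point) : convergentSeries :=
  polyGerm (C.affineEquation p)

/-- The set of singular points of the curve. -/
def singularPoints (C : ReducedPlaneCurve) : Set Point :=
  {p | eval p.rep C.form = 0 ∧ ∀ i, eval p.rep (pderiv i C.form) = 0}

/-- A curve is cuspidal if its only singularities are ordinary cusps and nodes. -/
def IsCuspidal (C : ReducedPlaneCurve) : Prop :=
  ∀ p ∈ C.singularPoints, IsOrdinaryCusp (C.germ p) ∨ IsOrdinaryNode (C.germ p)

/-- The number of virtual cusps of the curve. -/
def virtualCusps (C : ReducedPlaneCurve) : ℤ :=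
  ∑ᶠ p ∈ C.singularPoints, germVirtualCusps (C.germ p)

/-- The number of virtual nodes of the curve. -/
def virtualNodes (C : ReducedPlaneCurve) : ℤ :=
  ∑ᶠ p ∈ C.singularPoints, germVirtualNodes (C.germ p)

/-- The number of ordinary cusps of the curve. -/
def numCusps (C : ReducedPlaneCurve) : ℕ :=
  {p ∈ C.singularPoints | IsOrdinaryCusp (C.germ p)}.ncard

/-- The number of ordinary nodes of the curve. -/
def numNodes (C : ReducedPlaneCurve) : ℕ :=
  {p ∈ C.singularPoints | IsOrdinaryNode (C.germ p)}.ncard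

end ReducedPlaneCurve

end

open PlaneCurve

/-!
The local part rests on the Weierstrass preparation theorem. After a linear change of coordinates
(`exists_isRegular_shear`), which changes neither `δ` nor the multiplicities, a reduced germ of
multiplicity `m` is regular of order `m` in `y`. Weierstrass division (`exists_division`, by a
contraction argument for a weighted norm) then presents its local ring `𝒪` as `ℂ{x}[y] / (W)`
with `W` a monic polynomial of degree `m`, which is separable since the germ is reduced
(`IsWeierstrassPolynomial.separable`).

* `δ` is finite. By Euler's theorem on the different, `W' (y)` multiplies the normalization into
  `𝒪` (`IsMonogenic.exists_algebraMap_eq_derivative_mul`, a consequence of Lagrange interpolation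
  at the roots of `W`), so that the quotient of the normalization by `𝒪` embeds into
  `𝒪 / (W' (y))`. Since `W' (y)` divides a power of `x`, the latter is finite dimensional.
* `δ ≥ m - 1`. The coefficient of `y ^ j` in `W` has order at least `m - j`, so `y / x` is
  integral, and the elements `y ^ j / x` with `1 ≤ j < m` are linearly independent modulo `𝒪`
  (`IsMonogenic.le_finrank`).

If the germ has `k` branches, additivity of the order gives `∑ (mᵢ - 1) = m - k`. This is
nonnegative since every `mᵢ` is at least `1`, and at most `m - 1 ≤ δ` since `k ≥ 1`; so the numbers
of virtual cusps and of virtual nodes are nonnegative. The numbers `m`, `k` and `δ` are invariant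
under isomorphism. For the cusp and the node `m = 2`, with one branch and two branches respectively,
and `δ = 1`: here `δ ≥ m - 1 = 1`, while the discriminant of `W` is `x ^ 2` times a squarefree
factor, which gives `δ ≤ 1` (`IsMonogenic.finrank_le_one`).

The global part amounts to showing that a reduced projective curve has finitely many singular
points, and that its germs at them are reduced. Both facts follow from the Jacobian ideal `J`
generated by the equation and its derivatives in the three homogeneous coordinates. As the equation
is squarefree, `J` has height at least two (`two_le_height_jacobianIdeal`), whereas the ideal of a
point has height at most two. The ideals of the singular points are therefore among the finitely
many minimal primes over `J`. Moreover, by minimality, each element of the ideal of a singular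
point has a power that lies in `J` locally at that point. If the square of a germ `g` divided the
local equation, then `g` would divide this equation and its derivatives, hence a power of each of
the local coordinates, and would be a unit (`squarefree_polyGerm_aeval`).
-/

noncomputable section

open Finset MvPolynomial
open scoped ENNReal

namespace PlaneCurve

/-! ### Weighted norms of power series -/

/-- The monomial weight `r ^ i * s ^ j` of the exponent `(i, j)`. -/
def weight (r s : ℝ≥0∞) (n : Fin 2 →₀ ℕ) : ℝ≥0∞ := r ^ n 0 * s ^ n 1

theorem weight_add (r s : ℝ≥0∞) (n k : Fin 2 →₀ ℕ) :
    weight r s (n + k) = weight r s n * weight r s k := by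
  simp only [weight, Finsupp.add_apply, pow_add]
  ring

/-- The norm `∑ |a i j| r ^ i s ^ j` of a formal power series, with values in `[0, ∞]`. A series
converges if and only if this is finite for some positive radii. -/
def wnorm (r s : ℝ≥0∞) (f : MvPowerSeries (Fin 2) ℂ) : ℝ≥0∞ :=
  ∑' n, ‖MvPowerSeries.coeff n f‖ₑ * weight r s n

theorem wnorm_mono {r s r' s' : ℝ≥0∞} (hr : r ≤ r') (hs : s ≤ s')
    (f : MvPowerSeries (Fin 2) ℂ) : wnorm r s f ≤ wnorm r' s' f := by
  unfold wnorm weight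
  gcongr

theorem wnorm_add_le (r s : ℝ≥0∞) (f g : MvPowerSeries (Fin 2) ℂ) :
    wnorm r s (f + g) ≤ wnorm r s f + wnorm r s g := by
  unfold wnorm
  rw [← ENNReal.tsum_add]
  refine ENNReal.tsum_le_tsum fun n => ?_
  rw [← add_mul, map_add]
  gcongr
  exact enorm_add_le _ _

theorem wnorm_mul_le (r s : ℝ≥0∞) (f g : MvPowerSeries (Fin 2) ℂ) :
    wnorm r s (f * g) ≤ wnorm r s f * wnorm r s g := by
  classical
  set F : (Fin 2 →₀ ℕ) → ℝ≥0∞ := fun n => ‖MvPowerSeries.coeff n f‖ₑ * weight r s n with hF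
  set G : (Fin 2 →₀ ℕ) → ℝ≥0∞ := fun n => ‖MvPowerSeries.coeff n g‖ₑ * weight r s n with hG
  calc wnorm r s (f * g) ≤ ∑' n, ∑ p ∈ antidiagonal n, F p.1 * G p.2 := by
        refine ENNReal.tsum_le_tsum fun n => ?_
        rw [MvPowerSeries.coeff_mul]
        calc _ ≤ (∑ p ∈ antidiagonal n,
              ‖MvPowerSeries.coeff p.1 f * MvPowerSeries.coeff p.2 g‖ₑ) * weight r s n := by
              gcongr
              exact enorm_sum_le _ _
          _ = _ := by
              rw [Finset.sum_mul]
              refine Finset.sum_congr rfl fun p hp => ?_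
              rw [← HasAntidiagonal.mem_antidiagonal.1 hp, weight_add, enorm_mul]
              simp only [hF, hG]
              ring
    _ = ∑' n, ∑' p : antidiagonal n, F p.1.1 * G p.1.2 := by
        refine tsum_congr fun n => ?_
        rw [Finset.tsum_subtype (antidiagonal n) fun p => F p.1 * G p.2]
    _ = ∑' p : (Σ n : Fin 2 →₀ ℕ, antidiagonal n), F p.2.1.1 * G p.2.1.2 :=
        (ENNReal.tsum_sigma' fun p : (Σ n : Fin 2 →₀ ℕ, antidiagonal n) =>
          F p.2.1.1 * G p.2.1.2).symm
    _ = ∑' p : (Fin 2 →₀ ℕ) × (Fin 2 →₀ ℕ), F p.1 * G p.2 :=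
        Finset.HasAntidiagonal.sigmaAntidiagonalEquivProd.tsum_eq
          fun p : (Fin 2 →₀ ℕ) × (Fin 2 →₀ ℕ) => F p.1 * G p.2
    _ = (∑' n, F n) * ∑' n, G n := by
        rw [ENNReal.tsum_prod (f := fun a b => F a * G b)]
        simp_rw [ENNReal.tsum_mul_left, ENNReal.tsum_mul_right]

theorem wnorm_monomial (r s : ℝ≥0∞) (n : Fin 2 →₀ ℕ) (a : ℂ) :
    wnorm r s (MvPowerSeries.monomial n a) = ‖a‖ₑ * weight r s n := by
  classical
  unfold wnorm
  rw [tsum_eq_single n fun k hk => by simp [MvPowerSeries.coeff_monomial, hk],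
    MvPowerSeries.coeff_monomial_same]

theorem isConvergent_iff_wnorm {f : MvPowerSeries (Fin 2) ℂ} :
    IsConvergent f ↔ ∃ r s : ℝ≥0∞, 0 < r ∧ 0 < s ∧ wnorm r s f < ⊤ := by
  have key : ∀ r : ℝ, 0 < r → ∀ n : Fin 2 →₀ ℕ,
      ENNReal.ofReal (‖MvPowerSeries.coeff n f‖ * r ^ n.degree) =
        ‖MvPowerSeries.coeff n f‖ₑ * weight (ENNReal.ofReal r) (ENNReal.ofReal r) n := by
    intro r hr n
    rw [ENNReal.ofReal_mul (norm_nonneg _), ofReal_norm, ENNReal.ofReal_pow hr.le, weight,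
      ← pow_add]
    congr 2
    simp [Finsupp.degree_eq_sum, Fin.sum_univ_two]
  constructor
  · rintro ⟨r, hr, h⟩
    refine ⟨ENNReal.ofReal r, ENNReal.ofReal r, by simpa, by simpa, ?_⟩
    unfold wnorm
    simp_rw [← key r hr]
    rw [← ENNReal.ofReal_tsum_of_nonneg (fun n => by positivity) h]
    exact ENNReal.ofReal_lt_top
  · rintro ⟨r, s, hr, hs, h⟩
    obtain ⟨t, ht0, ht⟩ : ∃ t : ℝ, 0 < t ∧ ENNReal.ofReal t ≤ min r s := by
      obtain ⟨t, ht0, ht⟩ := ENNReal.lt_iff_exists_nnreal_btwn.1 (lt_min hr hs)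
      exact ⟨t, by simpa using ht0, by simpa using ht.le⟩
    refine ⟨t, ht0, ?_⟩
    have h' : wnorm (ENNReal.ofReal t) (ENNReal.ofReal t) f ≠ ⊤ :=
      ((wnorm_mono (ht.trans (min_le_left _ _)) (ht.trans (min_le_right _ _)) f).trans_lt h).ne
    unfold wnorm at h'
    simp_rw [← key t ht0] at h'
    have := ENNReal.summable_toReal h'
    refine this.congr fun n => ?_
    rw [ENNReal.toReal_ofReal (by positivity)]

theorem exists_wnorm_lt_top (f : convergentSeries) :
    ∃ r : ℝ≥0∞, 0 < r ∧ r < ⊤ ∧ wnorm r r (f : MvPowerSeries (Fin 2) ℂ) < ⊤ := by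
  obtain ⟨r, s, hr, hs, h⟩ := isConvergent_iff_wnorm.1 f.2
  refine ⟨min 1 (min r s), by simp [hr, hs], by simp, (wnorm_mono ?_ ?_ _).trans_lt h⟩
  · exact (min_le_right _ _).trans (min_le_left _ _)
  · exact (min_le_right _ _).trans (min_le_right _ _)

/-! ### Coefficients of convergent series -/

/-- The exponent of the monomial `x ^ i * y ^ j`. -/
def expo (i j : ℕ) : Fin 2 →₀ ℕ := Finsupp.single 0 i + Finsupp.single 1 j

@[simp] theorem expo_zero (i j : ℕ) : expo i j 0 = i := by simp [expo]
@[simp] theorem expo_one (i j : ℕ) : expo i j 1 = j := by simp [expo]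

theorem expo_eta (n : Fin 2 →₀ ℕ) : expo (n 0) (n 1) = n := by
  ext k
  fin_cases k <;> simp

theorem expo_inj {i j k l : ℕ} : expo i j = expo k l ↔ i = k ∧ j = l := by
  refine ⟨fun h => ⟨?_, ?_⟩, fun h => by rw [h.1, h.2]⟩
  · simpa using DFunLike.congr_fun h 0
  · simpa using DFunLike.congr_fun h 1

theorem expo_add (i j k l : ℕ) : expo i j + expo k l = expo (i + k) (j + l) := by
  ext a
  fin_cases a <;> simp

theorem degree_expo (i j : ℕ) : (expo i j).degree = i + j := by simp [expo]

/-- The coefficient of `x ^ i * y ^ j` in a convergent series. -/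
def cf (f : convergentSeries) (i j : ℕ) : ℂ :=
  MvPowerSeries.coeff (expo i j) (f : MvPowerSeries (Fin 2) ℂ)

theorem coeff_eq_cf (f : convergentSeries) (n : Fin 2 →₀ ℕ) :
    MvPowerSeries.coeff n (f : MvPowerSeries (Fin 2) ℂ) = cf f (n 0) (n 1) := by
  rw [cf, expo_eta]

theorem ext_cf {f g : convergentSeries} (h : ∀ i j, cf f i j = cf g i j) : f = g := by
  refine Subtype.ext (MvPowerSeries.ext fun n => ?_)
  rw [coeff_eq_cf, coeff_eq_cf, h]

@[simp] theorem cf_add (f g : convergentSeries) (i j : ℕ) :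
    cf (f + g) i j = cf f i j + cf g i j := by simp [cf]
@[simp] theorem cf_sub (f g : convergentSeries) (i j : ℕ) :
    cf (f - g) i j = cf f i j - cf g i j := by simp [cf]
@[simp] theorem cf_neg (f : convergentSeries) (i j : ℕ) : cf (-f) i j = -cf f i j := by simp [cf]
@[simp] theorem cf_zero (i j : ℕ) : cf 0 i j = 0 := by simp [cf]
@[simp] theorem cf_smul (c : ℂ) (f : convergentSeries) (i j : ℕ) :
    cf (c • f) i j = c * cf f i j := by simp [cf]

/-- The coefficient of `x ^ i * y ^ j` as an additive homomorphism. -/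
def cfHom (i j : ℕ) : convergentSeries →+ ℂ where
  toFun f := cf f i j
  map_zero' := cf_zero i j
  map_add' f g := cf_add f g i j

theorem cf_sum {ι : Type*} (s : Finset ι) (F : ι → convergentSeries) (i j : ℕ) :
    cf (∑ k ∈ s, F k) i j = ∑ k ∈ s, cf (F k) i j := map_sum (cfHom i j) F s

theorem cf_mul (f g : convergentSeries) (i j : ℕ) :
    cf (f * g) i j = ∑ a ∈ range (i + 1), ∑ b ∈ range (j + 1),
      cf f a b * cf g (i - a) (j - b) := by
  classical
  have h : cf (f * g) i j = ∑ p ∈ antidiagonal (expo i j),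
      MvPowerSeries.coeff p.1 (f : MvPowerSeries (Fin 2) ℂ) *
        MvPowerSeries.coeff p.2 (g : MvPowerSeries (Fin 2) ℂ) := by
    rw [cf, ← MvPowerSeries.coeff_mul]
    rfl
  rw [h, ← Finset.sum_product']
  refine Finset.sum_bij' (fun p _ => (p.1 0, p.1 1))
    (fun q _ => (expo q.1 q.2, expo (i - q.1) (j - q.2))) ?_ ?_ ?_ ?_ ?_
  · intro p hp
    have hp := HasAntidiagonal.mem_antidiagonal.1 hp
    have h0 := DFunLike.congr_fun hp 0
    have h1 := DFunLike.congr_fun hp 1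
    simp only [Finsupp.add_apply, expo_zero, expo_one] at h0 h1
    simp only [Finset.mem_product, Finset.mem_range]
    omega
  · intro q hq
    simp only [Finset.mem_product, Finset.mem_range] at hq
    rw [HasAntidiagonal.mem_antidiagonal, expo_add]
    congr 1 <;> omega
  · intro p hp
    have hp := HasAntidiagonal.mem_antidiagonal.1 hp
    have h0 := DFunLike.congr_fun hp 0
    have h1 := DFunLike.congr_fun hp 1
    simp only [Finsupp.add_apply, expo_zero, expo_one] at h0 h1
    refine Prod.ext (expo_eta _) ?_
    rw [← expo_eta p.2]
    simp only
    congr 1 <;> omega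
  · intro q hq
    simp
  · intro p hp
    have hp := HasAntidiagonal.mem_antidiagonal.1 hp
    have h0 := DFunLike.congr_fun hp 0
    have h1 := DFunLike.congr_fun hp 1
    simp only [Finsupp.add_apply, expo_zero, expo_one] at h0 h1
    rw [coeff_eq_cf, coeff_eq_cf]
    congr 2 <;> omega

/-- The monomial `x ^ i * y ^ j` as a convergent series. -/
def mono (i j : ℕ) : convergentSeries :=
  ⟨MvPowerSeries.monomial (expo i j) 1, by
    refine isConvergent_iff_wnorm.2 ⟨1, 1, one_pos, one_pos, ?_⟩
    rw [wnorm_monomial]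
    simp [weight]⟩

theorem cf_mono (i j k l : ℕ) : cf (mono i j) k l = if k = i ∧ l = j then 1 else 0 := by
  classical
  rw [cf, mono, MvPowerSeries.coeff_monomial]
  simp only [expo_inj]

theorem mono_mul_mono (i j k l : ℕ) : mono i j * mono k l = mono (i + k) (j + l) := by
  refine Subtype.ext ?_
  change MvPowerSeries.monomial _ 1 * MvPowerSeries.monomial _ 1 = MvPowerSeries.monomial _ 1
  rw [MvPowerSeries.monomial_mul_monomial, expo_add, one_mul]

theorem mono_zero : mono 0 0 = 1 := by
  refine Subtype.ext ?_
  change MvPowerSeries.monomial _ 1 = 1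
  have : expo 0 0 = 0 := by simp [expo]
  rw [this, MvPowerSeries.monomial_zero_one]

theorem cf_one (i j : ℕ) : cf 1 i j = if i = 0 ∧ j = 0 then 1 else 0 := by
  rw [← mono_zero, cf_mono]

/-- The coordinate function `x`. -/
abbrev xx : convergentSeries := mono 1 0

/-- The coordinate function `y`. -/
abbrev yy : convergentSeries := mono 0 1

theorem mono_eq (i j : ℕ) : mono i j = xx ^ i * yy ^ j := by
  have hx : xx ^ i = mono i 0 := by
    induction i with
    | zero => rw [pow_zero, mono_zero]
    | succ n ih => rw [pow_succ, ih, mono_mul_mono]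
  have hy : yy ^ j = mono 0 j := by
    induction j with
    | zero => rw [pow_zero, mono_zero]
    | succ n ih => rw [pow_succ, ih, mono_mul_mono]
  rw [hx, hy, mono_mul_mono, zero_add, add_zero]

theorem cf_mono_mul (i j : ℕ) (f : convergentSeries) (k l : ℕ) :
    cf (mono i j * f) k l = if i ≤ k ∧ j ≤ l then cf f (k - i) (l - j) else 0 := by
  classical
  have h : (expo i j ≤ expo k l) ↔ i ≤ k ∧ j ≤ l := by
    rw [Finsupp.le_def, Fin.forall_fin_two]
    simp
  rw [cf]
  change MvPowerSeries.coeff _ (MvPowerSeries.monomial _ 1 * _) = _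
  rw [MvPowerSeries.coeff_monomial_mul]
  simp only [h, one_mul, coeff_eq_cf]
  congr 2 <;> simp

/-- Deleting the terms not divisible by `x ^ i * y ^ j` and dividing the others by this monomial
preserves convergence. -/
theorem exists_shift (i j : ℕ) (f : convergentSeries) :
    ∃ g : convergentSeries, ∀ k l, cf g k l = cf f (k + i) (l + j) := by
  obtain ⟨r, hr0, hrt, hr⟩ := exists_wnorm_lt_top f
  refine ⟨⟨fun n => MvPowerSeries.coeff (n + expo i j) (f : MvPowerSeries (Fin 2) ℂ),
    isConvergent_iff_wnorm.2 ⟨r, r, hr0, hr0, ?_⟩⟩, fun k l => ?_⟩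
  · have hw0 : weight r r (expo i j) ≠ 0 := by simp [weight, hr0.ne']
    have hwt : weight r r (expo i j) ≠ ⊤ := by simp [weight, ENNReal.mul_eq_top, hrt.ne]
    refine lt_of_mul_lt_mul_right' (a := weight r r (expo i j)) ?_
    rw [ENNReal.top_mul hw0]
    refine lt_of_le_of_lt ?_ hr
    unfold wnorm
    rw [← ENNReal.tsum_mul_right]
    calc _ = ∑' n, ‖MvPowerSeries.coeff (n + expo i j) (f : MvPowerSeries (Fin 2) ℂ)‖ₑ *
            weight r r (n + expo i j) := by
          refine tsum_congr fun n => ?_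
          rw [weight_add, mul_assoc]
          rfl
      _ ≤ _ := ENNReal.tsum_comp_le_tsum_of_injective (f := fun n => n + expo i j)
          (add_left_injective _) _
  · change MvPowerSeries.coeff (expo k l + expo i j) (f : MvPowerSeries (Fin 2) ℂ) = _
    rw [expo_add, cf]

/-- The quotient of a series by the monomial `x ^ i * y ^ j`, all terms not divisible by this
monomial being discarded. -/
def shift (i j : ℕ) (f : convergentSeries) : convergentSeries := (exists_shift i j f).choose

theorem cf_shift (i j : ℕ) (f : convergentSeries) (k l : ℕ) :
    cf (shift i j f) k l = cf f (k + i) (l + j) := (exists_shift i j f).choose_spec k l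

theorem eq_mono_mul {i j : ℕ} {f : convergentSeries}
    (h : ∀ k l, ¬ (i ≤ k ∧ j ≤ l) → cf f k l = 0) : f = mono i j * shift i j f := by
  refine ext_cf fun k l => ?_
  rw [cf_mono_mul]
  split_ifs with hkl
  · rw [cf_shift, Nat.sub_add_cancel hkl.1, Nat.sub_add_cancel hkl.2]
  · exact h k l hkl

theorem germOrder_le_iff {f : convergentSeries} {n : ℕ} :
    (n : ℕ∞) ≤ germOrder f ↔ ∀ i j, i + j < n → cf f i j = 0 := by
  constructor
  · intro h i j hij
    refine MvPowerSeries.coeff_of_lt_order (lt_of_lt_of_le ?_ h)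
    rw [degree_expo]
    exact_mod_cast hij
  · intro h
    refine MvPowerSeries.nat_le_order fun d hd => ?_
    rw [coeff_eq_cf]
    refine h _ _ ?_
    rwa [← degree_expo, expo_eta]

theorem isUnit_iff {f : convergentSeries} : IsUnit f ↔ cf f 0 0 ≠ 0 := by
  constructor
  · rintro ⟨u, rfl⟩ h
    have h1 : cf (u * (u⁻¹ : convergentSeriesˣ) : convergentSeries) 0 0 = 1 := by
      rw [u.mul_inv, cf_one]
      simp
    rw [cf_mul] at h1
    simp [h] at h1
  · intro h
    refine isUnit_of_germOrder_eq_zero ?_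
    by_contra h0
    have : ((1 : ℕ) : ℕ∞) ≤ germOrder f := by
      rw [Nat.cast_one]
      exact Order.one_le_iff_ne_zero.2 h0
    exact h (germOrder_le_iff.1 this 0 0 (by simp))

/-! ### Weierstrass division -/

theorem cf_mul_eq_zero_of_lt {n : ℕ} (h d : convergentSeries)
    (hd : ∀ i j, i < n → cf d i j = 0) (i j : ℕ) (hi : i < n) : cf (h * d) i j = 0 := by
  rw [cf_mul]
  refine Finset.sum_eq_zero fun a _ => Finset.sum_eq_zero fun b _ => ?_
  rw [hd _ _ (by omega), mul_zero]

/-- The successive approximations to the quotient in the division of `g` by `y ^ m - x * h`. -/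
def divisionApprox (m : ℕ) (h g : convergentSeries) : ℕ → convergentSeries
  | 0 => 0
  | n + 1 => shift 0 m (g + xx * (h * divisionApprox m h g n))

theorem cf_divisionApprox (m : ℕ) (h g : convergentSeries) (n i j : ℕ) :
    cf (divisionApprox m h g (n + 1)) i j =
      cf (g + xx * (h * divisionApprox m h g n)) i (j + m) := by
  rw [divisionApprox, cf_shift, add_zero]

theorem cf_xx_mul_congr {n : ℕ} (h : convergentSeries) {u v : convergentSeries}
    (huv : ∀ i j, i < n → cf u i j = cf v i j) (i j : ℕ) (hi : i < n + 1) :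
    cf (xx * (h * u)) i j = cf (xx * (h * v)) i j := by
  rw [← sub_eq_zero, ← cf_sub, ← mul_sub, ← mul_sub, cf_mono_mul]
  split_ifs with hij
  · refine cf_mul_eq_zero_of_lt (n := n) _ _ (fun a b ha => ?_) _ _ (by omega)
    rw [cf_sub, huv a b ha, sub_self]
  · rfl

theorem cf_divisionApprox_succ (m : ℕ) (h g : convergentSeries) (n i j : ℕ) (hi : i < n) :
    cf (divisionApprox m h g (n + 1)) i j = cf (divisionApprox m h g n) i j := by
  induction n generalizing i j with
  | zero => omega
  | succ n ih =>
    rw [cf_divisionApprox, cf_divisionApprox, cf_add, cf_add,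
      cf_xx_mul_congr h (fun a b hab => ih a b hab) i _ hi]

theorem cf_divisionApprox_of_le (m : ℕ) (h g : convergentSeries) {k n : ℕ} (hkn : k ≤ n)
    (i j : ℕ) (hi : i < k) :
    cf (divisionApprox m h g n) i j = cf (divisionApprox m h g k) i j := by
  induction n, hkn using Nat.le_induction with
  | base => rfl
  | succ n hn ih => rw [cf_divisionApprox_succ m h g n i j (by omega), ih]

theorem wnorm_shift_mul_le (r s : ℝ≥0∞) (m : ℕ) (f : convergentSeries) :
    wnorm r s (shift 0 m f : convergentSeries) * s ^ m ≤ wnorm r s (f : convergentSeries) := by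
  unfold wnorm
  rw [← ENNReal.tsum_mul_right]
  calc _ = ∑' n, ‖MvPowerSeries.coeff (n + expo 0 m) (f : MvPowerSeries (Fin 2) ℂ)‖ₑ *
          weight r s (n + expo 0 m) := by
        refine tsum_congr fun n => ?_
        rw [weight_add, coeff_eq_cf, coeff_eq_cf, cf_shift]
        simp [weight, mul_assoc]
    _ ≤ _ := ENNReal.tsum_comp_le_tsum_of_injective (f := fun n => n + expo 0 m)
        (add_left_injective _) _

/-- On a polydisc that is thin in the direction of `x`, the recursion which defines the
approximations is a contraction, so that their norms stay bounded. -/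
theorem exists_wnorm_divisionApprox_le (m : ℕ) (h g : convergentSeries) :
    ∃ r s C : ℝ≥0∞, 0 < r ∧ 0 < s ∧ C < ⊤ ∧
      ∀ n, wnorm r s (divisionApprox m h g n : convergentSeries) ≤ C := by
  obtain ⟨r₁, h10, h1t, h1⟩ := exists_wnorm_lt_top h
  obtain ⟨r₂, h20, h2t, h2⟩ := exists_wnorm_lt_top g
  set s := min r₁ r₂ with hs
  have hs0 : 0 < s := lt_min h10 h20
  have hst : s < ⊤ := (min_le_left _ _).trans_lt h1t
  have hh : wnorm s s (h : MvPowerSeries (Fin 2) ℂ) < ⊤ :=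
    (wnorm_mono (min_le_left _ _) (min_le_left _ _) _).trans_lt h1
  have hg : wnorm s s (g : MvPowerSeries (Fin 2) ℂ) < ⊤ :=
    (wnorm_mono (min_le_right _ _) (min_le_right _ _) _).trans_lt h2
  set H := wnorm s s (h : MvPowerSeries (Fin 2) ℂ) with hH
  have hsm0 : s ^ m ≠ 0 := pow_ne_zero _ hs0.ne'
  have hsmt : s ^ m ≠ ⊤ := ENNReal.pow_ne_top hst.ne
  -- the radius in `x` is chosen so that the linear part of the recursion has norm at most `1 / 2`
  obtain ⟨r, hr0, hrs, hr⟩ : ∃ r : ℝ≥0∞, 0 < r ∧ r ≤ s ∧ r * H * 2 ≤ s ^ m := by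
    refine ⟨min s (s ^ m / (H * 2 + 1)), lt_min hs0 (ENNReal.div_pos hsm0 ?_), min_le_left _ _, ?_⟩
    · exact ENNReal.add_ne_top.2 ⟨ENNReal.mul_ne_top hh.ne (by simp), by simp⟩
    · calc _ ≤ (s ^ m / (H * 2 + 1)) * H * 2 := by
            gcongr
            exact min_le_right _ _
        _ = (s ^ m / (H * 2 + 1)) * (H * 2) := by ring
        _ ≤ (s ^ m / (H * 2 + 1)) * (H * 2 + 1) := by
            gcongr
            exact le_self_add
        _ ≤ s ^ m := by
            rw [mul_comm]
            exact ENNReal.mul_div_le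
  set G := wnorm s s (g : MvPowerSeries (Fin 2) ℂ) with hG
  refine ⟨r, s, 2 * (G / s ^ m), hr0, hs0, ?_, fun n => ?_⟩
  · exact ENNReal.mul_lt_top (by simp) (ENNReal.div_lt_top hg.ne hsm0)
  induction n with
  | zero => simp [divisionApprox, wnorm]
  | succ n ih =>
    set N := wnorm r s (divisionApprox m h g n : convergentSeries) with hN
    have e1 := wnorm_shift_mul_le r s m (g + xx * (h * divisionApprox m h g n))
    have e2 : wnorm r s ((g + xx * (h * divisionApprox m h g n) : convergentSeries) :
        MvPowerSeries (Fin 2) ℂ) ≤ G + r * (H * N) := by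
      refine (wnorm_add_le _ _ _ _).trans (add_le_add (wnorm_mono hrs le_rfl _) ?_)
      refine (wnorm_mul_le _ _ _ _).trans (mul_le_mul' ?_ ((wnorm_mul_le _ _ _ _).trans
        (mul_le_mul' (wnorm_mono hrs le_rfl _) le_rfl)))
      change wnorm r s (MvPowerSeries.monomial (expo 1 0) 1) ≤ r
      rw [wnorm_monomial]
      simp [weight]
    have e3 : r * (H * N) ≤ G := by
      calc _ ≤ r * (H * (2 * (G / s ^ m))) := by gcongr
        _ = (r * H * 2) * (G / s ^ m) := by ring
        _ ≤ s ^ m * (G / s ^ m) := by gcongr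
        _ ≤ G := ENNReal.mul_div_le
    rw [← mul_div_assoc, ENNReal.le_div_iff_mul_le (Or.inl hsm0) (Or.inl hsmt)]
    refine e1.trans (e2.trans ?_)
    rw [two_mul]
    gcongr

theorem exists_coeff_eq (F : (Fin 2 →₀ ℕ) → ℂ) :
    ∃ Q : MvPowerSeries (Fin 2) ℂ, ∀ n, MvPowerSeries.coeff n Q = F n := ⟨F, fun _ => rfl⟩

theorem exists_quotient (m : ℕ) (h g : convergentSeries) :
    ∃ q : convergentSeries, ∀ i j, cf q i j = cf (g + xx * (h * q)) i (j + m) := by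
  obtain ⟨r, s, C, hr, hs, hC, hle⟩ := exists_wnorm_divisionApprox_le m h g
  obtain ⟨Q, hQc⟩ := exists_coeff_eq fun n =>
    cf (divisionApprox m h g (n 0 + 1)) (n 0) (n 1)
  have hconv : IsConvergent Q := by
    refine isConvergent_iff_wnorm.2 ⟨r, s, hr, hs, lt_of_le_of_lt ?_ hC⟩
    unfold wnorm
    rw [ENNReal.tsum_eq_iSup_sum]
    refine iSup_le fun t => ?_
    obtain ⟨k, hk⟩ : ∃ k, ∀ n ∈ t, n 0 + 1 ≤ k :=
      ⟨t.sup fun n => n 0 + 1, fun n hn => Finset.le_sup (f := fun n : Fin 2 →₀ ℕ => n 0 + 1) hn⟩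
    refine le_trans ?_ (hle k)
    refine le_trans (le_of_eq ?_) (ENNReal.sum_le_tsum t)
    refine Finset.sum_congr rfl fun n hn => ?_
    rw [hQc, coeff_eq_cf, cf_divisionApprox_of_le m h g (hk n hn) _ _ (by omega)]
  have hq : ∀ i j, cf ⟨Q, hconv⟩ i j = cf (divisionApprox m h g (i + 1)) i j := by
    intro i j
    rw [cf]
    change MvPowerSeries.coeff _ Q = _
    rw [hQc, expo_zero, expo_one]
  refine ⟨⟨Q, hconv⟩, fun i j => ?_⟩
  rw [hq, cf_divisionApprox, cf_add, cf_add]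
  congr 1
  refine cf_xx_mul_congr (n := i) h (fun a b ha => ?_) i _ (by omega)
  rw [hq, cf_divisionApprox_of_le m h g (k := a + 1) (n := i) (by omega) _ _ (by omega)]

/-- A series is regular of order `m` in `y` if its restriction to the axis `x = 0` vanishes to
order exactly `m`. -/
def IsRegular (m : ℕ) (f : convergentSeries) : Prop :=
  (∀ j < m, cf f 0 j = 0) ∧ cf f 0 m ≠ 0

theorem exists_isUnit_mul_eq {m : ℕ} {f : convergentSeries} (hf : IsRegular m f) :
    ∃ u h : convergentSeries, IsUnit u ∧ f * u = mono 0 m - xx * h := by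
  have hv : IsUnit (shift 0 m (f - xx * shift 1 0 f)) := by
    rw [isUnit_iff, cf_shift, cf_sub, cf_mono_mul]
    simpa using hf.2
  have hfx : f - xx * shift 1 0 f = mono 0 m * shift 0 m (f - xx * shift 1 0 f) := by
    refine eq_mono_mul fun k l hkl => ?_
    rw [cf_sub, cf_mono_mul]
    rcases Nat.eq_zero_or_pos k with rfl | hk
    · simp only [nonpos_iff_eq_zero, one_ne_zero, false_and, if_false, sub_zero]
      exact hf.1 l (by omega)
    · rw [if_pos ⟨by omega, by omega⟩, cf_shift, Nat.sub_add_cancel (by omega), Nat.sub_zero,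
        add_zero, sub_self]
  obtain ⟨v, hv'⟩ := hv
  rw [← hv'] at hfx
  refine ⟨(v⁻¹ : convergentSeriesˣ), -(shift 1 0 f * (v⁻¹ : convergentSeriesˣ)), Units.isUnit _, ?_⟩
  have : f = mono 0 m * v + xx * shift 1 0 f := by rw [← hfx]; ring
  calc f * (v⁻¹ : convergentSeriesˣ)
      = mono 0 m * (v * (v⁻¹ : convergentSeriesˣ)) +
        xx * shift 1 0 f * (v⁻¹ : convergentSeriesˣ) := by
        conv_lhs => rw [this]
        ring
    _ = _ := by
        rw [v.mul_inv]
        ring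

/-- Weierstrass division: modulo a series that is regular of order `m` in `y`, every series is a
polynomial in `y` of degree less than `m`. -/
theorem exists_division {m : ℕ} {f : convergentSeries} (hf : IsRegular m f)
    (g : convergentSeries) :
    ∃ q : convergentSeries, ∀ i j, m ≤ j → cf (g - q * f) i j = 0 := by
  obtain ⟨u, h, -, huh⟩ := exists_isUnit_mul_eq hf
  obtain ⟨q, hq⟩ := exists_quotient m h g
  refine ⟨u * q, fun i j hj => ?_⟩
  obtain ⟨l, rfl⟩ := Nat.exists_eq_add_of_le' hj
  have : g - u * q * f = g + xx * (h * q) - mono 0 m * q := by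
    linear_combination (-q) * huh
  rw [this, cf_sub, ← hq, cf_mono_mul]
  simp

/-- The remainder of a Weierstrass division is unique. -/
theorem eq_zero_of_division {m : ℕ} {f : convergentSeries} (hf : IsRegular m f)
    (q : convergentSeries) (h : ∀ i j, m ≤ j → cf (q * f) i j = 0) : q = 0 := by
  refine ext_cf fun i => ?_
  induction i using Nat.strong_induction_on with
  | _ i ihi =>
    intro j
    induction j using Nat.strong_induction_on with
    | _ j ihj =>
      have h1 := h i (j + m) (by omega)
      rw [cf_mul, Finset.sum_eq_single i, Finset.sum_eq_single j] at h1
      · rw [Nat.sub_self, Nat.add_sub_cancel_left] at h1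
        exact (mul_eq_zero.1 h1).resolve_right hf.2
      · intro b hb hbj
        rcases lt_or_gt_of_ne hbj with hlt | hgt
        · rw [ihj b hlt, cf_zero, zero_mul]
        · have := Finset.mem_range.1 hb
          rw [Nat.sub_self, hf.1 _ (by omega), mul_zero]
      · intro hb
        exact absurd (Finset.mem_range.2 (by omega)) hb
      · intro a ha hai
        refine Finset.sum_eq_zero fun b _ => ?_
        rw [ihi a (by have := Finset.mem_range.1 ha; omega), cf_zero, zero_mul]
      · intro hi
        exact absurd (Finset.mem_range.2 (by omega)) hi

/-! ### Convergent series in one variable and Weierstrass polynomials -/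

/-- The subring of `ℂ{x, y}` of the series that do not involve `y`, a copy of `ℂ{x}`. -/
def xSubalgebra : Subalgebra ℂ convergentSeries where
  carrier := {f | ∀ i j, j ≠ 0 → cf f i j = 0}
  mul_mem' := by
    intro f g hf hg i j hj
    rw [cf_mul]
    refine Finset.sum_eq_zero fun a _ => Finset.sum_eq_zero fun b _ => ?_
    rcases eq_or_ne b 0 with rfl | hb
    · rw [hg _ _ (by omega), mul_zero]
    · rw [hf _ _ hb, zero_mul]
  add_mem' := by
    intro f g hf hg i j hj
    rw [cf_add, hf i j hj, hg i j hj, add_zero]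
  algebraMap_mem' := by
    intro c i j hj
    rw [Algebra.algebraMap_eq_smul_one, cf_smul, cf_one, if_neg (fun h => hj h.2), mul_zero]

/-- The ring `ℂ{x}` of convergent power series in one variable. It is a type of its own rather
than a subalgebra of `ℂ{x, y}`, which keeps the ring structure of its polynomial ring easy to
unify. -/
def xSeries : Type := xSubalgebra

instance : CommRing xSeries := inferInstanceAs (CommRing xSubalgebra)

instance : Algebra ℂ xSeries := inferInstanceAs (Algebra ℂ xSubalgebra)

/-- The inclusion of `ℂ{x}` in `ℂ{x, y}`. -/
def xInclusion : xSeries →ₐ[ℂ] convergentSeries := xSubalgebra.val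

instance : Algebra xSeries convergentSeries := xInclusion.toRingHom.toAlgebra

instance : IsScalarTower ℂ xSeries convergentSeries :=
  IsScalarTower.of_algebraMap_eq fun c => (xInclusion.commutes c).symm

instance : CoeOut xSeries convergentSeries := ⟨algebraMap xSeries convergentSeries⟩

theorem xSeries_coe_injective : Function.Injective (algebraMap xSeries convergentSeries) :=
  Subtype.val_injective

/-- A convergent series without `y` as an element of `ℂ{x}`. -/
def toXSeries (f : convergentSeries) (h : ∀ i j, j ≠ 0 → cf f i j = 0) : xSeries :=
  (⟨f, h⟩ : xSubalgebra)

theorem coe_toXSeries (f : convergentSeries) (h : ∀ i j, j ≠ 0 → cf f i j = 0) :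
    (toXSeries f h : convergentSeries) = f := rfl

theorem cf_xSeries (a : xSeries) {i j : ℕ} (hj : j ≠ 0) : cf (a : convergentSeries) i j = 0 :=
  Subtype.property (p := fun f => f ∈ xSubalgebra) a i j hj

/-- The variable of `ℂ{x}`. -/
def xVar : xSeries := toXSeries xx fun i j hj => by rw [cf_mono, if_neg fun h => hj h.2]

theorem coe_xVar : (xVar : convergentSeries) = xx := rfl

theorem xSeries_ext {a b : xSeries}
    (h : ∀ i, cf (a : convergentSeries) i 0 = cf (b : convergentSeries) i 0) : a = b := by
  refine xSeries_coe_injective (ext_cf fun i j => ?_)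
  rcases eq_or_ne j 0 with rfl | hj
  · exact h i
  · rw [cf_xSeries a hj, cf_xSeries b hj]

theorem cf_xSeries_mul (a : xSeries) (f : convergentSeries) (i j : ℕ) :
    cf (a * f) i j = ∑ k ∈ range (i + 1), cf (a : convergentSeries) k 0 * cf f (i - k) j := by
  rw [cf_mul]
  refine Finset.sum_congr rfl fun k _ => ?_
  rw [Finset.sum_eq_single 0 (fun b _ hb => by rw [cf_xSeries a hb, zero_mul])
    (fun h => absurd (Finset.mem_range.2 (by omega)) h), Nat.sub_zero]

theorem xSeries_isUnit_iff {a : xSeries} : IsUnit a ↔ cf (a : convergentSeries) 0 0 ≠ 0 := by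
  constructor
  · intro h
    exact isUnit_iff.1 (h.map (algebraMap xSeries convergentSeries))
  · intro h
    obtain ⟨u, hu⟩ := isUnit_iff.2 h
    have hv : ∀ i j, j ≠ 0 → cf (u⁻¹ : convergentSeriesˣ) i j = 0 := by
      intro i
      induction i using Nat.strong_induction_on with
      | _ i ih =>
        intro j hj
        have h1 : cf ((a : convergentSeries) * (u⁻¹ : convergentSeriesˣ)) i j = 0 := by
          rw [← hu, u.mul_inv, cf_one, if_neg fun h => hj h.2]
        rw [cf_xSeries_mul, Finset.sum_eq_single 0] at h1
        · exact (mul_eq_zero.1 h1).resolve_left h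
        · intro k hk hk0
          have := Finset.mem_range.1 hk
          rw [ih _ (by omega) j hj, mul_zero]
        · intro h0
          exact absurd (Finset.mem_range.2 (by omega)) h0
    refine IsUnit.of_mul_eq_one (toXSeries _ hv) (xSeries_coe_injective ?_)
    rw [map_mul, coe_toXSeries, ← hu, u.mul_inv, map_one]

theorem xVar_pow_dvd {a : xSeries} {n : ℕ} (h : ∀ i < n, cf (a : convergentSeries) i 0 = 0) :
    ∃ b : xSeries, a = xVar ^ n * b ∧
      ∀ i, cf (b : convergentSeries) i 0 = cf (a : convergentSeries) (i + n) 0 := by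
  refine ⟨toXSeries (shift n 0 a) fun i j hj => by rw [cf_shift, cf_xSeries a (by omega)], ?_,
    fun i => ?_⟩
  · refine xSeries_coe_injective ?_
    rw [map_mul, map_pow, coe_xVar, coe_toXSeries]
    have : xx ^ n = mono n 0 := by rw [mono_eq, pow_zero, mul_one]
    rw [this]
    refine eq_mono_mul fun k l hkl => ?_
    rcases eq_or_ne l 0 with rfl | hl
    · exact h k (by omega)
    · exact cf_xSeries a hl
  · rw [coe_toXSeries, cf_shift, add_zero]

theorem exists_eq_xVar_pow_mul {a : xSeries} (ha : a ≠ 0) :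
    ∃ (n : ℕ) (u : xSeries), IsUnit u ∧ a = xVar ^ n * u := by
  classical
  have hex : ∃ n, cf (a : convergentSeries) n 0 ≠ 0 := by
    by_contra! h
    exact ha (xSeries_ext fun i => by rw [h i]; simp)
  obtain ⟨b, hb, hb'⟩ := xVar_pow_dvd (a := a) (n := Nat.find hex) fun i hi =>
    not_not.1 (Nat.find_min hex hi)
  refine ⟨_, b, xSeries_isUnit_iff.2 ?_, hb⟩
  rw [hb', zero_add]
  exact Nat.find_spec hex

theorem xVar_irreducible : Irreducible xVar := by
  refine ⟨fun h => xSeries_isUnit_iff.1 h ?_, fun a b hab => ?_⟩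
  · rw [coe_xVar, cf_mono, if_neg (by simp)]
  · by_contra! h
    rw [xSeries_isUnit_iff, xSeries_isUnit_iff, not_not, not_not] at h
    have h1 : cf ((a : convergentSeries) * (b : convergentSeries)) 1 0 = 1 := by
      rw [← map_mul, ← hab, coe_xVar, cf_mono, if_pos ⟨rfl, rfl⟩]
    rw [cf_xSeries_mul, Finset.sum_range_succ, Finset.sum_range_one, h.1, Nat.sub_self, h.2] at h1
    simp at h1

instance : IsDomain convergentSeries :=
  have : IsDomain (MvPowerSeries (Fin 2) ℂ) := NoZeroDivisors.to_isDomain _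
  Subalgebra.isDomain _

instance : IsDomain xSeries := xSeries_coe_injective.isDomain _

instance : IsDiscreteValuationRing xSeries :=
  IsDiscreteValuationRing.ofHasUnitMulPowIrreducibleFactorization
    ⟨xVar, xVar_irreducible, fun {a} ha => by
      obtain ⟨n, u, hu, rfl⟩ := exists_eq_xVar_pow_mul ha
      exact ⟨n, hu.unit, rfl⟩⟩

open Polynomial in
/-- Substituting `y` in a polynomial over `ℂ{x}` embeds `ℂ{x}[y]` in `ℂ{x, y}` coefficientwise. -/
theorem cf_aeval (P : xSeries[X]) (i j : ℕ) :
    cf (Polynomial.aeval yy P) i j = cf (P.coeff j : convergentSeries) i 0 := by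
  induction P using Polynomial.induction_on' with
  | add p q hp hq => rw [map_add, cf_add, hp, hq, Polynomial.coeff_add, map_add, cf_add]
  | monomial n a =>
    have hy : yy ^ n = mono 0 n := by rw [mono_eq, pow_zero, one_mul]
    rw [Polynomial.aeval_monomial, hy, mul_comm, cf_mono_mul, Polynomial.coeff_monomial]
    rw [Nat.sub_zero]
    rcases lt_trichotomy n j with h | h | h
    · rw [if_pos (by omega), if_neg (by omega), cf_xSeries a (by omega)]
      simp
    · subst h
      simp
    · rw [if_neg (by omega), if_neg (by omega)]
      simp

open Polynomial in
theorem aeval_yy_injective : Function.Injective (Polynomial.aeval yy : xSeries[X] → _) := by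
  intro P Q h
  refine Polynomial.ext fun j => xSeries_ext fun i => ?_
  rw [← cf_aeval, ← cf_aeval, h]

open Polynomial in
theorem exists_aeval_eq {m : ℕ} {g : convergentSeries} (h : ∀ i j, m ≤ j → cf g i j = 0) :
    ∃ P : xSeries[X], P.degree < m ∧ Polynomial.aeval yy P = g := by
  have hrow : ∀ j, ∃ a : xSeries, ∀ i, cf (a : convergentSeries) i 0 = cf g i j := by
    intro j
    refine ⟨toXSeries (shift 0 j g - yy * shift 0 1 (shift 0 j g)) fun i l hl => ?_, fun i => ?_⟩
    · rw [cf_sub, cf_mono_mul, if_pos ⟨by omega, by omega⟩, cf_shift _ _ (shift 0 j g),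
        Nat.sub_zero, add_zero, Nat.sub_add_cancel (by omega), sub_self]
    · rw [coe_toXSeries, cf_sub, cf_mono_mul, if_neg (by omega), cf_shift, zero_add, add_zero,
        sub_zero]
  choose a ha using hrow
  set P : xSeries[X] := ∑ j ∈ range m, Polynomial.monomial j (a j) with hP
  have hc : ∀ j, P.coeff j = if j < m then a j else 0 := by
    intro j
    rw [hP, Polynomial.finsetSum_coeff]
    simp [Polynomial.coeff_monomial]
  refine ⟨P, ?_, ext_cf fun i j => ?_⟩
  · rw [Polynomial.degree_lt_iff_coeff_zero]
    intro j hj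
    rw [hc, if_neg (by omega)]
  · rw [cf_aeval, hc]
    split_ifs with hj
    · exact ha j i
    · rw [h i j (by omega)]
      simp

theorem IsRegular.cf_mul {m : ℕ} {f : convergentSeries} (hf : IsRegular m f)
    (q : convergentSeries) :
    (∀ j < m, cf (q * f) 0 j = 0) ∧ cf (q * f) 0 m = cf q 0 0 * cf f 0 m := by
  constructor
  · intro j hj
    rw [PlaneCurve.cf_mul, zero_add, Finset.sum_range_one]
    refine Finset.sum_eq_zero fun b _ => ?_
    rw [Nat.sub_zero, hf.1 _ (by omega), mul_zero]
  · rw [PlaneCurve.cf_mul, zero_add, Finset.sum_range_one, Finset.sum_eq_single 0]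
    · rfl
    · intro b hb hb0
      have := Finset.mem_range.1 hb
      rw [Nat.sub_zero, hf.1 _ (by omega), mul_zero]
    · intro h
      exact absurd (Finset.mem_range.2 (by omega)) h

open Polynomial in
/-- A Weierstrass polynomial of a series `f` that is regular of order `m` in `y`: a monic
polynomial of degree `m` over `ℂ{x}`, equal to `y ^ m` modulo `x`, which equals `f` up to a
unit. -/
structure IsWeierstrassPolynomial (m : ℕ) (f : convergentSeries) (W : xSeries[X]) : Prop where
  monic : W.Monic
  natDegree_eq : W.natDegree = m
  cf_coeff : ∀ j < m, cf (W.coeff j : convergentSeries) 0 0 = 0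
  associated : Associated (Polynomial.aeval yy W) f

open Polynomial in
/-- Weierstrass preparation. -/
theorem IsRegular.exists_weierstrassPolynomial {m : ℕ} {f : convergentSeries}
    (hf : IsRegular m f) : ∃ W : xSeries[X], IsWeierstrassPolynomial m f W := by
  obtain ⟨q, hq⟩ := exists_division hf (mono 0 m)
  obtain ⟨P, hPd, hP⟩ := exists_aeval_eq hq
  have hy : yy ^ m = mono 0 m := by rw [mono_eq, pow_zero, one_mul]
  have hW : Polynomial.aeval yy (Polynomial.X ^ m - P : xSeries[X]) = q * f := by
    rw [map_sub, hP, map_pow, Polynomial.aeval_X, hy]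
    ring
  have hmonic : (Polynomial.X ^ m - P : xSeries[X]).Monic :=
    Polynomial.monic_X_pow_sub hPd
  have hdeg : (Polynomial.X ^ m - P : xSeries[X]).natDegree = m := by
    refine Polynomial.natDegree_eq_of_degree_eq_some ?_
    rw [Polynomial.degree_sub_eq_left_of_degree_lt (by rwa [Polynomial.degree_X_pow]),
      Polynomial.degree_X_pow]
  refine ⟨_, hmonic, hdeg, fun j hj => ?_, ?_⟩
  · rw [← cf_aeval, hW]
    exact (hf.cf_mul q).1 j hj
  · have h1 : cf q 0 0 * cf f 0 m = 1 := by
      rw [← (hf.cf_mul q).2, ← hW, cf_aeval]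
      have := hmonic.coeff_natDegree
      rw [hdeg] at this
      rw [this, map_one, cf_one, if_pos ⟨rfl, rfl⟩]
    have hu : IsUnit q := isUnit_iff.2 (left_ne_zero_of_mul_eq_one h1)
    rw [hW]
    exact (associated_unit_mul_left f q hu)

open Polynomial in
/-- The local ring of a germ is generated by `y` over `ℂ{x}`, by Weierstrass division. -/
theorem exists_aeval_mk_eq {m : ℕ} {f : convergentSeries} (hf : IsRegular m f)
    (z : GermRing f) :
    ∃ P : xSeries[X], P.degree < m ∧
      Polynomial.aeval (Ideal.Quotient.mk (Ideal.span {f}) yy) P = z := by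
  obtain ⟨g, rfl⟩ := Ideal.Quotient.mk_surjective z
  obtain ⟨q, hq⟩ := exists_division hf g
  obtain ⟨P, hPd, hP⟩ := exists_aeval_eq hq
  refine ⟨P, hPd, ?_⟩
  have : Polynomial.aeval (Ideal.Quotient.mk (Ideal.span {f}) yy) P =
      Ideal.Quotient.mk (Ideal.span {f}) (Polynomial.aeval yy P) :=
    Polynomial.aeval_algHom_apply (Ideal.Quotient.mkₐ xSeries (Ideal.span {f})) yy P
  rw [this, hP, Ideal.Quotient.eq, Ideal.mem_span_singleton]
  exact ⟨-q, by ring⟩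

open Polynomial in
/-- The relations satisfied by `y` in the local ring are the multiples of the Weierstrass
polynomial, by uniqueness of Weierstrass division. -/
theorem aeval_mk_eq_zero_iff {m : ℕ} {f : convergentSeries} (hf : IsRegular m f)
    {W : xSeries[X]} (hW : IsWeierstrassPolynomial m f W) (P : xSeries[X]) :
    Polynomial.aeval (Ideal.Quotient.mk (Ideal.span {f}) yy) P = 0 ↔ W ∣ P := by
  have h : Polynomial.aeval (Ideal.Quotient.mk (Ideal.span {f}) yy) P =
      Ideal.Quotient.mk (Ideal.span {f}) (Polynomial.aeval yy P) :=
    Polynomial.aeval_algHom_apply (Ideal.Quotient.mkₐ xSeries (Ideal.span {f})) yy P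
  rw [h, Ideal.Quotient.eq_zero_iff_mem, Ideal.mem_span_singleton]
  constructor
  · intro hdvd
    rw [← Polynomial.modByMonic_eq_zero_iff_dvd hW.monic]
    have hdvd' : f ∣ Polynomial.aeval yy (P %ₘ W) := by
      rw [Polynomial.modByMonic_eq_sub_mul_div P, map_sub, map_mul]
      exact dvd_sub hdvd (hW.associated.symm.dvd.mul_right _)
    obtain ⟨q, hq⟩ := hdvd'
    have hq0 : q = 0 := by
      refine eq_zero_of_division hf q fun i j hj => ?_
      rw [mul_comm, ← hq, cf_aeval, Polynomial.coeff_eq_zero_of_degree_lt]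
      · simp
      · refine (Polynomial.degree_modByMonic_lt P hW.monic).trans_le ?_
        rw [Polynomial.degree_eq_natDegree hW.monic.ne_zero, hW.natDegree_eq]
        exact_mod_cast hj
    refine aeval_yy_injective ?_
    simp only [hq, hq0, mul_zero, map_zero]
  · rintro ⟨Q, rfl⟩
    rw [map_mul]
    exact hW.associated.symm.dvd.mul_right _

/-! ### Integral closure of a monogenic extension -/

section Monogenic

open Polynomial

/-- The `A`-algebra `O` is presented as `A[X] / (W)` by the element `ω`, with `W` monic. -/
structure IsMonogenic {A O : Type*} [CommRing A] [CommRing O] [Algebra A O] (W : A[X]) (ω : O) :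
    Prop where
  monic : W.Monic
  aeval_eq_zero_iff : ∀ P : A[X], Polynomial.aeval ω P = 0 ↔ W ∣ P
  exists_aeval_eq : ∀ z : O, ∃ P : A[X], Polynomial.aeval ω P = z

variable {A O : Type*} [CommRing A] [CommRing O] [Algebra A O] {W : A[X]} {ω : O}

theorem IsMonogenic.isIntegral (h : IsMonogenic W ω) : Algebra.IsIntegral A O := by
  refine ⟨fun z => ?_⟩
  obtain ⟨P, rfl⟩ := h.exists_aeval_eq z
  have hω : ω ∈ integralClosure A O :=
    ⟨W, h.monic, by rw [← Polynomial.aeval_def]; exact (h.aeval_eq_zero_iff W).2 dvd_rfl⟩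
  exact Algebra.adjoin_le (Set.singleton_subset_iff.2 hω)
    (Polynomial.aeval_mem_adjoin_singleton A ω)

theorem IsMonogenic.aeval_derivative_mem_nonZeroDivisors (h : IsMonogenic W ω)
    (hsep : (W.map (algebraMap A (FractionRing A))).Separable) :
    Polynomial.aeval ω (derivative W) ∈ nonZeroDivisors O := by
  refine mem_nonZeroDivisors_iff_right.2 fun z hz => ?_
  obtain ⟨P, rfl⟩ := h.exists_aeval_eq z
  have hinj := IsFractionRing.injective A (FractionRing A)
  rw [← map_mul, h.aeval_eq_zero_iff, ← Polynomial.map_dvd_map _ hinj h.monic,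
    Polynomial.map_mul, ← Polynomial.derivative_map] at hz
  exact (h.aeval_eq_zero_iff P).2
    ((Polynomial.map_dvd_map _ hinj h.monic).1 (hsep.dvd_of_dvd_mul_right hz))

variable [IsDomain A]

theorem IsMonogenic.algebraMap_mem_nonZeroDivisors (h : IsMonogenic W ω) {a : A} (ha : a ≠ 0) :
    algebraMap A O a ∈ nonZeroDivisors O := by
  refine mem_nonZeroDivisors_iff_right.2 fun z hz => ?_
  obtain ⟨P, rfl⟩ := h.exists_aeval_eq z
  rw [mul_comm, ← Algebra.smul_def, ← map_smul, h.aeval_eq_zero_iff,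
    ← Polynomial.modByMonic_eq_zero_iff_dvd h.monic, Polynomial.smul_modByMonic,
    smul_eq_zero_iff_right ha, Polynomial.modByMonic_eq_zero_iff_dvd h.monic] at hz
  exact (h.aeval_eq_zero_iff P).2 hz

theorem IsMonogenic.exists_dvd_algebraMap (h : IsMonogenic W ω) {b : O}
    (hb : b ∈ nonZeroDivisors O) : ∃ a : A, a ≠ 0 ∧ b ∣ algebraMap A O a :=
  (h.isIntegral.isIntegral b).isAlgebraic.exists_nonzero_dvd hb

/-- Lagrange interpolation at the roots of `W`: if a polynomial `H / a` takes integral values at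
the roots of `W`, then the remainder of `H * W'` modulo `W` is divisible by `a`. -/
theorem C_dvd_mul_derivative_modByMonic [IsIntegrallyClosed A] {L : Type*} [Field L] [Algebra A L]
    [Algebra (FractionRing A) L] [IsScalarTower A (FractionRing A) L] (hW : W.Monic)
    (hsplit : (W.map (algebraMap A L)).Splits) (hsep : (W.map (algebraMap A L)).Separable)
    {a : A} (ha : a ≠ 0) (H : A[X])
    (hH : ∀ θ : L, Polynomial.aeval θ W = 0 →
      ∃ ζ : L, IsIntegral A ζ ∧ algebraMap A L a * ζ = Polynomial.aeval θ H) :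
    Polynomial.C a ∣ (H * derivative W) %ₘ W := by
  classical
  have hinj : Function.Injective (algebraMap A L) := by
    rw [IsScalarTower.algebraMap_eq A (FractionRing A) L]
    exact (algebraMap (FractionRing A) L).injective.comp (IsFractionRing.injective A _)
  set T := (W.map (algebraMap A L)).roots.toFinset with hT
  have hmem : ∀ θ ∈ T, Polynomial.aeval θ W = 0 := fun θ hθ => by
    have := Polynomial.isRoot_of_mem_roots (Multiset.mem_toFinset.1 hθ)
    rwa [Polynomial.IsRoot.def, Polynomial.eval_map_algebraMap] at this
  have hnodal : W.map (algebraMap A L) = Lagrange.nodal T id := by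
    conv_lhs => rw [hsplit.eq_prod_roots_of_monic (hW.map _)]
    rw [Lagrange.nodal, Finset.prod, hT, Multiset.toFinset_val,
      (Polynomial.nodup_roots hsep).dedup]
    rfl
  have hint : ∀ θ : L, Polynomial.aeval θ W = 0 → IsIntegral A θ := fun θ hθ =>
    ⟨W, hW, by rwa [← Polynomial.aeval_def]⟩
  choose! ζ hζ hζH using hH
  set S : L[X] := ∑ θ ∈ T, Polynomial.C (ζ θ) * Lagrange.nodal (T.erase θ) id with hS
  have hSl : S ∈ Polynomial.liftsRing (algebraMap (integralClosure A L) L) := by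
    have hC : ∀ c : L, IsIntegral A c →
        Polynomial.C c ∈ Polynomial.liftsRing (algebraMap (integralClosure A L) L) := by
      intro c hc
      exact (Polynomial.lifts_iff_liftsRing _ _).1
        ((Polynomial.mem_lifts _).2 ⟨Polynomial.C ⟨c, hc⟩, by simp⟩)
    refine sum_mem fun θ hθ => mul_mem (hC _ (hζ θ (hmem θ hθ))) (prod_mem fun η hη => ?_)
    refine sub_mem ((Polynomial.lifts_iff_liftsRing _ _).1
      ((Polynomial.mem_lifts _).2 ⟨Polynomial.X, by simp⟩)) (hC _ ?_)
    exact hint η (hmem η (Finset.mem_of_mem_erase hη))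
  have hSint : ∀ j, IsIntegral A (S.coeff j) := by
    intro j
    obtain ⟨c, hc⟩ := (Polynomial.lifts_iff_coeff_lifts S).1 hSl j
    rw [← hc]
    exact c.2
  have hdegW : (W.map (algebraMap A L)).degree = T.card := by rw [hnodal, Lagrange.degree_nodal]
  set G := (H * derivative W) %ₘ W with hG
  have hGS : G.map (algebraMap A L) = Polynomial.C (algebraMap A L a) * S := by
    refine Polynomial.eq_of_degrees_lt_of_eval_finset_eq T ?_ ?_ fun θ hθ => ?_
    · rw [← hdegW, Polynomial.degree_map_eq_of_injective hinj,
        Polynomial.degree_map_eq_of_injective hinj]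
      exact Polynomial.degree_modByMonic_lt _ hW
    · rw [Polynomial.degree_C_mul fun h0 => ha (hinj (by rw [h0, map_zero]))]
      refine (Polynomial.degree_sum_le _ _).trans_lt ?_
      rw [Finset.sup_lt_iff (WithBot.bot_lt_coe _)]
      intro θ hθ
      refine (Polynomial.degree_mul_le _ _).trans_lt ?_
      refine (add_le_add_left Polynomial.degree_C_le _).trans_lt ?_
      rw [Lagrange.degree_nodal, zero_add]
      exact_mod_cast Finset.card_erase_lt_of_mem hθ
    · have e1 : Polynomial.eval θ (G.map (algebraMap A L)) =
          Polynomial.aeval θ H * Polynomial.aeval θ (derivative W) := by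
        rw [Polynomial.eval_map_algebraMap, hG, Polynomial.modByMonic_eq_sub_mul_div, map_sub,
          map_mul, map_mul, hmem θ hθ, zero_mul, sub_zero]
      have e2 : Polynomial.aeval θ (derivative W) =
          Polynomial.eval θ (Lagrange.nodal (T.erase θ) id) := by
        rw [← Polynomial.eval_map_algebraMap, ← Polynomial.derivative_map, hnodal]
        exact Lagrange.eval_nodal_derivative_eval_node_eq (v := id) hθ
      rw [e1, e2, Polynomial.eval_mul, Polynomial.eval_C, hS, Polynomial.eval_finsetSum,
        Finset.sum_eq_single_of_mem θ hθ, Polynomial.eval_mul, Polynomial.eval_C, ← mul_assoc,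
        hζH θ (hmem θ hθ)]
      intro η hη hne
      rw [Polynomial.eval_mul, Lagrange.eval_nodal,
        Finset.prod_eq_zero (i := θ) (Finset.mem_erase.2 ⟨hne.symm, hθ⟩) (by simp), mul_zero]
  refine (Polynomial.C_dvd_iff_dvd_coeff _ _).2 fun j => ?_
  have hj : algebraMap A L (G.coeff j) = algebraMap A L a * S.coeff j := by
    rw [← Polynomial.coeff_map, hGS, Polynomial.coeff_C_mul]
  set K := FractionRing A
  have haK : algebraMap A K a ≠ 0 := by
    simpa using ha
  have hk : algebraMap K L (algebraMap A K (G.coeff j) / algebraMap A K a) = S.coeff j := by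
    rw [map_div₀, ← IsScalarTower.algebraMap_apply, ← IsScalarTower.algebraMap_apply, hj,
      mul_div_cancel_left₀]
    exact fun h0 => ha (hinj (by rw [h0, map_zero]))
  have hk' : IsIntegral A (algebraMap A K (G.coeff j) / algebraMap A K a) := by
    rw [← isIntegral_algebraMap_iff (algebraMap K L).injective, hk]
    exact hSint j
  obtain ⟨g, hg⟩ := IsIntegrallyClosed.isIntegral_iff.1 hk'
  refine ⟨g, IsFractionRing.injective A K ?_⟩
  rw [map_mul, hg, mul_div_cancel₀ _ haK]

/-- Euler's theorem on the different: in a monogenic extension `O = A[ω]`, the derivative of the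
minimal polynomial at `ω` multiplies every element of the total ring of fractions that is integral
over `O` into `O`. -/
theorem IsMonogenic.exists_algebraMap_eq_derivative_mul [IsIntegrallyClosed A]
    (h : IsMonogenic W ω) (hsep : (W.map (algebraMap A (FractionRing A))).Separable)
    {Q : Type*} [CommRing Q] [Algebra O Q] [IsFractionRing O Q] {z : Q} (hz : IsIntegral O z) :
    ∃ o : O, algebraMap O Q o = algebraMap O Q (Polynomial.aeval ω (derivative W)) * z := by
  let _ : Algebra A Q := ((algebraMap O Q).comp (algebraMap A O)).toAlgebra
  have : IsScalarTower A O Q := IsScalarTower.of_algebraMap_eq fun _ => rfl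
  have := h.isIntegral
  obtain ⟨⟨u, b⟩, rfl⟩ := IsLocalization.mk'_surjective (nonZeroDivisors O) z
  simp only at hz ⊢
  set z := IsLocalization.mk' Q u b with hzdef
  obtain ⟨a, ha, c, hc⟩ := h.exists_dvd_algebraMap b.2
  obtain ⟨H, hH⟩ := h.exists_aeval_eq (u * c)
  have hza : algebraMap O Q (algebraMap A O a) * z = algebraMap O Q (Polynomial.aeval ω H) := by
    rw [hc, hH, map_mul, map_mul, mul_right_comm, mul_comm (algebraMap O Q b), hzdef,
      IsLocalization.mk'_spec]
  set L := AlgebraicClosure (FractionRing A)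
  have hinj : Function.Injective (algebraMap A L) := by
    rw [IsScalarTower.algebraMap_eq A (FractionRing A) L]
    exact (algebraMap (FractionRing A) L).injective.comp (IsFractionRing.injective A _)
  have hmap : W.map (algebraMap A L) =
      (W.map (algebraMap A (FractionRing A))).map (algebraMap (FractionRing A) L) := by
    rw [Polynomial.map_map, ← IsScalarTower.algebraMap_eq]
  have key : Polynomial.C a ∣ (H * derivative W) %ₘ W := by
    refine C_dvd_mul_derivative_modByMonic (L := L) h.monic (IsAlgClosed.splits _)
      (by rw [hmap]; exact hsep.map) ha H fun θ hθ => ?_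
    have hker : RingHom.ker (Polynomial.aeval ω : A[X] →ₐ[A] O).toRingHom ≤
        RingHom.ker (Polynomial.aeval θ : A[X] →ₐ[A] L).toRingHom := fun P hP => by
      obtain ⟨R, rfl⟩ := (h.aeval_eq_zero_iff P).1 hP
      change Polynomial.aeval θ (W * R) = 0
      rw [map_mul, hθ, zero_mul]
    let φ : O →ₐ[A] L := AlgHom.liftOfSurjective _ h.exists_aeval_eq _ hker
    have hφ : ∀ P, φ (Polynomial.aeval ω P) = Polynomial.aeval θ P := fun P =>
      DFunLike.congr_fun (AlgHom.liftOfSurjective_comp _ h.exists_aeval_eq _ hker) P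
    have hunit : ∀ s : nonZeroDivisors O, IsUnit ((φ : O →+* L) s) := by
      intro s
      obtain ⟨a', ha', hdvd⟩ := h.exists_dvd_algebraMap s.2
      have h1 := map_dvd φ hdvd
      rw [AlgHom.commutes] at h1
      refine isUnit_of_dvd_unit h1 (IsUnit.mk0 _ fun h0 => ha' (hinj (by rw [h0, map_zero])))
    let ψ : Q →ₐ[A] L :=
      { (IsLocalization.lift hunit : Q →+* L) with
        commutes' := fun r => by
          change IsLocalization.lift hunit (algebraMap O Q (algebraMap A O r)) = _
          rw [IsLocalization.lift_eq]
          exact φ.commutes r }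
    have hψ : ∀ o, ψ (algebraMap O Q o) = φ o := fun o => IsLocalization.lift_eq hunit o
    refine ⟨ψ z, (isIntegral_trans (R := A) (A := O) z hz).map ψ, ?_⟩
    rw [← hφ, ← hψ, ← hza, map_mul, hψ, AlgHom.commutes]
  obtain ⟨G, hG⟩ := key
  have hreg := h.algebraMap_mem_nonZeroDivisors ha
  have hunit := IsLocalization.map_units Q (⟨_, hreg⟩ : nonZeroDivisors O)
  refine ⟨Polynomial.aeval ω G, hunit.mul_left_cancel ?_⟩
  have hW0 : Polynomial.aeval ω W = 0 := (h.aeval_eq_zero_iff W).2 dvd_rfl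
  have e : algebraMap A O a * Polynomial.aeval ω G =
      Polynomial.aeval ω H * Polynomial.aeval ω (derivative W) := by
    rw [← Polynomial.aeval_C ω a, ← map_mul, ← hG, Polynomial.modByMonic_eq_sub_mul_div, map_sub,
      map_mul, map_mul, hW0, zero_mul, sub_zero]
  change algebraMap O Q (algebraMap A O a) * _ = algebraMap O Q (algebraMap A O a) * _
  rw [← map_mul, e, map_mul, ← hza]
  ring

/-- A monic polynomial that is not separable over the fraction field has a multiple monic factor
of positive degree. -/
theorem exists_monic_mul_self_dvd [IsIntegrallyClosed A] [CharZero A] (hW : W.Monic)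
    (hsep : ¬ (W.map (algebraMap A (FractionRing A))).Separable) :
    ∃ P : A[X], P.Monic ∧ 0 < P.natDegree ∧ P * P ∣ W := by
  set K := FractionRing A
  have : CharZero K := charZero_of_injective_algebraMap (IsFractionRing.injective A K)
  rw [PerfectField.separable_iff_squarefree] at hsep
  obtain ⟨g, hg, hgu⟩ : ∃ g : K[X], g * g ∣ W.map (algebraMap A K) ∧ ¬ IsUnit g := by
    unfold Squarefree at hsep
    push Not at hsep
    exact hsep
  have hg0 : g ≠ 0 := by
    rintro rfl
    rw [zero_mul, zero_dvd_iff] at hg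
    exact (hW.map _).ne_zero hg
  set g₁ := g * Polynomial.C g.leadingCoeff⁻¹ with hg₁
  have hm : g₁.Monic := Polynomial.monic_mul_leadingCoeff_inv hg0
  have hu : IsUnit (Polynomial.C g.leadingCoeff⁻¹) :=
    Polynomial.isUnit_C.2 (IsUnit.mk0 _ (inv_ne_zero (Polynomial.leadingCoeff_ne_zero.2 hg0)))
  have hd : g₁ * g₁ ∣ W.map (algebraMap A K) := by
    rw [hg₁, mul_mul_mul_comm]
    exact (IsUnit.mul_right_dvd (hu.mul hu)).2 hg
  have hnu : ¬ IsUnit g₁ := fun h => hgu (isUnit_of_mul_isUnit_left h)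
  obtain ⟨P, hP⟩ := IsIntegrallyClosed.eq_map_mul_C_of_dvd K hW
    ((dvd_mul_right g₁ g₁).trans hd)
  rw [hm.leadingCoeff, Polynomial.C_1, mul_one] at hP
  have hinj := IsFractionRing.injective A K
  have hPm : P.Monic := Polynomial.monic_of_injective hinj (by rw [hP]; exact hm)
  refine ⟨P, hPm, ?_, ?_⟩
  · rw [← hPm.natDegree_map (algebraMap A K), hP]
    exact Nat.pos_of_ne_zero fun h0 => hnu (by rw [hm.natDegree_eq_zero.1 h0]; exact isUnit_one)
  · rw [← Polynomial.map_dvd_map _ hinj (hPm.mul hPm), Polynomial.map_mul, hP]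
    exact hd

end Monogenic

/-! ### The Weierstrass polynomial of a reduced germ -/

section Regular

open Polynomial

instance : CharZero xSeries := charZero_of_injective_algebraMap (algebraMap ℂ xSeries).injective

/-- The value of a series in one variable at the origin. -/
def xConst : xSeries →+* ℂ where
  toFun a := cf (a : convergentSeries) 0 0
  map_one' := by rw [map_one, cf_one, if_pos ⟨rfl, rfl⟩]
  map_mul' a b := by rw [map_mul, cf_xSeries_mul]; simp
  map_zero' := by rw [map_zero, cf_zero]
  map_add' a b := by rw [map_add, cf_add]

/-- The coordinate function `y` in the local ring of a germ. -/
abbrev yBar (f : convergentSeries) : GermRing f := Ideal.Quotient.mk (Ideal.span {f}) yy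

variable {m : ℕ} {f : convergentSeries} {W : xSeries[X]}

theorem IsWeierstrassPolynomial.isMonogenic (hf : IsRegular m f)
    (hW : IsWeierstrassPolynomial m f W) : IsMonogenic W (yBar f) where
  monic := hW.monic
  aeval_eq_zero_iff := aeval_mk_eq_zero_iff hf hW
  exists_aeval_eq z := by
    obtain ⟨P, -, hP⟩ := exists_aeval_mk_eq hf z
    exact ⟨P, hP⟩

theorem IsWeierstrassPolynomial.map_xConst (hW : IsWeierstrassPolynomial m f W) :
    W.map xConst = Polynomial.X ^ m := by
  refine Polynomial.ext fun j => ?_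
  rw [Polynomial.coeff_map, Polynomial.coeff_X_pow]
  rcases lt_trichotomy j m with h | h | h
  · rw [if_neg h.ne]
    exact hW.cf_coeff j h
  · have := hW.monic.coeff_natDegree
    rw [hW.natDegree_eq] at this
    rw [if_pos h, h, this, map_one]
  · rw [if_neg h.ne', Polynomial.coeff_eq_zero_of_natDegree_lt (by rw [hW.natDegree_eq]; exact h),
      map_zero]

/-- The Weierstrass polynomial of a reduced germ is separable: a multiple factor would be monic
with coefficients in `ℂ{x}`, and equal to a positive power of `y` modulo `x`, hence not a unit. -/
theorem IsWeierstrassPolynomial.separable (hW : IsWeierstrassPolynomial m f W)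
    (hsq : Squarefree f) : (W.map (algebraMap xSeries (FractionRing xSeries))).Separable := by
  by_contra hsep
  obtain ⟨P, hPm, hPd, hdvd⟩ := exists_monic_mul_self_dvd hW.monic hsep
  have hu : IsUnit (Polynomial.aeval yy P) := by
    refine hsq _ (dvd_trans ?_ hW.associated.dvd)
    rw [← map_mul]
    exact map_dvd (Polynomial.aeval yy) hdvd
  rw [isUnit_iff, cf_aeval] at hu
  refine hu ?_
  have h1 : P.map xConst ∣ Polynomial.X ^ m := by
    rw [← hW.map_xConst]
    exact Polynomial.map_dvd _ (dvd_of_mul_right_dvd hdvd)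
  obtain ⟨k, -, hk⟩ := (dvd_prime_pow Polynomial.prime_X m).1 h1
  have h2 : P.map xConst = Polynomial.X ^ k :=
    Polynomial.eq_of_monic_of_associated (hPm.map _) (Polynomial.monic_X_pow k) hk
  have hkd : k = P.natDegree := by
    rw [← hPm.natDegree_map xConst, h2, Polynomial.natDegree_X_pow]
  have h3 : (P.map xConst).coeff 0 = 0 := by
    rw [h2, Polynomial.coeff_X_pow, if_neg (by omega)]
  rwa [Polynomial.coeff_map] at h3

end Regular

/-! ### The δ-invariant of a monogenic extension of `ℂ{x}` -/

section Delta

open Polynomial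

/-- The quotient of the normalization of a ring by the ring itself. -/
abbrev NormalizationQuotient (O : Type*) [CommRing O] : Type _ :=
  integralClosure O (FractionRing O) ⧸
    LinearMap.range (Algebra.linearMap O (integralClosure O (FractionRing O)))

section General

variable {O : Type*} [CommRing O]

theorem mk_eq_zero_iff (z : integralClosure O (FractionRing O)) :
    (Submodule.Quotient.mk z : NormalizationQuotient O) = 0 ↔
      ∃ o : O, algebraMap O (FractionRing O) o = z := by
  rw [Submodule.Quotient.mk_eq_zero, LinearMap.mem_range]
  exact exists_congr fun o => Subtype.ext_iff

/-- The quotient of the normalization by the ring embeds in the quotient of the ring by a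
multiplier of the normalization. -/
theorem finite_normalizationQuotient_of_multiplier {k : Type*} [Field k] [Algebra k O] {d : O}
    (hd : d ∈ nonZeroDivisors O)
    (hmul : ∀ z : integralClosure O (FractionRing O), ∃ o : O,
      algebraMap O (FractionRing O) o = algebraMap O (FractionRing O) d * z)
    (hfin : Module.Finite k (O ⧸ Ideal.span {d})) :
    Module.Finite k (NormalizationQuotient O) := by
  choose T hT using hmul
  have hinj : Function.Injective (algebraMap O (FractionRing O)) := IsFractionRing.injective _ _
  let T' : integralClosure O (FractionRing O) →ₗ[O] O :=
    { toFun := T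
      map_add' := fun z w => hinj (by rw [map_add, hT, hT, hT, Subalgebra.coe_add, mul_add])
      map_smul' := fun r z => hinj (by
        rw [RingHom.id_apply, smul_eq_mul, map_mul, hT, hT, Subalgebra.coe_smul, Algebra.smul_def]
        ring) }
  let F : integralClosure O (FractionRing O) →ₗ[O] (O ⧸ Ideal.span {d}) :=
    (Submodule.mkQ (Ideal.span {d})).comp T'
  have hker : LinearMap.ker F =
      LinearMap.range (Algebra.linearMap O (integralClosure O (FractionRing O))) := by
    ext z
    rw [LinearMap.mem_ker, LinearMap.mem_range]
    change Submodule.Quotient.mk (T z) = 0 ↔ _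
    rw [Submodule.Quotient.mk_eq_zero, Ideal.mem_span_singleton]
    have hu := IsLocalization.map_units (FractionRing O) (⟨d, hd⟩ : nonZeroDivisors O)
    constructor
    · rintro ⟨o, ho⟩
      refine ⟨o, Subtype.ext (hu.mul_left_cancel ?_)⟩
      change algebraMap O _ d * algebraMap O _ o = algebraMap O _ d * _
      rw [← hT, ho, map_mul]
    · rintro ⟨o, rfl⟩
      refine ⟨o, hinj ?_⟩
      rw [hT, map_mul]
      rfl
  let G : NormalizationQuotient O →ₗ[O] (O ⧸ Ideal.span {d}) := Submodule.liftQ _ F hker.ge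
  have hG : Function.Injective G := by
    rw [← LinearMap.ker_eq_bot]
    exact Submodule.ker_liftQ_eq_bot _ _ _ hker.le
  exact Module.Finite.of_injective (G.restrictScalars k) hG

end General

variable {O : Type*} [CommRing O] [Algebra xSeries O] {W : xSeries[X]} {ω : O}

theorem xSeries_coe_smul (c : ℂ) (a : xSeries) :
    ((c • a : xSeries) : convergentSeries) = c • (a : convergentSeries) := map_smul xInclusion c a

theorem exists_eq_sum_add_xVar_pow_mul (a : xSeries) (N : ℕ) :
    ∃ (c : Fin N → ℂ) (b : xSeries), a = ∑ i, c i • xVar ^ (i : ℕ) + xVar ^ N * b := by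
  have hx : ∀ i j, cf (xVar ^ i : xSeries) j 0 = if j = i then 1 else 0 := by
    intro i j
    rw [map_pow, coe_xVar, ← mul_one (xx ^ i), ← pow_zero yy, ← mono_eq, cf_mono]
    simp
  obtain ⟨b, hb, -⟩ := xVar_pow_dvd
    (a := a - ∑ i : Fin N, cf (a : convergentSeries) i 0 • xVar ^ (i : ℕ)) (n := N) (by
      intro k hk
      rw [map_sub, map_sum, cf_sub, cf_sum, Finset.sum_eq_single ⟨k, hk⟩]
      · rw [xSeries_coe_smul, cf_smul, hx, if_pos rfl, mul_one, sub_self]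
      · intro i _ hi
        rw [xSeries_coe_smul, cf_smul, hx, if_neg fun h => hi (Fin.ext h.symm), mul_zero]
      · intro h
        exact absurd (Finset.mem_univ _) h)
  exact ⟨_, b, by rw [← hb]; ring⟩

/-- If the coefficient of `y ^ j` in `W`, of degree `m`, is divisible by `x ^ (m - j)`, then
`y / x` is integral: dividing `W (y) = 0` by `x ^ m` gives a monic equation. -/
theorem IsMonogenic.isIntegral_div (h : IsMonogenic W ω)
    (hW : ∀ j, xVar ^ (W.natDegree - j) ∣ W.coeff j) {t : FractionRing O}
    (ht : algebraMap O (FractionRing O) (algebraMap xSeries O xVar) * t =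
      algebraMap O (FractionRing O) ω) : IsIntegral O t := by
  choose b hb using hW
  set V : xSeries[X] := ∑ j ∈ range (W.natDegree + 1), Polynomial.monomial j (b j) with hV
  have hVc : ∀ j, j ≤ W.natDegree → V.coeff j = b j := by
    intro j hj
    rw [hV, Polynomial.finsetSum_coeff]
    simp only [Polynomial.coeff_monomial, Finset.sum_ite_eq', Finset.mem_range]
    rw [if_pos (by omega)]
  have hVd : V.natDegree ≤ W.natDegree := by
    refine Polynomial.natDegree_sum_le_of_forall_le _ _ fun j hj => ?_
    exact (Polynomial.natDegree_monomial_le _).trans (by have := Finset.mem_range.1 hj; omega)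
  have hbm : b W.natDegree = 1 := by
    have := h.monic.coeff_natDegree
    rwa [hb, Nat.sub_self, pow_zero, one_mul] at this
  have hVm : V.Monic :=
    Polynomial.monic_of_natDegree_le_of_coeff_eq_one _ hVd (by rw [hVc _ le_rfl, hbm])
  have hVd' : V.natDegree = W.natDegree := Polynomial.natDegree_eq_of_le_of_coeff_ne_zero hVd
    (by rw [hVc _ le_rfl, hbm]; exact one_ne_zero)
  have hscale : V.scaleRoots xVar = W := by
    refine Polynomial.ext fun j => ?_
    rw [Polynomial.coeff_scaleRoots, hVd']
    rcases le_or_gt j W.natDegree with hj | hj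
    · rw [hVc j hj, hb, mul_comm]
    · rw [Polynomial.coeff_eq_zero_of_natDegree_lt (by omega),
        Polynomial.coeff_eq_zero_of_natDegree_lt hj, zero_mul]
  have hroot : Polynomial.eval₂ ((algebraMap O (FractionRing O)).comp (algebraMap xSeries O)) t V =
      0 := by
    have h1 := Polynomial.scaleRoots_eval₂_mul (p := V)
      ((algebraMap O (FractionRing O)).comp (algebraMap xSeries O)) t xVar
    rw [hscale, RingHom.comp_apply, ht, ← Polynomial.hom_eval₂, ← Polynomial.aeval_def,
      (h.aeval_eq_zero_iff W).2 dvd_rfl, map_zero] at h1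
    have hu := IsLocalization.map_units (FractionRing O)
      (⟨_, h.algebraMap_mem_nonZeroDivisors xVar_irreducible.ne_zero⟩ : nonZeroDivisors O)
    exact ((hu.pow V.natDegree).mul_right_eq_zero).1 h1.symm
  refine ⟨V.map (algebraMap xSeries O), hVm.map _, ?_⟩
  rw [Polynomial.eval₂_map]
  exact hroot

/-- `ℂ{x}` is integrally closed: an element of the total ring of fractions of a monogenic
extension that is a fraction over `ℂ{x}` and integral is a series. -/
theorem IsMonogenic.dvd_of_isIntegral [Nontrivial O] (h : IsMonogenic W ω) {a c : xSeries}
    (ha : a ≠ 0) {s : FractionRing O} (hs : IsIntegral O s)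
    (hsa : algebraMap O (FractionRing O) (algebraMap xSeries O a) * s =
      algebraMap O (FractionRing O) (algebraMap xSeries O c)) : a ∣ c := by
  have := h.isIntegral
  obtain ⟨V, hV, hVs⟩ := isIntegral_trans (R := xSeries) (A := O) s hs
  rw [IsScalarTower.algebraMap_eq xSeries O (FractionRing O)] at hVs
  set ι : xSeries →+* FractionRing O :=
    (algebraMap O (FractionRing O)).comp (algebraMap xSeries O) with hι
  have hinj : Function.Injective ι := by
    refine (IsFractionRing.injective O (FractionRing O)).comp ?_
    refine (injective_iff_map_eq_zero (algebraMap xSeries O)).2 fun r hr => ?_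
    by_contra hr0
    exact nonZeroDivisors.ne_zero (h.algebraMap_mem_nonZeroDivisors hr0) hr
  have h1 : Polynomial.eval c (V.scaleRoots a) = 0 := by
    refine hinj ?_
    have h2 := Polynomial.scaleRoots_eval₂_mul (p := V) ι s a
    have h3 : ι a * s = ι c := hsa
    rw [h3, hVs, mul_zero, Polynomial.eval₂_at_apply] at h2
    rw [h2, map_zero]
  set K := FractionRing xSeries
  have haK : algebraMap xSeries K a ≠ 0 := by simpa using ha
  have h4 : IsIntegral xSeries (algebraMap xSeries K c / algebraMap xSeries K a) := by
    refine ⟨V, hV, ?_⟩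
    have h5 := Polynomial.scaleRoots_eval₂_mul (p := V) (algebraMap xSeries K)
      (algebraMap xSeries K c / algebraMap xSeries K a) a
    rw [mul_div_cancel₀ _ haK, Polynomial.eval₂_at_apply, h1, map_zero] at h5
    exact (mul_eq_zero.1 h5.symm).resolve_left (pow_ne_zero _ haK)
  obtain ⟨g, hg⟩ := IsIntegrallyClosed.isIntegral_iff.1 h4
  refine ⟨g, IsFractionRing.injective xSeries K ?_⟩
  rw [map_mul, hg, mul_div_cancel₀ _ haK]

variable [Algebra ℂ O] [IsScalarTower ℂ xSeries O]

theorem IsMonogenic.finite_quotient (h : IsMonogenic W ω) {d : O} {N : ℕ}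
    (hd : d ∣ algebraMap xSeries O (xVar ^ N)) : Module.Finite ℂ (O ⧸ Ideal.span {d}) := by
  let v : Fin (W.natDegree + 1) × Fin N → O ⧸ Ideal.span {d} := fun p =>
    Ideal.Quotient.mk _ (algebraMap xSeries O (xVar ^ (p.2 : ℕ)) * ω ^ (p.1 : ℕ))
  refine Module.Finite.of_surjective (Fintype.linearCombination ℂ v) fun z => ?_
  obtain ⟨z, rfl⟩ := Ideal.Quotient.mk_surjective z
  obtain ⟨P₀, rfl⟩ := h.exists_aeval_eq z
  have hP₀ : Polynomial.aeval ω P₀ = Polynomial.aeval ω (P₀ %ₘ W) := by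
    rw [Polynomial.modByMonic_eq_sub_mul_div, map_sub, map_mul,
      (h.aeval_eq_zero_iff W).2 dvd_rfl, zero_mul, sub_zero]
  rw [hP₀]
  set P := P₀ %ₘ W
  have hP : P.natDegree < W.natDegree + 1 :=
    Nat.lt_succ_of_le (Polynomial.natDegree_le_natDegree
      (Polynomial.degree_modByMonic_lt _ h.monic).le)
  choose c b hcb using fun j => exists_eq_sum_add_xVar_pow_mul (P.coeff j) N
  refine ⟨fun p => c p.1 p.2, ?_⟩
  have hd0 : Ideal.Quotient.mk (Ideal.span {d}) (algebraMap xSeries O (xVar ^ N)) = 0 :=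
    Ideal.Quotient.eq_zero_iff_mem.2 (Ideal.mem_span_singleton.2 hd)
  rw [Fintype.linearCombination_apply, Fintype.sum_prod_type,
    Polynomial.aeval_eq_sum_range' hP,
    map_sum, Finset.sum_range]
  refine Finset.sum_congr rfl fun j _ => ?_
  rw [Algebra.smul_def, hcb j, map_add, map_mul (algebraMap xSeries O), map_sum, add_mul, map_add,
    map_mul _ (_ * _), map_mul _ (algebraMap xSeries O (xVar ^ N)), hd0, zero_mul, zero_mul,
    add_zero, Finset.sum_mul, map_sum]
  refine Finset.sum_congr rfl fun i _ => ?_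
  rw [← IsScalarTower.coe_toAlgHom' ℂ xSeries O, map_smul, smul_mul_assoc]
  rfl

theorem IsMonogenic.finite_normalizationQuotient (h : IsMonogenic W ω)
    (hsep : (W.map (algebraMap xSeries (FractionRing xSeries))).Separable) :
    Module.Finite ℂ (NormalizationQuotient O) := by
  have hd := h.aeval_derivative_mem_nonZeroDivisors hsep
  refine finite_normalizationQuotient_of_multiplier hd
    (fun z => h.exists_algebraMap_eq_derivative_mul hsep z.2) ?_
  obtain ⟨a, ha, hda⟩ := h.exists_dvd_algebraMap hd
  obtain ⟨N, u, hu, rfl⟩ := exists_eq_xVar_pow_mul ha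
  refine h.finite_quotient (N := N) (hda.trans ?_)
  rw [map_mul]
  exact (IsUnit.mul_right_dvd (hu.map _)).2 dvd_rfl

/-- The bound `δ ≥ m - 1` for a germ of multiplicity `m`: the integral elements `y ^ j / x` with
`1 ≤ j < m` are linearly independent modulo the local ring. -/
theorem IsMonogenic.le_finrank (h : IsMonogenic W ω)
    (hW : ∀ j, xVar ^ (W.natDegree - j) ∣ W.coeff j)
    (hX : W.map xConst = Polynomial.X ^ W.natDegree)
    (hfin : Module.Finite ℂ (NormalizationQuotient O)) :
    W.natDegree - 1 ≤ Module.finrank ℂ (NormalizationQuotient O) := by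
  have hx := h.algebraMap_mem_nonZeroDivisors xVar_irreducible.ne_zero
  obtain ⟨t, ht⟩ : ∃ t : FractionRing O,
      algebraMap O (FractionRing O) (algebraMap xSeries O xVar) * t =
        algebraMap O (FractionRing O) ω :=
    ⟨IsLocalization.mk' _ ω ⟨_, hx⟩, IsLocalization.mk'_spec' (FractionRing O) ω ⟨_, hx⟩⟩
  have hti := h.isIntegral_div hW ht
  let z : integralClosure O (FractionRing O) := ⟨t, hti⟩
  let v : Fin (W.natDegree - 1) → NormalizationQuotient O := fun k =>
    Submodule.Quotient.mk (ω ^ (k : ℕ) • z)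
  have hv : LinearIndependent ℂ v := by
    rw [Fintype.linearIndependent_iff]
    intro c hc k
    set R : xSeries[X] := ∑ k : Fin (W.natDegree - 1),
      Polynomial.monomial (k : ℕ) (algebraMap ℂ xSeries (c k)) with hR
    have hRω : Polynomial.aeval ω R = ∑ k, c k • ω ^ (k : ℕ) := by
      rw [hR, map_sum]
      refine Finset.sum_congr rfl fun i _ => ?_
      rw [Polynomial.aeval_monomial, ← IsScalarTower.algebraMap_apply, Algebra.smul_def]
    have h1 : ∑ k, c k • v k = Submodule.Quotient.mk (Polynomial.aeval ω R • z) := by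
      rw [hRω, Finset.sum_smul, ← Submodule.mkQ_apply, map_sum]
      refine Finset.sum_congr rfl fun i _ => ?_
      rw [smul_assoc]
      rfl
    rw [h1, mk_eq_zero_iff] at hc
    obtain ⟨o, ho⟩ := hc
    obtain ⟨P, rfl⟩ := h.exists_aeval_eq o
    have h2 : Polynomial.aeval ω (Polynomial.C xVar * P) =
        Polynomial.aeval ω (R * Polynomial.X) := by
      refine IsFractionRing.injective O (FractionRing O) ?_
      rw [map_mul, Polynomial.aeval_C, map_mul, ho, map_mul, Polynomial.aeval_X, map_mul, ← ht,
        Subalgebra.coe_smul, Algebra.smul_def]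
      ring
    rw [← sub_eq_zero, ← map_sub, h.aeval_eq_zero_iff] at h2
    have h3 := Polynomial.map_dvd xConst h2
    have hx0 : xConst xVar = 0 := by
      change cf xx 0 0 = 0
      rw [cf_mono, if_neg (by simp)]
    rw [hX, Polynomial.map_sub, Polynomial.map_mul, Polynomial.map_C, hx0, Polynomial.C_0, zero_mul,
      zero_sub, dvd_neg, Polynomial.X_pow_dvd_iff] at h3
    have h4 := h3 (k + 1) (by omega)
    rw [Polynomial.map_mul, Polynomial.map_X, Polynomial.coeff_mul_X, Polynomial.coeff_map, hR,
      Polynomial.finsetSum_coeff, Finset.sum_eq_single k, Polynomial.coeff_monomial,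
      if_pos rfl] at h4
    · rw [← h4]
      change _ = cf (algebraMap xSeries convergentSeries (algebraMap ℂ xSeries (c k))) 0 0
      rw [← IsScalarTower.algebraMap_apply, Algebra.algebraMap_eq_smul_one, cf_smul, cf_one,
        if_pos ⟨rfl, rfl⟩, mul_one]
    · intro i _ hik
      rw [Polynomial.coeff_monomial, if_neg fun h => hik (Fin.ext h)]
    · intro h
      exact absurd (Finset.mem_univ _) h
  have := hv.fintype_card_le_finrank
  rwa [Fintype.card_fin] at this

/-- A double point whose discriminant is `x ^ 2 * D` with `D` squarefree has `δ ≤ 1`: modulo the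
local ring, the normalization is spanned by `w / x`, where `w ^ 2` is the discriminant. -/
theorem IsMonogenic.finrank_le_one [Nontrivial O] (h : IsMonogenic W ω) {b c D : xSeries}
    (hW : W = Polynomial.X ^ 2 + Polynomial.C b * Polynomial.X + Polynomial.C c)
    (hdisc : b ^ 2 - 4 * c = xVar ^ 2 * D) (hD0 : D ≠ 0) (hD : ∀ p, D ∣ p ^ 2 → D ∣ p)
    (hsep : (W.map (algebraMap xSeries (FractionRing xSeries))).Separable) :
    Module.finrank ℂ (NormalizationQuotient O) ≤ 1 := by
  set ι := algebraMap O (FractionRing O)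
  set σ := algebraMap xSeries O
  have hx0 : xVar ≠ 0 := xVar_irreducible.ne_zero
  have hreg : ∀ a : xSeries, a ≠ 0 → IsUnit (ι (σ a)) := fun a ha =>
    IsLocalization.map_units (FractionRing O)
      (⟨_, h.algebraMap_mem_nonZeroDivisors ha⟩ : nonZeroDivisors O)
  have hω : ω ^ 2 + σ b * ω + σ c = 0 := by
    have := (h.aeval_eq_zero_iff W).2 dvd_rfl
    rwa [hW, map_add, map_add, map_mul, map_pow, Polynomial.aeval_X, Polynomial.aeval_C,
      Polynomial.aeval_C] at this
  set w : O := 2 * ω + σ b with hw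
  have hw' : Polynomial.aeval ω (derivative W) = w := by
    rw [hW, hw]
    simp only [map_add, Polynomial.derivative_X_pow, Polynomial.derivative_mul,
      Polynomial.derivative_C, Polynomial.derivative_X, map_mul, map_pow, Polynomial.aeval_X,
      Polynomial.aeval_C, map_zero]
    simp only [Nat.cast_ofNat, map_ofNat, σ]
    simp
  have hw2 : w ^ 2 = σ (xVar ^ 2 * D) := by
    rw [← hdisc, map_sub, map_pow, map_mul, map_ofNat, hw]
    linear_combination 4 * hω
  obtain ⟨e, he⟩ : ∃ e : FractionRing O, ι (σ xVar) * e = ι w :=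
    ⟨(hreg _ hx0).unit⁻¹ * ι w, by rw [← mul_assoc, IsUnit.mul_val_inv, one_mul]⟩
  have he2 : e ^ 2 = ι (σ D) := by
    refine ((hreg _ hx0).pow 2).mul_left_cancel ?_
    rw [← mul_pow, he, ← map_pow, hw2, map_mul, map_mul, map_pow, map_pow]
  have hei : IsIntegral O e := by
    refine IsIntegral.of_pow two_pos ?_
    rw [he2]
    exact isIntegral_algebraMap
  refine _root_.finrank_le_one
    (Submodule.Quotient.mk (⟨e, hei⟩ : integralClosure O (FractionRing O))) fun z => ?_
  obtain ⟨z, rfl⟩ := Submodule.Quotient.mk_surjective _ z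
  obtain ⟨o, ho⟩ := h.exists_algebraMap_eq_derivative_mul hsep z.2
  rw [hw'] at ho
  -- the element `w * z` of `O` is written in the basis `1, w`, which exists since `2` is invertible
  obtain ⟨p, q, hpq⟩ : ∃ p q : xSeries, o = σ p + σ q * w := by
    obtain ⟨P, rfl⟩ := h.exists_aeval_eq o
    have h2 : algebraMap ℂ xSeries (1 / 2) * 2 = 1 := by
      rw [← map_ofNat (algebraMap ℂ xSeries) 2, ← map_mul]
      norm_num
    set η := algebraMap ℂ xSeries (1 / 2)
    have hdeg : (P %ₘ W).natDegree < 2 := by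
      have hWd : W.natDegree = 2 := by
        rw [hW]
        compute_degree!
      rw [← hWd]
      exact Polynomial.natDegree_modByMonic_lt _ h.monic fun h1 => by simp [h1] at hWd
    have hP : Polynomial.aeval ω P =
        σ ((P %ₘ W).coeff 0) + σ ((P %ₘ W).coeff 1) * ω := by
      have hP₀ : Polynomial.aeval ω P = Polynomial.aeval ω (P %ₘ W) := by
        rw [Polynomial.modByMonic_eq_sub_mul_div, map_sub, map_mul,
          (h.aeval_eq_zero_iff W).2 dvd_rfl, zero_mul, sub_zero]
      rw [hP₀, Polynomial.aeval_eq_sum_range' hdeg, Finset.sum_range_succ, Finset.sum_range_one,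
        pow_zero, pow_one, Algebra.smul_def, Algebra.smul_def, mul_one]
    set p₀ := (P %ₘ W).coeff 0
    set p₁ := (P %ₘ W).coeff 1
    refine ⟨p₀ - η * p₁ * b, η * p₁, ?_⟩
    have h2' : σ η * 2 = 1 := by rw [← map_ofNat σ 2, ← map_mul, h2, map_one]
    rw [hP, map_sub, map_mul, map_mul, hw]
    linear_combination (-(σ p₁ * ω)) * h2'
  set s : FractionRing O := z - ι (σ q) with hs
  have hsi : IsIntegral O s := z.2.sub isIntegral_algebraMap
  have hws : ι w * s = ι (σ p) := by
    rw [hs, mul_sub, ← ho, hpq, map_add, map_mul]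
    ring
  have hD0' : xVar ^ 2 * D ≠ 0 := mul_ne_zero (pow_ne_zero _ hx0) hD0
  have hdvd : xVar ^ 2 * D ∣ p ^ 2 := by
    refine h.dvd_of_isIntegral hD0' (hsi.pow 2) ?_
    change ι (σ _) * _ = ι (σ _)
    rw [← hw2, map_pow, ← mul_pow, hws, map_pow, map_pow]
  obtain ⟨p', rfl⟩ : xVar ∣ p :=
    xVar_irreducible.prime.dvd_of_dvd_pow (((dvd_pow_self _ two_ne_zero).mul_right D).trans hdvd)
  obtain ⟨p'', rfl⟩ : D ∣ p' := by
    refine hD p' ?_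
    rwa [mul_pow, mul_dvd_mul_iff_left (pow_ne_zero 2 hx0)] at hdvd
  have hse : s = ι (σ p'') * e := by
    refine (hreg _ hD0').mul_left_cancel ?_
    rw [← hw2, map_pow, pow_two, mul_assoc, hws, ← he, map_mul, map_mul, map_mul, map_mul, ← he2]
    ring
  obtain ⟨γ, p₃, hp₃⟩ := exists_eq_sum_add_xVar_pow_mul p'' 1
  rw [Fin.sum_univ_one, Fin.val_zero, pow_zero, pow_one] at hp₃
  refine ⟨γ 0, ?_⟩
  rw [← Submodule.Quotient.mk_smul, ← sub_eq_zero, ← Submodule.Quotient.mk_sub, mk_eq_zero_iff]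
  refine ⟨-(σ p₃ * w + σ q), ?_⟩
  have hz : (z : FractionRing O) = ι (σ q) + ι (σ p'') * e := by rw [← hse, hs]; ring
  have hγ : ((γ 0 • (⟨e, hei⟩ : integralClosure O (FractionRing O)) :
      integralClosure O (FractionRing O)) : FractionRing O) = ι (σ (γ 0 • 1)) * e := by
    rw [← IsScalarTower.coe_toAlgHom' ℂ xSeries O, map_smul, map_one, ← Algebra.smul_def,
      smul_assoc, one_smul]
    rfl
  rw [Subalgebra.coe_sub, hγ, hz, hp₃, map_neg, map_add, map_mul, ← he, map_add, map_add, map_mul,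
    map_mul]
  ring

end Delta

/-! ### Linear changes of coordinates -/

theorem wnorm_pow_le (r s : ℝ≥0∞) (f : MvPowerSeries (Fin 2) ℂ) (n : ℕ) :
    wnorm r s (f ^ n) ≤ wnorm r s f ^ n := by
  induction n with
  | zero =>
    rw [pow_zero, pow_zero, ← MvPowerSeries.monomial_zero_one, wnorm_monomial]
    simp [weight]
  | succ n ih =>
    rw [pow_succ, pow_succ]
    exact (wnorm_mul_le _ _ _ _).trans (mul_le_mul' ih le_rfl)

/-- Substitution of series of norms at most the radii of convergence preserves convergence. -/
theorem wnorm_subst_le (r s : ℝ≥0∞) {a : Fin 2 → MvPowerSeries (Fin 2) ℂ}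
    (ha : MvPowerSeries.HasSubst a) (f : MvPowerSeries (Fin 2) ℂ) :
    wnorm r s (MvPowerSeries.subst a f) ≤ wnorm (wnorm r s (a 0)) (wnorm r s (a 1)) f := by
  have hterm : ∀ n, ‖MvPowerSeries.coeff n (MvPowerSeries.subst a f)‖ₑ ≤
      ∑' d, ‖MvPowerSeries.coeff d f‖ₑ *
        ‖MvPowerSeries.coeff n (d.prod fun i k => a i ^ k)‖ₑ := by
    intro n
    rw [MvPowerSeries.coeff_subst ha,
      finsum_eq_sum _ (MvPowerSeries.coeff_subst_finite ha f n)]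
    refine (enorm_sum_le _ _).trans ?_
    simp_rw [smul_eq_mul, enorm_mul]
    exact ENNReal.sum_le_tsum _
  calc _ ≤ ∑' n, ∑' d, ‖MvPowerSeries.coeff d f‖ₑ *
        ‖MvPowerSeries.coeff n (d.prod fun i k => a i ^ k)‖ₑ * weight r s n := by
        refine ENNReal.tsum_le_tsum fun n => ?_
        rw [ENNReal.tsum_mul_right]
        gcongr
        exact hterm n
    _ = ∑' d, ‖MvPowerSeries.coeff d f‖ₑ * wnorm r s (d.prod fun i k => a i ^ k) := by
        rw [ENNReal.tsum_comm]
        refine tsum_congr fun d => ?_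
        simp_rw [mul_assoc]
        rw [ENNReal.tsum_mul_left]
        rfl
    _ ≤ _ := by
        refine ENNReal.tsum_le_tsum fun d => ?_
        gcongr
        rw [Finsupp.prod_fintype _ _ fun i => pow_zero _, Fin.prod_univ_two]
        exact (wnorm_mul_le _ _ _ _).trans
          (mul_le_mul' (wnorm_pow_le _ _ _ _) (wnorm_pow_le _ _ _ _))

/-- The substitution `(x, y) ↦ (x + c y, y)`. -/
def shearVars (c : ℂ) : Fin 2 → MvPowerSeries (Fin 2) ℂ :=
  ![MvPowerSeries.X 0 + MvPowerSeries.C c * MvPowerSeries.X 1, MvPowerSeries.X 1]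

theorem hasSubst_shearVars (c : ℂ) : MvPowerSeries.HasSubst (shearVars c) := by
  refine MvPowerSeries.hasSubst_of_constantCoeff_zero fun i => ?_
  fin_cases i <;> simp [shearVars]

theorem isConvergent_subst_shearVars (c : ℂ) (f : convergentSeries) :
    IsConvergent (MvPowerSeries.subst (shearVars c) (f : MvPowerSeries (Fin 2) ℂ)) := by
  obtain ⟨ρ, hρ0, hρt, hρ⟩ := exists_wnorm_lt_top f
  have hX : ∀ r s : ℝ≥0∞, ∀ i, wnorm r s (MvPowerSeries.X i : MvPowerSeries (Fin 2) ℂ) =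
      weight r s (Finsupp.single i 1) := by
    intro r s i
    rw [MvPowerSeries.X, wnorm_monomial]
    simp
  have hC : ∀ r s : ℝ≥0∞, wnorm r s (MvPowerSeries.C c : MvPowerSeries (Fin 2) ℂ) = ‖c‖ₑ := by
    intro r s
    rw [← MvPowerSeries.monomial_zero_eq_C_apply, wnorm_monomial]
    simp [weight]
  have h2 : ρ / 2 ≠ 0 := by simp [hρ0.ne']
  have hsc : 0 < ρ / 2 / (1 + ‖c‖ₑ) := ENNReal.div_pos h2 (by simp)
  refine isConvergent_iff_wnorm.2 ⟨ρ / 2, ρ / 2 / (1 + ‖c‖ₑ), pos_iff_ne_zero.2 h2, hsc, ?_⟩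
  have hs : ρ / 2 / (1 + ‖c‖ₑ) * (1 + ‖c‖ₑ) ≤ ρ / 2 := by
    rw [mul_comm]
    exact ENNReal.mul_div_le
  refine (wnorm_subst_le _ _ (hasSubst_shearVars c) _).trans_lt
    ((wnorm_mono ?_ ?_ _).trans_lt hρ)
  · refine (wnorm_add_le _ _ _ _).trans ?_
    calc _ ≤ ρ / 2 + ‖c‖ₑ * (ρ / 2 / (1 + ‖c‖ₑ)) := by
          gcongr
          · rw [hX]
            simp [weight]
          · refine (wnorm_mul_le _ _ _ _).trans ?_
            rw [hC, hX]
            simp [weight]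
      _ ≤ ρ / 2 + ρ / 2 := by
          gcongr
          refine le_trans ?_ hs
          rw [mul_comm]
          gcongr
          exact le_add_self
      _ = ρ := ENNReal.add_halves ρ
  · change wnorm _ _ (MvPowerSeries.X 1) ≤ ρ
    rw [hX]
    refine le_trans ?_ (ENNReal.half_le_self (a := ρ))
    refine le_trans ?_ hs
    simp only [weight, Finsupp.single_eq_same, pow_one]
    rw [Finsupp.single_eq_of_ne (by decide), pow_zero, one_mul, mul_add, mul_one]
    exact le_self_add

/-- The endomorphism `(x, y) ↦ (x + c y, y)` of `ℂ{x, y}`. -/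
def shearHom (c : ℂ) : convergentSeries →ₐ[ℂ] convergentSeries :=
  ((MvPowerSeries.substAlgHom (hasSubst_shearVars c)).comp convergentSeries.val).codRestrict
    convergentSeries fun f => by
      rw [AlgHom.comp_apply, MvPowerSeries.substAlgHom_apply]
      exact isConvergent_subst_shearVars c f

theorem coe_shearHom (c : ℂ) (f : convergentSeries) :
    (shearHom c f : MvPowerSeries (Fin 2) ℂ) =
      MvPowerSeries.subst (shearVars c) (f : MvPowerSeries (Fin 2) ℂ) :=
  MvPowerSeries.substAlgHom_apply (hasSubst_shearVars c) _

theorem coe_xx : (xx : MvPowerSeries (Fin 2) ℂ) = MvPowerSeries.X 0 := by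
  change MvPowerSeries.monomial (expo 1 0) 1 = MvPowerSeries.monomial (Finsupp.single 0 1) 1
  rw [expo, Finsupp.single_zero, add_zero]

theorem coe_yy : (yy : MvPowerSeries (Fin 2) ℂ) = MvPowerSeries.X 1 := by
  change MvPowerSeries.monomial (expo 0 1) 1 = MvPowerSeries.monomial (Finsupp.single 1 1) 1
  rw [expo, Finsupp.single_zero, zero_add]

theorem shearHom_xx (c : ℂ) : shearHom c xx = xx + c • yy := by
  refine Subtype.ext ?_
  rw [coe_shearHom, coe_xx, MvPowerSeries.subst_X (hasSubst_shearVars c)]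
  change MvPowerSeries.X 0 + MvPowerSeries.C c * MvPowerSeries.X 1 =
    (xx : MvPowerSeries (Fin 2) ℂ) + c • (yy : MvPowerSeries (Fin 2) ℂ)
  rw [coe_xx, coe_yy, MvPowerSeries.smul_eq_C_mul]

theorem shearHom_yy (c : ℂ) : shearHom c yy = yy := by
  refine Subtype.ext ?_
  rw [coe_shearHom, coe_yy, MvPowerSeries.subst_X (hasSubst_shearVars c)]
  rfl

theorem shearHom_shearHom_neg (c : ℂ) (f : convergentSeries) :
    shearHom c (shearHom (-c) f) = f := by
  refine Subtype.ext ?_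
  rw [coe_shearHom, coe_shearHom,
    MvPowerSeries.subst_comp_subst_apply (hasSubst_shearVars _) (hasSubst_shearVars _)]
  have h : (fun s => MvPowerSeries.subst (shearVars c) (shearVars (-c) s)) =
      (MvPowerSeries.X : Fin 2 → MvPowerSeries (Fin 2) ℂ) := by
    have hy : MvPowerSeries.subst (shearVars c) (MvPowerSeries.X 1 : MvPowerSeries (Fin 2) ℂ) =
        MvPowerSeries.X 1 := MvPowerSeries.subst_X (hasSubst_shearVars c) 1
    have hx : MvPowerSeries.subst (shearVars c) (MvPowerSeries.X 0 : MvPowerSeries (Fin 2) ℂ) =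
        MvPowerSeries.X 0 + MvPowerSeries.C c * MvPowerSeries.X 1 :=
      MvPowerSeries.subst_X (hasSubst_shearVars c) 0
    funext i
    fin_cases i
    · change MvPowerSeries.subst (shearVars c)
        (MvPowerSeries.X 0 + MvPowerSeries.C (-c) * MvPowerSeries.X 1) = MvPowerSeries.X 0
      rw [MvPowerSeries.subst_add (hasSubst_shearVars c), ← MvPowerSeries.smul_eq_C_mul,
        MvPowerSeries.subst_smul (hasSubst_shearVars c), hx, hy, neg_smul,
        MvPowerSeries.smul_eq_C_mul]
      ring
    · exact hy
  rw [h, MvPowerSeries.subst_self]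
  rfl

/-- The change of coordinates `(x, y) ↦ (x + c y, y)`. -/
def shear (c : ℂ) : convergentSeries ≃ₐ[ℂ] convergentSeries :=
  AlgEquiv.ofAlgHom (shearHom c) (shearHom (-c))
    (AlgHom.ext fun f => shearHom_shearHom_neg c f)
    (AlgHom.ext fun f => by
      have := shearHom_shearHom_neg (-c) f
      rwa [neg_neg] at this)

theorem shear_xx (c : ℂ) : shear c xx = xx + c • yy := shearHom_xx c
theorem shear_yy (c : ℂ) : shear c yy = yy := shearHom_yy c

/-! ### Order and multiplicity -/

theorem eq_xx_mul_add_yy_mul {f : convergentSeries} (h : cf f 0 0 = 0) :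
    f = xx * shift 1 0 f + yy * shift 0 1 (f - xx * shift 1 0 f) := by
  have : f - xx * shift 1 0 f = yy * shift 0 1 (f - xx * shift 1 0 f) := by
    refine eq_mono_mul fun k l hkl => ?_
    obtain rfl : l = 0 := by omega
    rw [cf_sub, cf_mono_mul]
    split_ifs with h1
    · rw [cf_shift, Nat.sub_add_cancel h1.1, add_zero, sub_self]
    · obtain rfl : k = 0 := by omega
      rw [h, sub_zero]
  rw [← this]
  ring

theorem cf_shift_sub (f : convergentSeries) (i j : ℕ) :
    cf (shift 0 1 (f - xx * shift 1 0 f)) i j = if i = 0 then cf f 0 (j + 1) else 0 := by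
  rw [cf_shift, cf_sub, cf_mono_mul, add_zero]
  rcases Nat.eq_zero_or_pos i with rfl | hi
  · simp
  · rw [if_pos ⟨hi, by omega⟩, if_neg (by omega), cf_shift, Nat.sub_add_cancel hi, Nat.sub_zero,
      add_zero, sub_self]

theorem le_germOrder_add {n : ℕ∞} {f g : convergentSeries} (hf : n ≤ germOrder f)
    (hg : n ≤ germOrder g) : n ≤ germOrder (f + g) :=
  (le_min hf hg).trans MvPowerSeries.min_order_le_add

theorem one_le_germOrder_iff {f : convergentSeries} : 1 ≤ germOrder f ↔ ¬ IsUnit f := by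
  have := germOrder_le_iff (f := f) (n := 1)
  rw [Nat.cast_one] at this
  rw [this, isUnit_iff, not_not]
  constructor
  · exact fun h => h 0 0 (by omega)
  · intro h i j hij
    obtain rfl : i = 0 := by omega
    obtain rfl : j = 0 := by omega
    exact h

/-- An automorphism preserves the maximal ideal `(x, y)`, hence its powers. -/
theorem le_germOrder_map (φ : convergentSeries ≃ₐ[ℂ] convergentSeries) (n : ℕ) :
    ∀ f, (n : ℕ∞) ≤ germOrder f → (n : ℕ∞) ≤ germOrder (φ f) := by
  have hnu : ∀ f, ¬ IsUnit f → 1 ≤ germOrder (φ f) := fun f hf =>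
    one_le_germOrder_iff.2 fun h => hf ((MulEquiv.isUnit_map φ).1 h)
  have hx : 1 ≤ germOrder (φ xx) := hnu _ (by rw [isUnit_iff, cf_mono]; simp)
  have hy : 1 ≤ germOrder (φ yy) := hnu _ (by rw [isUnit_iff, cf_mono]; simp)
  induction n with
  | zero => simp
  | succ n ih =>
    intro f hf
    have hf' := germOrder_le_iff.1 hf
    rw [eq_xx_mul_add_yy_mul (hf' 0 0 (by omega)), map_add, map_mul, map_mul]
    refine le_germOrder_add ?_ ?_
    · rw [germOrder_mul, Nat.cast_succ, add_comm]
      refine add_le_add hx (ih _ (germOrder_le_iff.2 fun i j hij => ?_))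
      rw [cf_shift]
      exact hf' _ _ (by omega)
    · rw [germOrder_mul, Nat.cast_succ, add_comm]
      refine add_le_add hy (ih _ (germOrder_le_iff.2 fun i j hij => ?_))
      rw [cf_shift_sub]
      split_ifs with h
      · exact hf' _ _ (by omega)
      · rfl

theorem germOrder_map (φ : convergentSeries ≃ₐ[ℂ] convergentSeries) (f : convergentSeries) :
    germOrder (φ f) = germOrder f := by
  have key : ∀ (ψ : convergentSeries ≃ₐ[ℂ] convergentSeries) g,
      germOrder g ≤ germOrder (ψ g) := fun ψ g =>
    ENat.forall_natCast_le_iff_le.1 fun n hn => le_germOrder_map ψ n g hn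
  refine le_antisymm ?_ (key φ f)
  have := key φ.symm (φ f)
  rwa [AlgEquiv.symm_apply_apply] at this

theorem germOrder_eq_of_associated {f g : convergentSeries} (h : Associated f g) :
    germOrder f = germOrder g := by
  obtain ⟨u, rfl⟩ := h
  have hu : germOrder (u : convergentSeries) = 0 := by
    by_contra h0
    exact one_le_germOrder_iff.1 (Order.one_le_iff_ne_zero.2 h0) u.isUnit
  rw [germOrder_mul, hu, add_zero]

theorem coe_germMultiplicity {f : convergentSeries} (hf : f ≠ 0) :
    (germMultiplicity f : ℕ∞) = germOrder f :=
  ENat.natCast_toNat fun h => hf (Subtype.ext (MvPowerSeries.order_eq_top_iff.1 h))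

theorem germMultiplicity_eq_of_germIso {f g : convergentSeries} (h : GermIso f g) :
    germMultiplicity f = germMultiplicity g := by
  obtain ⟨φ, hφ⟩ := h
  rw [germMultiplicity, germMultiplicity, ← germOrder_eq_of_associated hφ, germOrder_map]

/-- The restriction to the line `x = c y`, whose leading term is the value of the leading form. -/
theorem cf_shear (c : ℂ) (m : ℕ) : ∀ f, (m : ℕ∞) ≤ germOrder f →
    cf (shear c f) 0 m = ∑ i ∈ range (m + 1), cf f i (m - i) * c ^ i := by
  induction m with
  | zero =>
    intro f _
    have h1 : f = cf f 0 0 • 1 + (f - cf f 0 0 • 1) := by ring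
    have h2 : cf (shear c (f - cf f 0 0 • 1)) 0 0 = 0 := by
      by_contra h0
      refine isUnit_iff.1 ((MulEquiv.isUnit_map (shear c)).1 (isUnit_iff.2 h0)) ?_
      rw [cf_sub, cf_smul, cf_one, if_pos ⟨rfl, rfl⟩, mul_one, sub_self]
    conv_lhs => rw [h1]
    rw [map_add, cf_add, h2, map_smul, map_one, cf_smul, cf_one]
    simp
  | succ m ih =>
    intro f hf
    have hf' := germOrder_le_iff.1 hf
    conv_lhs => rw [eq_xx_mul_add_yy_mul (hf' 0 0 (by omega))]
    rw [map_add, map_mul, map_mul, shear_xx, shear_yy, add_mul, cf_add, cf_add, cf_mono_mul,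
      if_neg (by omega), zero_add, smul_mul_assoc, cf_smul, cf_mono_mul, if_pos (by omega),
      cf_mono_mul, if_pos (by omega), Nat.sub_self, Nat.add_sub_cancel, ih _ _, ih _ _,
      Finset.sum_range_succ' _ (m + 1), Finset.mul_sum]
    · congr 1
      · refine Finset.sum_congr rfl fun i hi => ?_
        rw [cf_shift, add_zero, pow_succ, Nat.add_sub_add_right]
        ring
      · rw [Finset.sum_eq_single 0]
        · rw [cf_shift_sub]
          simp
        · intro i _ hi
          rw [cf_shift_sub, if_neg hi, zero_mul]
        · simp
    · refine germOrder_le_iff.2 fun i j hij => ?_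
      rw [cf_shift_sub]
      split_ifs
      · exact hf' _ _ (by omega)
      · rfl
    · refine germOrder_le_iff.2 fun i j hij => ?_
      rw [cf_shift]
      exact hf' _ _ (by omega)

/-- After a linear change of coordinates, a series of order `m` is regular of order `m` in `y`. -/
theorem exists_isRegular_shear {f : convergentSeries} (hf : f ≠ 0) :
    ∃ c, IsRegular (germMultiplicity f) (shear c f) := by
  classical
  set m := germMultiplicity f with hm
  have hord : (m : ℕ∞) = germOrder f := coe_germMultiplicity hf
  set P : Polynomial ℂ := ∑ i ∈ range (m + 1), Polynomial.monomial i (cf f i (m - i)) with hP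
  have hP0 : P ≠ 0 := by
    intro h0
    have h1 : ((m + 1 : ℕ) : ℕ∞) ≤ germOrder f := by
      refine germOrder_le_iff.2 fun i j hij => ?_
      rcases Nat.lt_or_ge (i + j) m with h | h
      · exact germOrder_le_iff.1 hord.le i j h
      · have h2 := congrArg (fun p => Polynomial.coeff p i) h0
        simp only [hP, Polynomial.finsetSum_coeff, Polynomial.coeff_monomial, Polynomial.coeff_zero,
          Finset.sum_ite_eq', Finset.mem_range] at h2
        rw [if_pos (by omega)] at h2
        rwa [show j = m - i by omega]
    rw [← hord] at h1
    have : m + 1 ≤ m := by exact_mod_cast h1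
    omega
  obtain ⟨c, hc⟩ : ∃ c, P.eval c ≠ 0 := by
    by_contra! h
    exact hP0 (Polynomial.funext fun c => by rw [h c, Polynomial.eval_zero])
  have hord' : (m : ℕ∞) ≤ germOrder (shear c f) := by rw [germOrder_map, hord]
  refine ⟨c, fun j hj => germOrder_le_iff.1 hord' 0 j (by omega), ?_⟩
  rw [cf_shear c m f hord.le]
  rwa [hP, Polynomial.eval_finsetSum,
    Finset.sum_congr rfl fun i _ => Polynomial.eval_monomial] at hc

/-! ### Invariance of `δ` under isomorphism -/

section Transport

variable {k O O' : Type*} [Field k] [CommRing O] [CommRing O'] [Algebra k O] [Algebra k O']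

theorem nonempty_normalizationQuotient_equiv (e : O ≃ₐ[k] O') :
    Nonempty (NormalizationQuotient O ≃ₗ[k] NormalizationQuotient O') := by
  let E : FractionRing O ≃+* FractionRing O' := IsFractionRing.ringEquivOfRingEquiv e.toRingEquiv
  have hE : ∀ o, E (algebraMap O _ o) = algebraMap O' _ (e o) := fun o =>
    IsFractionRing.ringEquivOfRingEquiv_algebraMap e.toRingEquiv o
  have hE' : ∀ o, E.symm (algebraMap O' _ o) = algebraMap O _ (e.symm o) := fun o => by
    rw [RingEquiv.symm_apply_eq, hE, AlgEquiv.apply_symm_apply]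
  have hk : ∀ (c : k) z, E (c • z) = c • E z := by
    intro c z
    have h1 : algebraMap k (FractionRing O) c = algebraMap O _ (algebraMap k O c) :=
      IsScalarTower.algebraMap_apply k O (FractionRing O) c
    have h2 : algebraMap k (FractionRing O') c = algebraMap O' _ (algebraMap k O' c) :=
      IsScalarTower.algebraMap_apply k O' (FractionRing O') c
    rw [Algebra.smul_def, Algebra.smul_def, map_mul, h1, h2, hE, AlgEquiv.commutes]
  have hi : ∀ z, IsIntegral O z → IsIntegral O' (E z) := fun z hz =>
    hz.map_of_comp_eq (e : O →+* O') (E : FractionRing O →+* FractionRing O')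
      (RingHom.ext fun o => (hE o).symm)
  have hi' : ∀ z, IsIntegral O' z → IsIntegral O (E.symm z) := fun z hz =>
    hz.map_of_comp_eq (e.symm : O' →+* O) (E.symm : FractionRing O' →+* FractionRing O)
      (RingHom.ext fun o => (hE' o).symm)
  let N := integralClosure O (FractionRing O)
  let N' := integralClosure O' (FractionRing O')
  let F : N ≃ₗ[k] N' :=
    { toFun := fun z => ⟨E z, hi _ z.2⟩
      invFun := fun z => ⟨E.symm z, hi' _ z.2⟩
      map_add' := fun z w => Subtype.ext (map_add E _ _)
      map_smul' := fun c z => Subtype.ext (hk c z)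
      left_inv := fun z => Subtype.ext (E.symm_apply_apply _)
      right_inv := fun z => Subtype.ext (E.apply_symm_apply _) }
  let S := (LinearMap.range (Algebra.linearMap O N)).restrictScalars k
  let S' := (LinearMap.range (Algebra.linearMap O' N')).restrictScalars k
  have hS : S.map (F : N →ₗ[k] N') = S' := by
    ext z
    constructor
    · rintro ⟨w, ⟨o, rfl⟩, rfl⟩
      exact ⟨e o, Subtype.ext (hE o).symm⟩
    · rintro ⟨o, rfl⟩
      refine ⟨Algebra.linearMap O N (e.symm o), ⟨_, rfl⟩, Subtype.ext ?_⟩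
      refine (hE (e.symm o)).trans ?_
      rw [AlgEquiv.apply_symm_apply]
      rfl
  exact ⟨(Submodule.Quotient.restrictScalarsEquiv k _).symm.trans
    ((Submodule.Quotient.equiv S S' F hS).trans (Submodule.Quotient.restrictScalarsEquiv k _))⟩

end Transport

theorem GermIso.nonempty_deltaModule_equiv {f g : convergentSeries} (h : GermIso f g) :
    Nonempty (DeltaModule f ≃ₗ[ℂ] DeltaModule g) := by
  obtain ⟨φ, hφ⟩ := h
  have hI : Ideal.span {g} = (Ideal.span {f}).map (φ : convergentSeries →+* convergentSeries) := by
    rw [Ideal.map_span, Set.image_singleton]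
    exact (Ideal.span_singleton_eq_span_singleton.2 hφ).symm
  exact nonempty_normalizationQuotient_equiv
    (Ideal.quotientEquivAlg (Ideal.span {f}) (Ideal.span {g}) φ hI)

theorem GermIso.delta_eq {f g : convergentSeries} (h : GermIso f g) : delta f = delta g :=
  h.nonempty_deltaModule_equiv.some.finrank_eq

theorem GermIso.squarefree {f g : convergentSeries} (h : GermIso f g) (hf : Squarefree f) :
    Squarefree g := by
  obtain ⟨φ, hφ⟩ := h
  intro x hx
  have h1 : φ.symm x * φ.symm x ∣ f := by
    have := map_dvd φ.symm (hx.trans hφ.symm.dvd)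
    rwa [map_mul, AlgEquiv.symm_apply_apply] at this
  exact (MulEquiv.isUnit_map φ.symm).1 (hf _ h1)

theorem GermIso.irreducible_iff {f g : convergentSeries} (h : GermIso f g) :
    Irreducible f ↔ Irreducible g := by
  obtain ⟨φ, hφ⟩ := h
  rw [← hφ.irreducible_iff, MulEquiv.irreducible_iff φ]

theorem germIso_shear (c : ℂ) (f : convergentSeries) : GermIso f (shear c f) :=
  ⟨shear c, Associated.refl _⟩

/-! ### Finiteness of `δ` and the lower bound by the multiplicity -/

theorem IsWeierstrassPolynomial.xVar_pow_dvd {m : ℕ} {f : convergentSeries}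
    {W : Polynomial xSeries} (hW : IsWeierstrassPolynomial m f W)
    (hord : (m : ℕ∞) ≤ germOrder f) (j : ℕ) : xVar ^ (W.natDegree - j) ∣ W.coeff j := by
  obtain ⟨b, hb, -⟩ := PlaneCurve.xVar_pow_dvd (a := W.coeff j) (n := W.natDegree - j)
    fun i hi => by
      rw [← cf_aeval]
      rw [← germOrder_eq_of_associated hW.associated] at hord
      exact germOrder_le_iff.1 hord i j (by rw [hW.natDegree_eq] at hi; omega)
  exact ⟨b, hb⟩

theorem finiteDimensional_deltaModule {f : convergentSeries} (hsq : Squarefree f) :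
    FiniteDimensional ℂ (DeltaModule f) := by
  obtain ⟨c, hc⟩ := exists_isRegular_shear hsq.ne_zero
  obtain ⟨W, hW⟩ := hc.exists_weierstrassPolynomial
  have hiso := germIso_shear c f
  have : FiniteDimensional ℂ (DeltaModule (shear c f)) :=
    (hW.isMonogenic hc).finite_normalizationQuotient (hW.separable (hiso.squarefree hsq))
  exact Module.Finite.equiv hiso.nonempty_deltaModule_equiv.some.symm

theorem germMultiplicity_sub_one_le_delta {f : convergentSeries} (hsq : Squarefree f) :
    germMultiplicity f - 1 ≤ delta f := by
  obtain ⟨c, hc⟩ := exists_isRegular_shear hsq.ne_zero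
  obtain ⟨W, hW⟩ := hc.exists_weierstrassPolynomial
  have hiso := germIso_shear c f
  have hfin := finiteDimensional_deltaModule (hiso.squarefree hsq)
  have hord : (germMultiplicity f : ℕ∞) ≤ germOrder (shear c f) := by
    rw [germOrder_map, coe_germMultiplicity hsq.ne_zero]
  have h := (hW.isMonogenic hc).le_finrank (hW.xVar_pow_dvd hord)
    (by rw [hW.map_xConst, hW.natDegree_eq]) hfin
  rw [hW.natDegree_eq] at h
  rw [hiso.delta_eq]
  exact h

/-! ### Branches -/

theorem branches_spec {f : convergentSeries} (hf : f ≠ 0) :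
    (∀ g ∈ branches f, Irreducible g) ∧ Associated (branches f).prod f := by
  rw [branches, dif_neg hf]
  exact (WfDvdMonoid.exists_factors f hf).choose_spec

theorem one_le_germMultiplicity {f : convergentSeries} (hf : f ≠ 0) (hu : ¬ IsUnit f) :
    1 ≤ germMultiplicity f := by
  have := one_le_germOrder_iff.2 hu
  rw [← coe_germMultiplicity hf] at this
  exact_mod_cast this

theorem germMultiplicity_mul {f g : convergentSeries} (hf : f ≠ 0) (hg : g ≠ 0) :
    germMultiplicity (f * g) = germMultiplicity f + germMultiplicity g := by
  have h := germOrder_mul f g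
  rw [← coe_germMultiplicity hf, ← coe_germMultiplicity hg,
    ← coe_germMultiplicity (mul_ne_zero hf hg)] at h
  exact_mod_cast h

theorem sum_germMultiplicity_sub_one (S : Multiset convergentSeries)
    (hS : ∀ g ∈ S, Irreducible g) :
    (S.map fun g => (germMultiplicity g : ℤ) - 1).sum =
      (germMultiplicity S.prod : ℤ) - S.card := by
  induction S using Multiset.induction with
  | empty =>
    have h : germMultiplicity 1 = 0 := by
      have := germMultiplicity_mul (one_ne_zero (α := convergentSeries)) one_ne_zero
      rw [mul_one] at this
      omega
    simp [h]
  | cons g S ih =>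
    have hg := (hS g (Multiset.mem_cons_self g S)).ne_zero
    have hS' : ∀ h ∈ S, Irreducible h := fun h hh => hS h (Multiset.mem_cons_of_mem hh)
    have hP : S.prod ≠ 0 := Multiset.prod_ne_zero fun h0 => (hS' 0 h0).ne_zero rfl
    rw [Multiset.map_cons, Multiset.sum_cons, ih hS', Multiset.prod_cons, Multiset.card_cons,
      germMultiplicity_mul hg hP]
    push_cast
    ring

theorem germVirtualCusps_eq {f : convergentSeries} (hf : f ≠ 0) :
    germVirtualCusps f = (germMultiplicity f : ℤ) - (branches f).card := by
  obtain ⟨h1, h2⟩ := branches_spec hf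
  rw [germVirtualCusps, sum_germMultiplicity_sub_one _ h1, germMultiplicity, germMultiplicity,
    germOrder_eq_of_associated h2]

theorem germVirtualNodes_eq (f : convergentSeries) :
    germVirtualNodes f = (delta f : ℤ) - germVirtualCusps f := rfl

theorem germVirtualCusps_nonneg {f : convergentSeries} (hf : f ≠ 0) : 0 ≤ germVirtualCusps f := by
  refine Multiset.sum_nonneg fun a ha => ?_
  obtain ⟨g, hg, rfl⟩ := Multiset.mem_map.1 ha
  have hg := (branches_spec hf).1 g hg
  have := one_le_germMultiplicity hg.ne_zero hg.not_isUnit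
  omega

theorem card_branches_pos {f : convergentSeries} (hf : f ≠ 0) (hu : ¬ IsUnit f) :
    0 < (branches f).card := by
  rw [Multiset.card_pos]
  intro h0
  have h := (branches_spec hf).2
  rw [h0, Multiset.prod_zero] at h
  exact hu (associated_one_iff_isUnit.1 h.symm)

theorem germVirtualNodes_nonneg {f : convergentSeries} (hsq : Squarefree f) (hu : ¬ IsUnit f) :
    0 ≤ germVirtualNodes f := by
  have h1 := germMultiplicity_sub_one_le_delta hsq
  have h2 := card_branches_pos hsq.ne_zero hu
  rw [germVirtualNodes_eq, germVirtualCusps_eq hsq.ne_zero]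
  omega

theorem card_branches_eq_one_iff {f : convergentSeries} (hf : f ≠ 0) :
    (branches f).card = 1 ↔ Irreducible f := by
  obtain ⟨h1, h2⟩ := branches_spec hf
  constructor
  · intro h
    obtain ⟨g, hg⟩ := Multiset.card_eq_one.1 h
    rw [hg, Multiset.prod_singleton] at h2
    exact h2.irreducible (h1 g (by rw [hg]; exact Multiset.mem_singleton_self g))
  · intro h
    obtain ⟨g, hg⟩ := Multiset.card_pos_iff_exists_mem.1 (card_branches_pos hf h.not_isUnit)
    obtain ⟨S, hS⟩ := Multiset.exists_cons_of_mem hg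
    rw [hS, Multiset.prod_cons] at h2
    have h3 := (h2.symm.irreducible h).isUnit_or_isUnit rfl
    have h4 : IsUnit S.prod := h3.resolve_left (h1 g hg).not_isUnit
    have h5 : S = 0 := by
      refine Multiset.eq_zero_of_forall_notMem fun a ha => ?_
      exact (h1 a (by rw [hS]; exact Multiset.mem_cons_of_mem ha)).not_isUnit
        (isUnit_of_dvd_unit (Multiset.dvd_prod ha) h4)
    rw [hS, h5, Multiset.card_cons, Multiset.card_zero]

theorem card_branches_le {f : convergentSeries} (hf : f ≠ 0) :
    (branches f).card ≤ germMultiplicity f := by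
  have := germVirtualCusps_nonneg hf
  rw [germVirtualCusps_eq hf] at this
  omega

/-! ### Ordinary nodes and cusps -/

theorem polyGerm_X_zero : polyGerm (X 0) = xx :=
  Subtype.ext (by rw [coe_xx]; exact MvPolynomial.coe_X 0)

theorem polyGerm_X_one : polyGerm (X 1) = yy :=
  Subtype.ext (by rw [coe_yy]; exact MvPolynomial.coe_X 1)

theorem polyGerm_node : polyGerm (X 0 * X 1) = xx * yy := by
  rw [← polyGerm_X_zero, ← polyGerm_X_one]
  exact Subtype.ext (MvPolynomial.coe_mul _ _)

theorem polyGerm_cusp : polyGerm (X 1 ^ 2 - X 0 ^ 3) = yy ^ 2 - xx ^ 3 := by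
  rw [← polyGerm_X_zero, ← polyGerm_X_one]
  refine Subtype.ext ?_
  change ((X 1 ^ 2 - X 0 ^ 3 : MvPolynomial (Fin 2) ℂ) : MvPowerSeries (Fin 2) ℂ) =
    ((X 1 : MvPolynomial (Fin 2) ℂ) : MvPowerSeries (Fin 2) ℂ) ^ 2 -
    ((X 0 : MvPolynomial (Fin 2) ℂ) : MvPowerSeries (Fin 2) ℂ) ^ 3
  rw [← MvPolynomial.coe_pow, ← MvPolynomial.coe_pow]
  exact map_sub MvPolynomial.coeToMvPowerSeries.ringHom _ _

theorem germMultiplicity_eq_of_germOrder {f : convergentSeries} {n : ℕ} (h : germOrder f = n) :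
    germMultiplicity f = n := by
  rw [germMultiplicity, h, ENat.toNat_natCast]

theorem germMultiplicity_eq {f : convergentSeries} {n i j : ℕ}
    (h0 : ∀ i j, i + j < n → cf f i j = 0)
    (hij : i + j = n) (h1 : cf f i j ≠ 0) : germMultiplicity f = n := by
  refine germMultiplicity_eq_of_germOrder (le_antisymm ?_ (germOrder_le_iff.2 h0))
  by_contra! h
  have h2 : ((n + 1 : ℕ) : ℕ∞) ≤ germOrder f := by
    rw [Nat.cast_succ]
    exact Order.add_one_le_of_lt h
  exact h1 (germOrder_le_iff.1 h2 i j (by omega))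

theorem cf_cusp (i j : ℕ) : cf (yy ^ 2 - xx ^ 3) i j =
    (if i = 0 ∧ j = 2 then 1 else 0) - (if i = 3 ∧ j = 0 then 1 else 0) := by
  have hy : yy ^ 2 = mono 0 2 := by rw [mono_eq, pow_zero, one_mul]
  have hx : xx ^ 3 = mono 3 0 := by rw [mono_eq, pow_zero, mul_one]
  rw [hy, hx, cf_sub, cf_mono, cf_mono]

theorem germMultiplicity_cusp : germMultiplicity (yy ^ 2 - xx ^ 3) = 2 := by
  refine germMultiplicity_eq (i := 0) (j := 2) (fun i j hij => ?_) rfl ?_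
  · rw [cf_cusp, if_neg (by omega), if_neg (by omega), sub_zero]
  · rw [cf_cusp]
    simp

theorem germMultiplicity_node : germMultiplicity (xx * yy) = 2 := by
  rw [mono_mul_mono]
  refine germMultiplicity_eq (i := 1) (j := 1) (fun i j hij => ?_) rfl ?_
  · rw [cf_mono, if_neg (by omega)]
  · rw [cf_mono]
    simp

theorem irreducible_cusp : Irreducible (yy ^ 2 - xx ^ 3) := by
  refine ⟨fun h => isUnit_iff.1 h (by rw [cf_cusp]; simp), fun a b hab => ?_⟩
  by_contra! h
  rw [isUnit_iff, isUnit_iff, not_not, not_not] at h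
  obtain ⟨ha, hb⟩ := h
  -- comparing coefficients, the linear parts of both factors are multiples of `y`, and then the
  -- product has no term `x ^ 3`
  have e20 := cf_cusp 2 0
  have e11 := cf_cusp 1 1
  have e02 := cf_cusp 0 2
  have e30 := cf_cusp 3 0
  rw [hab, cf_mul] at e20 e11 e02 e30
  simp only [Finset.sum_range_succ, Finset.sum_range_zero, ha, hb, Nat.sub_self, Nat.sub_zero,
    zero_mul, mul_zero, zero_add, add_zero, Nat.reduceSub, Nat.reduceAdd] at e20 e11 e02 e30
  norm_num at e20 e11 e02 e30
  have h1 : cf a 0 1 ≠ 0 := left_ne_zero_of_mul_eq_one e02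
  have h2 : cf b 0 1 ≠ 0 := right_ne_zero_of_mul_eq_one e02
  have h3 : cf a 1 0 = 0 ∧ cf b 1 0 = 0 := by
    rcases e20 with h | h
    · refine ⟨h, ?_⟩
      rw [h] at e11
      simpa [h1] using e11
    · refine ⟨?_, h⟩
      rw [h] at e11
      simpa [h2] using e11
  rw [h3.1, h3.2] at e30
  norm_num at e30

theorem not_irreducible_node : ¬ Irreducible (xx * yy) := by
  intro h
  rcases h.isUnit_or_isUnit rfl with h | h
  · exact isUnit_iff.1 h (by rw [cf_mono]; simp)
  · exact isUnit_iff.1 h (by rw [cf_mono]; simp)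

theorem nontrivial_germRing {f : convergentSeries} (hf : ¬ IsUnit f) : Nontrivial (GermRing f) :=
  Ideal.Quotient.nontrivial_iff.2 fun h => hf (Ideal.span_singleton_eq_top.1 h)

open Polynomial in
/-- The bound `δ ≤ 1` for `y ^ 2 + b y + c` with discriminant `x ^ 2 * D`, where the hypothesis
`hD` expresses that `D` is squarefree. -/
theorem delta_le_one_of_discriminant {f : convergentSeries} (hsq : Squarefree f) {b c D : xSeries}
    (hf : f = yy ^ 2 + algebraMap xSeries convergentSeries b * yy +
      algebraMap xSeries convergentSeries c)
    (hb : cf (algebraMap xSeries convergentSeries b) 0 0 = 0)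
    (hc : cf (algebraMap xSeries convergentSeries c) 0 0 = 0)
    (hdisc : b ^ 2 - 4 * c = xVar ^ 2 * D) (hD0 : D ≠ 0) (hD : ∀ p, D ∣ p ^ 2 → D ∣ p) :
    delta f ≤ 1 := by
  set W : xSeries[X] := Polynomial.X ^ 2 + Polynomial.C b * Polynomial.X + Polynomial.C c with hWd
  have hWf : Polynomial.aeval yy W = f := by
    rw [hWd, hf, map_add, map_add, map_mul, map_pow, Polynomial.aeval_X, Polynomial.aeval_C,
      Polynomial.aeval_C]
  have hdeg : W.natDegree = 2 := by
    rw [hWd]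
    compute_degree!
  have hmonic : W.Monic := by
    rw [hWd]
    monicity!
  have hcoeff : ∀ j < 2, cf (algebraMap xSeries convergentSeries (W.coeff j)) 0 0 = 0 := by
    intro j hj
    interval_cases j
    · simp [hWd, hc]
    · simp [hWd, hb, Polynomial.coeff_C]
  have hW : IsWeierstrassPolynomial 2 f W := ⟨hmonic, hdeg, hcoeff, by rw [hWf]⟩
  have hreg : IsRegular 2 f := by
    refine ⟨fun j hj => ?_, ?_⟩
    · rw [← hWf, cf_aeval]
      exact hcoeff j hj
    · have := hmonic.coeff_natDegree
      rw [hdeg] at this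
      rw [← hWf, cf_aeval, this, map_one, cf_one, if_pos ⟨rfl, rfl⟩]
      exact one_ne_zero
  have hu : ¬ IsUnit f := fun h => isUnit_iff.1 h (hreg.1 0 two_pos)
  have := nontrivial_germRing hu
  exact (hW.isMonogenic hreg).finrank_le_one hWd hdisc hD0 hD (hW.separable hsq)

theorem delta_cusp (hsq : Squarefree (yy ^ 2 - xx ^ 3)) : delta (yy ^ 2 - xx ^ 3) = 1 := by
  refine le_antisymm ?_ ?_
  · have hx : (algebraMap xSeries convergentSeries (-xVar ^ 3)) = -xx ^ 3 := by
      rw [map_neg, map_pow, coe_xVar]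
    have h4 : IsUnit (4 : xSeries) := by
      have h := (IsUnit.mk0 (4 : ℂ) (by norm_num)).map (algebraMap ℂ xSeries)
      rwa [map_ofNat] at h
    refine delta_le_one_of_discriminant hsq (b := 0) (c := -xVar ^ 3) (D := 4 * xVar) ?_ ?_ ?_ ?_ ?_
      fun p hp => ?_
    · rw [hx, map_zero]
      ring
    · rw [map_zero, cf_zero]
    · have : xx ^ 3 = mono 3 0 := by rw [mono_eq, pow_zero, mul_one]
      rw [hx, this, cf_neg, cf_mono, if_neg (by omega), neg_zero]
    · ring
    · exact mul_ne_zero h4.ne_zero xVar_irreducible.ne_zero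
    · rw [h4.mul_left_dvd] at hp ⊢
      exact xVar_irreducible.prime.dvd_of_dvd_pow hp
  · have := germMultiplicity_sub_one_le_delta hsq
    rwa [germMultiplicity_cusp] at this

theorem delta_node (hsq : Squarefree (xx * yy)) : delta (xx * yy) = 1 := by
  refine le_antisymm ?_ ?_
  · have hiso := germIso_shear 1 (xx * yy)
    rw [hiso.delta_eq]
    refine delta_le_one_of_discriminant (hiso.squarefree hsq) (b := xVar) (c := 0) (D := 1)
      ?_ ?_ ?_ ?_ one_ne_zero fun p _ => one_dvd p
    · rw [map_mul, shear_xx, shear_yy, map_zero, coe_xVar, one_smul]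
      ring
    · rw [coe_xVar, cf_mono, if_neg (by omega)]
    · rw [map_zero, cf_zero]
    · ring
  · have := germMultiplicity_sub_one_le_delta hsq
    rwa [germMultiplicity_node] at this

theorem virtual_of_isOrdinaryCusp {f : convergentSeries} (hsq : Squarefree f)
    (h : IsOrdinaryCusp f) : germVirtualCusps f = 1 ∧ germVirtualNodes f = 0 := by
  rw [IsOrdinaryCusp, polyGerm_cusp] at h
  have h1 := (card_branches_eq_one_iff hsq.ne_zero).2 (h.irreducible_iff.2 irreducible_cusp)
  have h2 := germMultiplicity_eq_of_germIso h
  rw [germMultiplicity_cusp] at h2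
  have h3 := h.delta_eq
  rw [delta_cusp (h.squarefree hsq)] at h3
  rw [germVirtualNodes_eq, germVirtualCusps_eq hsq.ne_zero, h1, h2, h3]
  norm_num

theorem virtual_of_isOrdinaryNode {f : convergentSeries} (hsq : Squarefree f)
    (h : IsOrdinaryNode f) : germVirtualCusps f = 0 ∧ germVirtualNodes f = 1 := by
  rw [IsOrdinaryNode, polyGerm_node] at h
  have h2 := germMultiplicity_eq_of_germIso h
  rw [germMultiplicity_node] at h2
  have hu : ¬ IsUnit f := by
    intro hu
    have h4 := germOrder_eq_of_associated (associated_one_iff_isUnit.2 hu)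
    have h5 := one_le_germOrder_iff.not.2 (not_not.2 hu)
    rw [← coe_germMultiplicity hsq.ne_zero, h2] at h5
    exact h5 (by norm_num)
  have h1 : (branches f).card = 2 := by
    have h5 := card_branches_pos hsq.ne_zero hu
    have h6 := card_branches_le hsq.ne_zero
    have h7 := (card_branches_eq_one_iff hsq.ne_zero).not.2
      (fun h' => not_irreducible_node (h.irreducible_iff.1 h'))
    omega
  have h3 := h.delta_eq
  rw [delta_node (h.squarefree hsq)] at h3
  rw [germVirtualNodes_eq, germVirtualCusps_eq hsq.ne_zero, h1, h2, h3]
  norm_num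

/-! ### The Jacobian ideal of a reduced form -/

/-- Homogeneity: multiplying all arguments of a form by `t` multiplies its value by `t ^ n`. -/
theorem aeval_mul_of_isHomogeneous {σ A : Type*} [Fintype σ] [CommRing A] [Algebra ℂ A]
    {n : ℕ} {G : MvPolynomial σ ℂ} (hG : G.IsHomogeneous n) (t : A) (a : σ → A) :
    aeval (fun i => t * a i) G = t ^ n * aeval a G := by
  rw [aeval_def, aeval_def, eval₂_eq', eval₂_eq', Finset.mul_sum]
  refine Finset.sum_congr rfl fun d hd => ?_
  have hn : ∑ i, d i = n := by
    rw [← Finsupp.degree_eq_sum]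
    exact (hG.degree_eq_sum_deg_support hd).symm
  simp_rw [mul_pow]
  rw [Finset.prod_mul_distrib, Finset.prod_pow_eq_pow_sum, hn]
  ring

/-- The ideal generated by a polynomial and its partial derivatives. -/
def jacobianIdeal {σ : Type*} (F : MvPolynomial σ ℂ) : Ideal (MvPolynomial σ ℂ) :=
  Ideal.span (insert F (Set.range fun i => pderiv i F))

theorem mem_jacobianIdeal {σ : Type*} (F : MvPolynomial σ ℂ) : F ∈ jacobianIdeal F :=
  Ideal.subset_span (Set.mem_insert _ _)

theorem pderiv_mem_jacobianIdeal {σ : Type*} (F : MvPolynomial σ ℂ) (i : σ) :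
    pderiv i F ∈ jacobianIdeal F :=
  Ideal.subset_span (Set.mem_insert_of_mem _ ⟨i, rfl⟩)

theorem jacobianIdeal_le {σ : Type*} {F : MvPolynomial σ ℂ} {I : Ideal (MvPolynomial σ ℂ)}
    (h : F ∈ I) (h' : ∀ i, pderiv i F ∈ I) : jacobianIdeal F ≤ I :=
  Ideal.span_le.2 (Set.insert_subset h (Set.range_subset_iff.2 h'))

theorem eq_zero_of_dvd_pderiv {σ : Type*} {Q : MvPolynomial σ ℂ} {i : σ}
    (h : Q ∣ pderiv i Q) : pderiv i Q = 0 := by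
  classical
  by_contra h0
  obtain ⟨A, hA⟩ := h
  have hQ : Q ≠ 0 := fun h => h0 (by rw [h, map_zero])
  have hA0 : A ≠ 0 := fun h => h0 (by rw [hA, h, mul_zero])
  have h1 : degreeOf i Q ≤ degreeOf i (pderiv i Q) := by
    rw [hA, degreeOf_mul_eq hQ hA0]
    exact Nat.le_add_right _ _
  obtain ⟨m, hm, hmi⟩ : ∃ m ∈ (pderiv i Q).support, m i = degreeOf i (pderiv i Q) := by
    obtain ⟨m, hm, hmi⟩ := Finset.exists_mem_eq_sup (pderiv i Q).support
      (support_nonempty.2 h0) fun m => m i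
    exact ⟨m, hm, by rw [degreeOf_eq_sup, hmi]⟩
  rw [mem_support_iff, coeff_pderiv] at hm
  have h2 := monomial_le_degreeOf i (mem_support_iff.2 (left_ne_zero_of_mul hm))
  simp only [Finsupp.add_apply, Finsupp.single_eq_same] at h2
  omega

theorem eq_C_of_pderiv_eq_zero {σ : Type*} {Q : MvPolynomial σ ℂ} (h : ∀ i, pderiv i Q = 0) :
    Q = C (coeff 0 Q) := by
  classical
  ext m
  rw [coeff_C]
  split_ifs with hm
  · rw [hm]
  · obtain ⟨i, hi⟩ := Finsupp.ne_iff.1 (Ne.symm hm)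
    have h1 := congrArg (coeff (m - Finsupp.single i 1)) (h i)
    have hle : Finsupp.single i 1 ≤ m :=
      Finsupp.single_le_iff.2 (Nat.one_le_iff_ne_zero.2 (by simpa using hi))
    rw [coeff_pderiv, coeff_zero, tsub_add_cancel_of_le hle] at h1
    exact (mul_eq_zero.1 h1).resolve_right (Nat.cast_add_one_ne_zero _)

/-- Only a multiple factor of `F` can divide all its derivatives: if `F = Q R`, then `Q` divides
`R ∂Q`, hence `∂Q`, which has smaller degree. -/
theorem not_jacobianIdeal_le_span {σ : Type*} {F Q : MvPolynomial σ ℂ}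
    (hF : Squarefree F) (hQ : Prime Q) : ¬ jacobianIdeal F ≤ Ideal.span {Q} := by
  intro h
  obtain ⟨R, hR⟩ := Ideal.mem_span_singleton.1 (h (mem_jacobianIdeal F))
  have hQR : ¬ Q ∣ R := by
    rintro ⟨S, rfl⟩
    exact hQ.not_isUnit (hF Q ⟨S, by rw [hR, mul_assoc]⟩)
  have hd : ∀ i, pderiv i Q = 0 := by
    intro i
    have h1 := Ideal.mem_span_singleton.1 (h (pderiv_mem_jacobianIdeal F i))
    rw [hR, Derivation.leibniz, smul_eq_mul, smul_eq_mul] at h1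
    exact eq_zero_of_dvd_pderiv
      ((hQ.dvd_or_dvd ((dvd_add_right (dvd_mul_right _ _)).1 h1)).resolve_left hQR)
  have hC := eq_C_of_pderiv_eq_zero hd
  have hc : coeff 0 Q ≠ 0 := fun h0 => hQ.ne_zero (by rw [hC, h0, C_0])
  exact hQ.not_isUnit (by rw [hC]; exact (isUnit_iff_ne_zero.2 hc).map C)

/-- The singular locus of a reduced hypersurface has codimension at least two in affine space. -/
theorem two_le_height_jacobianIdeal {σ : Type*} [Finite σ] {F : MvPolynomial σ ℂ}
    (hF : Squarefree F) : 2 ≤ (jacobianIdeal F).height := by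
  rw [Ideal.height_eq_inf_minimalPrimes]
  refine le_iInf₂ fun P hP => ?_
  have hprime : P.IsPrime := hP.1.1
  have hle : jacobianIdeal F ≤ P := hP.1.2
  have hbot : P ≠ ⊥ := by
    rintro rfl
    exact hF.ne_zero (hle (mem_jacobianIdeal F))
  have h0 : P.height ≠ 0 := fun h => hbot (Ideal.height_eq_zero_iff_eq_bot.1 h)
  have h1 : P.height ≠ 1 := by
    intro h
    obtain ⟨Q, hQP, hQ⟩ := hprime.exists_mem_prime_of_ne_bot hbot
    exact not_jacobianIdeal_le_span hF hQ
      (hle.trans_eq (Ideal.eq_span_singleton_of_height_eq_one h hQP hQ))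
  have h2 : 1 < P.height := lt_of_le_of_ne (Order.one_le_iff_ne_zero.2 h0) h1.symm
  exact Order.add_one_le_of_lt h2

/-! ### The ideal of a point of the projective plane -/

/-- The restriction of polynomials to the line through the origin spanned by `v`. -/
def restrictLine (v : Fin 3 → ℂ) : MvPolynomial (Fin 3) ℂ →ₐ[ℂ] Polynomial ℂ :=
  aeval fun i => Polynomial.X * Polynomial.C (v i)

theorem eval_restrictLine (v : Fin 3 → ℂ) (t : ℂ) (G : MvPolynomial (Fin 3) ℂ) :
    (restrictLine v G).eval t = eval (fun i => t * v i) G := by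
  have h : ((Polynomial.aeval t).comp (restrictLine v) : MvPolynomial (Fin 3) ℂ →ₐ[ℂ] ℂ) =
      aeval fun i => t * v i := by
    refine MvPolynomial.algHom_ext fun i => ?_
    rw [AlgHom.comp_apply, restrictLine, aeval_X, aeval_X, map_mul, Polynomial.aeval_X,
      Polynomial.aeval_C]
    rfl
  have h1 := DFunLike.congr_fun h G
  rw [AlgHom.comp_apply, Polynomial.coe_aeval_eq_eval] at h1
  exact h1.trans (DFunLike.congr_fun (coe_aeval_eq_eval _) G)

/-- The homogeneous ideal of the point of the projective plane with coordinates `v`. -/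
def lineIdeal (v : Fin 3 → ℂ) : Ideal (MvPolynomial (Fin 3) ℂ) := RingHom.ker (restrictLine v)

instance (v : Fin 3 → ℂ) : (lineIdeal v).IsPrime := RingHom.ker_isPrime _

theorem mem_lineIdeal_of_eval_eq_zero {v : Fin 3 → ℂ} {n : ℕ} {G : MvPolynomial (Fin 3) ℂ}
    (hG : G.IsHomogeneous n) (h : eval v G = 0) : G ∈ lineIdeal v := by
  refine RingHom.mem_ker.2 (Polynomial.funext fun t => ?_)
  have h1 : eval (fun i => t * v i) G = t ^ n * eval v G :=
    aeval_mul_of_isHomogeneous hG t v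
  rw [eval_restrictLine, Polynomial.eval_zero, h1, h, mul_zero]

theorem exists_eval_ne_zero_of_notMem_lineIdeal {v : Fin 3 → ℂ} {G : MvPolynomial (Fin 3) ℂ}
    (h : G ∉ lineIdeal v) : ∃ t : ℂ, t ≠ 0 ∧ eval (fun i => t * v i) G ≠ 0 := by
  by_contra! h0
  have h1 : Polynomial.X * restrictLine v G = 0 := by
    refine Polynomial.funext fun t => ?_
    rw [Polynomial.eval_mul, Polynomial.eval_X, Polynomial.eval_zero, eval_restrictLine]
    rcases eq_or_ne t 0 with rfl | ht
    · rw [zero_mul]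
    · rw [h0 t ht, mul_zero]
  exact h (RingHom.mem_ker.2 ((mul_eq_zero.1 h1).resolve_left Polynomial.X_ne_zero))

theorem height_lineIdeal_le {v : Fin 3 → ℂ} {c : Fin 3} (hc : v c ≠ 0) :
    (lineIdeal v).height ≤ 2 := by
  set M : Ideal (MvPolynomial (Fin 3) ℂ) :=
    RingHom.ker (eval (fun _ => 0) : MvPolynomial (Fin 3) ℂ →+* ℂ) with hM
  have hMp : M.IsPrime := RingHom.ker_isPrime _
  have hlt : lineIdeal v < M := by
    refine lt_of_le_of_ne (fun G hG => RingHom.mem_ker.2 ?_) fun h => ?_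
    · have h1 := eval_restrictLine v 0 G
      rw [RingHom.mem_ker.1 hG, Polynomial.eval_zero] at h1
      simpa using h1.symm
    · have h1 : X c ∈ lineIdeal v := by
        rw [h, hM, RingHom.mem_ker, eval_X]
      have h2 := eval_restrictLine v 1 (X c)
      rw [RingHom.mem_ker.1 h1, Polynomial.eval_zero, eval_X, one_mul] at h2
      exact hc h2.symm
  have h1 := Ideal.height_add_one_le_of_lt_of_isPrime hlt
  have h2 : (M.height : WithBot ℕ∞) ≤ ringKrullDim (MvPolynomial (Fin 3) ℂ) :=
    Ideal.height_le_ringKrullDim_of_isPrime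
  rw [MvPolynomial.ringKrullDim_of_isNoetherianRing, ringKrullDim_eq_zero_of_field, zero_add,
    Nat.card_fin] at h2
  have h3 : M.height ≤ 3 := WithBot.coe_le_coe.1 h2
  have h4 : (lineIdeal v).height + 1 ≤ 2 + 1 := h1.trans (by rwa [two_add_one_eq_three])
  exact (ENat.add_le_add_iff_right (by simp)).1 h4

/-- The ideal of a singular point is a minimal prime over the Jacobian ideal, as both have
height two. -/
theorem lineIdeal_mem_minimalPrimes {F : MvPolynomial (Fin 3) ℂ} (hF : Squarefree F)
    {v : Fin 3 → ℂ} {c : Fin 3} (hc : v c ≠ 0) (h : jacobianIdeal F ≤ lineIdeal v) :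
    lineIdeal v ∈ (jacobianIdeal F).minimalPrimes := by
  have hle := height_lineIdeal_le hc
  have : (lineIdeal v).FiniteHeight :=
    (lineIdeal v).finiteHeight_iff.2 (Or.inr (ne_top_of_le_ne_top (by decide) hle))
  exact Ideal.mem_minimalPrimes_of_height_le h (hle.trans (two_le_height_jacobianIdeal hF))

/-- Elements of a minimal prime over `I` are nilpotent modulo `I`, locally at that prime. -/
theorem exists_mul_pow_mem_of_mem_minimalPrimes {R : Type*} [CommRing R] {I P : Ideal R}
    (hP : P ∈ I.minimalPrimes) {x : R} (hx : x ∈ P) : ∃ s ∉ P, ∃ n : ℕ, s * x ^ n ∈ I := by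
  have hprime : P.IsPrime := hP.1.1
  by_contra! h
  have hd : Disjoint (I : Set R) (P.primeCompl ⊔ Submonoid.powers x : Submonoid R) := by
    rw [Set.disjoint_left]
    intro a ha hS
    obtain ⟨s, hs, y, ⟨n, rfl⟩, rfl⟩ := Submonoid.mem_sup.1 hS
    exact h s hs n ha
  obtain ⟨Q, hQ, hIQ, hQS⟩ := Ideal.exists_le_prime_disjoint I _ hd
  have hQP : Q ≤ P := fun a ha => by
    by_contra haP
    exact Set.disjoint_left.1 hQS ha
      ((le_sup_left : P.primeCompl ≤ P.primeCompl ⊔ Submonoid.powers x) haP)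
  exact Set.disjoint_left.1 hQS (hP.2 ⟨hQ, hIQ⟩ hQP hx)
    ((le_sup_right : Submonoid.powers x ≤ P.primeCompl ⊔ Submonoid.powers x)
      (Submonoid.mem_powers x))

/-- A common divisor of powers of `x` and `y` has nonzero constant term, since its initial
exponent in the lexicographic order divides those of both powers. -/
theorem constantCoeff_ne_zero_of_dvd {g : MvPowerSeries (Fin 2) ℂ} {N : Fin 2 → ℕ}
    (h : ∀ j, g ∣ MvPowerSeries.X j ^ N j) : MvPowerSeries.constantCoeff g ≠ 0 := by
  classical
  have hX : ∀ j, (MvPowerSeries.X j ^ N j : MvPowerSeries (Fin 2) ℂ) ≠ 0 := fun j h0 => by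
    have h1 := congrArg (MvPowerSeries.coeff (Finsupp.single j (N j))) h0
    rw [MvPowerSeries.coeff_X_pow, if_pos rfl, map_zero] at h1
    exact one_ne_zero h1
  have hg : g ≠ 0 := by
    rintro rfl
    exact hX 0 (zero_dvd_iff.1 (h 0))
  obtain ⟨d, hd⟩ := MvPowerSeries.exists_finsupp_eq_lexOrder_of_ne_zero hg
  have key : ∀ j k, k ≠ j → d k = 0 := by
    intro j k hkj
    obtain ⟨a, ha⟩ := h j
    have ha0 : a ≠ 0 := fun h0 => hX j (by rw [ha, h0, mul_zero])
    obtain ⟨e, he⟩ := MvPowerSeries.exists_finsupp_eq_lexOrder_of_ne_zero ha0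
    have h1 := MvPowerSeries.coeff_mul_of_add_lexOrder hd he
    rw [← ha, MvPowerSeries.coeff_X_pow] at h1
    have h2 := mul_ne_zero (MvPowerSeries.coeff_ne_zero_of_lexOrder hd.symm)
      (MvPowerSeries.coeff_ne_zero_of_lexOrder he.symm)
    rw [← h1] at h2
    have h3 : d + e = Finsupp.single j (N j) := by
      by_contra h3
      exact h2 (if_neg h3)
    have h4 := DFunLike.congr_fun h3 k
    rw [Finsupp.add_apply, Finsupp.single_eq_of_ne hkj] at h4
    omega
  have hd0 : d = 0 := by
    ext k
    fin_cases k
    · exact key 1 0 (by decide)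
    · exact key 0 1 (by decide)
  rw [← MvPowerSeries.coeff_zero_eq_constantCoeff_apply, ← hd0]
  exact MvPowerSeries.coeff_ne_zero_of_lexOrder hd.symm

/-! ### Germs of a reduced projective curve -/

/-- The affine coordinates `(1, w 0 + x, w 1 + y)`, the constant `1` being in position `c`. -/
def affineCoord (c : Fin 3) (w : Fin 2 → ℂ) : Fin 3 → MvPolynomial (Fin 2) ℂ :=
  c.insertNth (α := fun _ => MvPolynomial (Fin 2) ℂ) 1 fun j => C (w j) + X j

theorem affineCoord_self (c : Fin 3) (w : Fin 2 → ℂ) : affineCoord c w c = 1 :=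
  Fin.insertNth_apply_same _ _ _

theorem affineCoord_succAbove (c : Fin 3) (w : Fin 2 → ℂ) (j : Fin 2) :
    affineCoord c w (c.succAbove j) = C (w j) + X j :=
  Fin.insertNth_apply_succAbove _ _ _ _

theorem pderiv_affineCoord (c : Fin 3) (w : Fin 2 → ℂ) (j : Fin 2) (i : Fin 3) :
    pderiv j (affineCoord c w i) = if i = c.succAbove j then 1 else 0 := by
  rcases Fin.eq_self_or_eq_succAbove c i with rfl | ⟨k, rfl⟩
  · rw [affineCoord_self, if_neg (Fin.ne_succAbove _ _), ← C_1, pderiv_C]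
  · rw [affineCoord_succAbove, map_add, pderiv_C, zero_add, pderiv_X, Pi.single_apply]
    simp only [Fin.succAbove_right_inj]

theorem pderiv_aeval_affineCoord (c : Fin 3) (w : Fin 2 → ℂ) (j : Fin 2)
    (P : MvPolynomial (Fin 3) ℂ) :
    pderiv j (aeval (affineCoord c w) P) =
      aeval (affineCoord c w) (pderiv (c.succAbove j) P) := by
  classical
  induction P using MvPolynomial.induction_on with
  | C a => rw [aeval_C, algebraMap_eq, pderiv_C, pderiv_C, map_zero]
  | add p q hp hq => rw [map_add, map_add, hp, hq, map_add, map_add]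
  | mul_X p i hp =>
    rw [map_mul, Derivation.leibniz, hp, aeval_X, pderiv_affineCoord, Derivation.leibniz,
      pderiv_X, Pi.single_apply]
    simp only [smul_eq_mul, map_add, map_mul, aeval_X]
    split_ifs <;> simp

/-- A factor of a power series `f` that occurs twice divides the derivatives of `f`. -/
theorem dvd_pderiv_of_mul_self_dvd {f g : MvPowerSeries (Fin 2) ℂ} (h : g * g ∣ f) (j : Fin 2) :
    g ∣ MvPowerSeries.pderiv ℂ j f := by
  obtain ⟨a, rfl⟩ := h
  rw [Derivation.leibniz, Derivation.leibniz]
  simp only [smul_eq_mul]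
  exact ⟨g * MvPowerSeries.pderiv ℂ j a + a * (2 * MvPowerSeries.pderiv ℂ j g), by ring⟩

/-- If the local equation has a multiple factor `g`, then `g` divides the restrictions of all
elements of the Jacobian ideal to the affine plane on which the coordinate `c` is `t`. -/
theorem dvd_aeval_of_mem_jacobianIdeal {n : ℕ} {F : MvPolynomial (Fin 3) ℂ}
    (hF : F.IsHomogeneous n) {c : Fin 3} {w : Fin 2 → ℂ} {g : MvPowerSeries (Fin 2) ℂ}
    (hg : g * g ∣ (aeval (affineCoord c w) F : MvPolynomial (Fin 2) ℂ))
    (t : ℂ) {G : MvPolynomial (Fin 3) ℂ} (hG : G ∈ jacobianIdeal F) :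
    g ∣ (aeval (fun i => C t * affineCoord c w i) G : MvPolynomial (Fin 2) ℂ) := by
  have hsub : jacobianIdeal F ≤ (Ideal.span {g}).comap
      ((coeToMvPowerSeries.ringHom (R := ℂ) (σ := Fin 2)).comp
        (aeval (fun i => C t * affineCoord c w i)).toRingHom) := by
    have hhom : ∀ {m : ℕ} {H : MvPolynomial (Fin 3) ℂ}, H.IsHomogeneous m →
        g ∣ (aeval (affineCoord c w) H : MvPolynomial (Fin 2) ℂ) →
        H ∈ (Ideal.span {g}).comap ((coeToMvPowerSeries.ringHom (R := ℂ) (σ := Fin 2)).comp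
          (aeval (fun i => C t * affineCoord c w i)).toRingHom) := by
      intro m H hH h
      refine Ideal.mem_comap.2 (Ideal.mem_span_singleton.2 ?_)
      change g ∣ (aeval (fun i => C t * affineCoord c w i) H : MvPolynomial (Fin 2) ℂ)
      rw [aeval_mul_of_isHomogeneous hH, MvPolynomial.coe_mul]
      exact h.mul_left _
    have hF0 : g ∣ (aeval (affineCoord c w) F : MvPolynomial (Fin 2) ℂ) :=
      (dvd_mul_right g g).trans hg
    have hFj : ∀ j, g ∣
        (aeval (affineCoord c w) (pderiv (c.succAbove j) F) : MvPolynomial (Fin 2) ℂ) := by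
      intro j
      rw [← pderiv_aeval_affineCoord, ← MvPowerSeries.pderiv_coe]
      exact dvd_pderiv_of_mul_self_dvd hg j
    refine jacobianIdeal_le (hhom hF hF0) fun i => hhom hF.pderiv ?_
    rcases Fin.eq_self_or_eq_succAbove c i with rfl | ⟨j, rfl⟩
    · -- the derivative in the direction of the chart is given by Euler's identity
      have h1 := congrArg (fun H => ((aeval (affineCoord i w) H : MvPolynomial (Fin 2) ℂ) :
        MvPowerSeries (Fin 2) ℂ)) hF.sum_X_mul_pderiv
      simp only [Fin.sum_univ_succAbove _ i, map_add, map_mul, aeval_X, affineCoord_self,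
        one_mul, nsmul_eq_mul, MvPolynomial.coe_add, MvPolynomial.coe_mul, map_natCast,
        Fin.sum_univ_two] at h1
      rw [← eq_sub_iff_add_eq] at h1
      rw [h1]
      exact (hF0.mul_left _).sub (((hFj 0).mul_left _).add ((hFj 1).mul_left _))
    · exact hFj j
  exact Ideal.mem_span_singleton.1 (Ideal.mem_comap.1 (hsub hG))

/-- The affine plane on which the coordinate `c` is `t * v c` is parametrized so that the origin
is sent to `t * v`. -/
theorem constantCoeff_aeval_affineCoord (c : Fin 3) (v : Fin 3 → ℂ) (hc : v c ≠ 0) (t : ℂ)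
    (G : MvPolynomial (Fin 3) ℂ) :
    constantCoeff (aeval (fun i => C (t * v c) *
      affineCoord c (fun j => v (c.succAbove j) / v c) i) G) = eval (fun i => t * v i) G := by
  rw [map_aeval]
  change eval₂ _ _ _ = _
  rw [eval, coe_eval₂Hom]
  congr 1
  · ext a
    simp
  · funext i
    rcases Fin.eq_self_or_eq_succAbove c i with rfl | ⟨j, rfl⟩
    · rw [affineCoord_self]
      simp
    · rw [affineCoord_succAbove]
      simp
      field_simp

/-- The local equation of a reduced curve has no multiple factors: such a factor would divide a
power of each of the local coordinates, since these lie in the ideal of the point, which is a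
minimal prime over the Jacobian ideal. -/
theorem squarefree_polyGerm_aeval {n : ℕ} {F : MvPolynomial (Fin 3) ℂ}
    (hF : F.IsHomogeneous n) (hsq : Squarefree F) {c : Fin 3} {v : Fin 3 → ℂ} (hc : v c ≠ 0)
    (hv : jacobianIdeal F ≤ lineIdeal v) :
    Squarefree (polyGerm
      (aeval (affineCoord c fun j => v (c.succAbove j) / v c) F)) := by
  set w : Fin 2 → ℂ := fun j => v (c.succAbove j) / v c with hw
  rintro g ⟨q, hq⟩
  have hg : (g : MvPowerSeries (Fin 2) ℂ) * g ∣
      (aeval (affineCoord c w) F : MvPolynomial (Fin 2) ℂ) :=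
    ⟨q, congrArg Subtype.val hq⟩
  have key : ∀ j, ∃ N : ℕ, (g : MvPowerSeries (Fin 2) ℂ) ∣ MvPowerSeries.X j ^ N := by
    intro j
    have hG : X (c.succAbove j) - C (w j) * X c ∈ lineIdeal v := by
      refine mem_lineIdeal_of_eval_eq_zero ((isHomogeneous_X _ _).sub
        (isHomogeneous_C_mul_X _ _)) ?_
      simp [hw, hc]
    obtain ⟨s, hs, N, hN⟩ :=
      exists_mul_pow_mem_of_mem_minimalPrimes (lineIdeal_mem_minimalPrimes hsq hc hv) hG
    -- the plane is moved away from the zeros of `s` on the line, so that `s` becomes a unit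
    obtain ⟨t, ht, hst⟩ := exists_eval_ne_zero_of_notMem_lineIdeal hs
    have h1 := dvd_aeval_of_mem_jacobianIdeal hF hg (t * v c) hN
    rw [← constantCoeff_aeval_affineCoord c v hc] at hst
    have hu : IsUnit ((aeval (fun i => C (t * v c) * affineCoord c w i) s :
        MvPolynomial (Fin 2) ℂ) : MvPowerSeries (Fin 2) ℂ) := by
      rw [MvPowerSeries.isUnit_iff_constantCoeff, isUnit_iff_ne_zero,
        ← MvPowerSeries.coeff_zero_eq_constantCoeff_apply, coeff_coe]
      exact hst
    have h2 : aeval (fun i => C (t * v c) * affineCoord c w i)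
        (X (c.succAbove j) - C (w j) * X c) = C (t * v c) * X j := by
      rw [map_sub, map_mul (aeval _), aeval_X, aeval_X, aeval_C, algebraMap_eq, affineCoord_self,
        affineCoord_succAbove]
      ring
    rw [map_mul, map_pow, h2, MvPolynomial.coe_mul, hu.dvd_mul_left, MvPolynomial.coe_pow,
      MvPolynomial.coe_mul, mul_pow, coe_C, coe_X] at h1
    refine ⟨N, (IsUnit.dvd_mul_left ?_).1 h1⟩
    exact ((isUnit_iff_ne_zero.2 (mul_ne_zero ht hc)).map MvPowerSeries.C).pow N
  choose N hN using key
  have h0 := constantCoeff_ne_zero_of_dvd hN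
  rw [isUnit_iff, cf]
  simpa [expo] using h0

theorem finsum_mem_eq_ncard {α : Type*} {s : Set α} (hs : s.Finite) {f : α → ℤ}
    {P : α → Prop} (h1 : ∀ a ∈ s, P a → f a = 1) (h0 : ∀ a ∈ s, ¬ P a → f a = 0) :
    ∑ᶠ a ∈ s, f a = ({a ∈ s | P a}.ncard : ℤ) := by
  classical
  rw [finsum_mem_eq_finite_toFinset_sum _ hs, Set.ncard_eq_toFinset_card _ (hs.sep P)]
  have hfil : (hs.sep P).toFinset = hs.toFinset.filter P := by
    ext a
    simp
  rw [hfil, Finset.card_filter, Nat.cast_sum]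
  refine Finset.sum_congr rfl fun a ha => ?_
  rw [Set.Finite.mem_toFinset] at ha
  split_ifs with h
  · rw [h1 a ha h, Nat.cast_one]
  · rw [h0 a ha h, Nat.cast_zero]

end PlaneCurve

namespace ReducedPlaneCurve

open PlaneCurve

variable (C : ReducedPlaneCurve)

theorem jacobianIdeal_le_lineIdeal {p : Point} (hp : p ∈ C.singularPoints) :
    jacobianIdeal C.form ≤ lineIdeal p.rep :=
  jacobianIdeal_le (mem_lineIdeal_of_eval_eq_zero C.isHomogeneous hp.1) fun i =>
    mem_lineIdeal_of_eval_eq_zero C.isHomogeneous.pderiv (hp.2 i)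

theorem lineIdeal_rep_injective : Function.Injective fun p : Point => lineIdeal p.rep := by
  intro p q h
  replace h : lineIdeal p.rep = lineIdeal q.rep := h
  have hprop : ∀ i, p.rep (chart p) * q.rep i = p.rep i * q.rep (chart p) := by
    intro i
    have h1 : MvPolynomial.C (p.rep (chart p)) * X i - MvPolynomial.C (p.rep i) * X (chart p) ∈
        lineIdeal p.rep := by
      refine mem_lineIdeal_of_eval_eq_zero
        ((isHomogeneous_C_mul_X _ _).sub (isHomogeneous_C_mul_X _ _)) ?_
      simp [mul_comm]
    have h2 := eval_restrictLine q.rep 1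
      (MvPolynomial.C (p.rep (chart p)) * X i - MvPolynomial.C (p.rep i) * X (chart p))
    have h3 : MvPolynomial.C (p.rep (chart p)) * X i - MvPolynomial.C (p.rep i) * X (chart p) ∈
        lineIdeal q.rep := h ▸ h1
    rw [RingHom.mem_ker.1 h3] at h2
    simp only [Polynomial.eval_zero, one_mul, eval_sub, eval_mul, eval_C, eval_X] at h2
    exact sub_eq_zero.1 h2.symm
  rw [← p.mk_rep, ← q.mk_rep, Projectivization.mk_eq_mk_iff']
  have hc := rep_chart_ne_zero p
  have hq : q.rep (chart p) ≠ 0 := by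
    intro h0
    refine q.rep_nonzero (funext fun i => ?_)
    have := hprop i
    rw [h0, mul_zero] at this
    exact (mul_eq_zero.1 this).resolve_left hc
  refine ⟨p.rep (chart p) / q.rep (chart p), funext fun i => ?_⟩
  rw [Pi.smul_apply, smul_eq_mul, div_mul_eq_mul_div, hprop, mul_div_cancel_right₀ _ hq]

/-- The singular points correspond to certain minimal primes over the Jacobian ideal. -/
theorem finite_singularPoints : C.singularPoints.Finite := by
  refine Set.Finite.of_finite_image (f := fun p : Point => lineIdeal p.rep)
    ((Ideal.finite_minimalPrimes_of_isNoetherianRing _ (jacobianIdeal C.form)).subset ?_)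
    lineIdeal_rep_injective.injOn
  rintro _ ⟨p, hp, rfl⟩
  exact lineIdeal_mem_minimalPrimes C.squarefree (rep_chart_ne_zero p)
    (C.jacobianIdeal_le_lineIdeal hp)

theorem squarefree_germ {p : Point} (hp : p ∈ C.singularPoints) : Squarefree (C.germ p) :=
  squarefree_polyGerm_aeval C.isHomogeneous C.squarefree (rep_chart_ne_zero p)
    (C.jacobianIdeal_le_lineIdeal hp)

theorem not_isUnit_germ {p : Point} (hp : p ∈ C.singularPoints) : ¬ IsUnit (C.germ p) := by
  rw [isUnit_iff, not_not]
  have h1 := constantCoeff_aeval_affineCoord (chart p) p.rep (rep_chart_ne_zero p)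
    (p.rep (chart p))⁻¹ C.form
  have h2 : eval (fun i => (p.rep (chart p))⁻¹ * p.rep i) C.form =
      (p.rep (chart p))⁻¹ ^ C.degree * eval p.rep C.form :=
    aeval_mul_of_isHomogeneous C.isHomogeneous _ _
  rw [h2, hp.1, mul_zero, inv_mul_cancel₀ (rep_chart_ne_zero p)] at h1
  simp only [C_1, one_mul] at h1
  have h3 : expo 0 0 = 0 := by simp [expo]
  rw [cf, h3]
  exact (coeff_coe _ _).trans h1

theorem virtualCusps_nonneg : 0 ≤ C.virtualCusps :=
  finsum_mem_induction (0 ≤ ·) le_rfl (fun _ _ => add_nonneg) fun _ hp =>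
    germVirtualCusps_nonneg (C.squarefree_germ hp).ne_zero

theorem virtualNodes_nonneg : 0 ≤ C.virtualNodes :=
  finsum_mem_induction (0 ≤ ·) le_rfl (fun _ _ => add_nonneg) fun _ hp =>
    germVirtualNodes_nonneg (C.squarefree_germ hp) (C.not_isUnit_germ hp)

theorem virtualCusps_eq_numCusps (h : C.IsCuspidal) : C.virtualCusps = C.numCusps :=
  finsum_mem_eq_ncard C.finite_singularPoints
    (fun _ hp hc => (virtual_of_isOrdinaryCusp (C.squarefree_germ hp) hc).1)
    fun p hp hc => (virtual_of_isOrdinaryNode (C.squarefree_germ hp) ((h p hp).resolve_left hc)).1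

theorem virtualNodes_eq_numNodes (h : C.IsCuspidal) : C.virtualNodes = C.numNodes :=
  finsum_mem_eq_ncard C.finite_singularPoints
    (fun _ hp hc => (virtual_of_isOrdinaryNode (C.squarefree_germ hp) hc).2)
    fun p hp hc => (virtual_of_isOrdinaryCusp (C.squarefree_germ hp) ((h p hp).resolve_right hc)).2

end ReducedPlaneCurve

end

theorem proposition1 :
    (∀ f : convergentSeries, Squarefree f → ¬ IsUnit f →
      FiniteDimensional ℂ (DeltaModule f) ∧
      0 ≤ germVirtualCusps f ∧ 0 ≤ germVirtualNodes f ∧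
      (IsOrdinaryCusp f → germVirtualCusps f = 1 ∧ germVirtualNodes f = 0) ∧
      (IsOrdinaryNode f → germVirtualCusps f = 0 ∧ germVirtualNodes f = 1)) ∧
    (∀ C : ReducedPlaneCurve,
      C.singularPoints.Finite ∧
      (∀ p ∈ C.singularPoints, FiniteDimensional ℂ (DeltaModule (C.germ p))) ∧
      0 ≤ C.virtualCusps ∧ 0 ≤ C.virtualNodes ∧
      (C.IsCuspidal →
        C.virtualCusps = (C.numCusps : ℤ) ∧ C.virtualNodes = (C.numNodes : ℤ))) := by
  refine ⟨fun f hsq hu => ⟨finiteDimensional_deltaModule hsq, germVirtualCusps_nonneg hsq.ne_zero,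
    germVirtualNodes_nonneg hsq hu, virtual_of_isOrdinaryCusp hsq,
    virtual_of_isOrdinaryNode hsq⟩, fun C => ⟨C.finite_singularPoints,
    fun p hp => finiteDimensional_deltaModule (C.squarefree_germ hp), C.virtualCusps_nonneg,
    C.virtualNodes_nonneg, fun h => ⟨C.virtualCusps_eq_numCusps h, C.virtualNodes_eq_numNodes h⟩⟩⟩
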